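/- Fix constants $\delta,\gamma\in\mathbb N$. **Parameters.** On input $1^n$ the system setup $\mathcal S$ outputs $(P,Q,g)$, where $P$ is a uniformly chosen prime of bit length $n+\delta$ such that $\gamma\mid P-1$ and $Q=(P-1)/\gamma$ is prime, and $g$ is a uniformly chosen generator of the subgroup $G_Q\subset\mathbb Z_P^*$ of order $Q$. (Values of $n$ for which there is no such prime are disregarded; all advantages are $0$ there.) **Scheme.** Key generation chooses $x_A,x_B$ uniformly in $\mathbb Z_Q$ and publishes $y_A=g^{x_A}$, $y_B=g^{x_B}$. Encryption of $m\in G_Q$ is $(y_1,y_2)=(g^{k_A},\,m\,y_A^{k_A})$; re-encryption of $(y_1,y_2)$ is $(y_1,\,g^{k_B},\,y_2\,y_B^{k_B})$; so the two-layer ciphertext of $m$ is $(g^{k_A},g^{k_B},m\,y_A^{k_A}y_B^{k_B})$, with $k_A,k_B$ uniform in $\mathbb Z_Q$ and everything modulo $P$. **Indistinguishability.** An adversary is a pair $(F,A)$ of probabilistic polynomial-time (p.p.t.) Turing machines. $F$, on input $(1^n,P,Q,g,y_A,y_B)$, outputs two messages $m_0,m_1$ and a state $s$; $A$, on input $(1^n,P,Q,g,y_A,y_B)$,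 a two-layer ciphertext of $m_b$, and $s$, outputs a bit (if $m_0,m_1$ are not both in $G_Q$, the experiment returns $0$). The advantage of $(F,A)$ is the absolute value of the difference between the probabilities that the experiment returns $1$ for $b=1$ and for $b=0$; it is considered for fixed $(P,Q,g)$, or for $(P,Q,g)\leftarrow\mathcal S(1^n)$. The scheme is *secure in the sense of indistinguishability* if for all p.p.t. $(F,A)$ the advantage over $(P,Q,g)\leftarrow\mathcal S(1^n)$ is negligible, i.e. $o(n^{-d})$ for all $d$. **Decision Diffie–Hellman.** A machine $M$ *solves DDH for $(n,P,Q,g)$ with probability at least $p$* if for all $a,b,c\in\mathbb Z_Q$, on input $(1^n,P,Q,g,g^a,g^b,g^c)$, it outputs the correct answer (one bit) to the question whether $g^c=g^{ab}$ with probability at least $p$ over its coin tosses. The *DDH assumption* says that for every p.p.t. Turing machine $D$ the probabilities that $D$ outputs $1$ on $(1^n,P,Q,g,g^a,g^b,g^{ab})$ and on $(1^n,P,Q,g,g^a,g^b,g^c)$, where $(P,Q,g)\leftarrow\mathcal S(1^n)$ and $a,b,c$ are uniform in $\mathbb Z_Q$, differ by a negligible function of $n$. **Theorem.** 1. For all p.p.t.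 Turing machines $F,A$ and every $d\in\mathbb N$ there are a p.p.t. Turing machine $M$ and a negligible function $\varepsilon$ such that, for every $n$ and every possible output $(P,Q,g)$ of $\mathcal S(1^n)$ for which the advantage $\alpha$ of $(F,A)$ satisfies $n^d\alpha\ge 1$, the machine $M$ solves DDH for $(n,P,Q,g)$ with probability at least $1-\varepsilon(n)$. 2. If the two-layer ElGamal re-encryption scheme is not secure in the sense of indistinguishability, then there exists a p.p.t. Turing machine $M$ that solves the decision Diffie–Hellman problem with overwhelming probability, that is: there are a negligible function $\varepsilon$ and $d\in\mathbb N$ such that for infinitely many $n$, with probability $\rho$ satisfying $n^d\rho\ge 1$ over $(P,Q,g)\leftarrow\mathcal S(1^n)$, the machine $M$ solves DDH for $(n,P,Q,g)$ with probability at least $1-\varepsilon(n)$. 3. Under the DDH assumption the two-layer ElGamal re-encryption scheme is secure in the sense of indistinguishability. -/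

import Mathlib

open Filter Finset

/-! ## Words, encodings, probabilistic polynomial-time Turing machines -/

/-- The input/output alphabet: the two bits `some false`, `some true` and a separator `none`. -/
abbrev IOSymbol := Option Bool

abbrev Word := List IOSymbol

/-- Binary expansion of a natural number, least significant bit first. -/
def encNat (m : ℕ) : Word := m.bits.map some

/-- The number with a given binary expansion, least significant bit first. -/
def decNat (w : Word) : ℕ :=
  w.foldr (fun s acc => (if s = some true then 1 else 0) + 2 * acc) 0

/-- The unary word `1ⁿ`. -/
def unary (n : ℕ) : Word := List.replicate n (some true)

/-- A tuple of words, each one terminated by the separator. -/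
def encFields (ws : List Word) : Word := ws.flatMap (fun w => w ++ [none])

/-- The part of a word before its first separator. -/
def headField (w : Word) : Word := w.takeWhile Option.isSome

/-- The part of a word after its first separator. -/
def tailFields (w : Word) : Word := (w.dropWhile Option.isSome).tail

/-- A probabilistic Turing machine: a multi-stack Turing machine with two transition programs,
`tm.m` and `m'`. Before each step a fair coin decides which of the two is applied. -/
structure ProbTM where
  tm : Turing.FinTM2
  m' : tm.Λ → Turing.TM2.Stmt tm.Γ tm.Λ tm.σ
  finΓ : ∀ k, Finite (tm.Γ k)
  inp : IOSymbol ≃ tm.Γ tm.k₀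
  out : tm.Γ tm.k₁ ≃ IOSymbol

namespace ProbTM

/-- One step with a given coin; a halted configuration does not change. -/
def stepWith (M : ProbTM) (coin : Bool) (c : M.tm.Cfg) : M.tm.Cfg :=
  (Turing.TM2.step (if coin then M.m' else M.tm.m) c).getD c

/-- The initial configuration on input `x`: all stacks are empty except the input stack. -/
def init (M : ProbTM) (x : Word) : M.tm.Cfg where
  l := some M.tm.main
  var := M.tm.initialState
  stk := Function.update (fun _ => []) M.tm.k₀ (x.map M.inp)

/-- The distribution of the configuration after `t` steps from `c`. -/
noncomputable def run (M : ProbTM) : ℕ → M.tm.Cfg → PMF M.tm.Cfg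
  | 0, c => PMF.pure c
  | t + 1, c => (PMF.uniformOfFintype Bool).bind fun coin => M.run t (M.stepWith coin c)

/-- The machine is in the halting state. -/
def Halted (M : ProbTM) (c : M.tm.Cfg) : Prop := Turing.TM2.Cfg.l c = none

/-- The word on the output stack. -/
def read (M : ProbTM) (c : M.tm.Cfg) : Word := (Turing.TM2.Cfg.stk c M.tm.k₁).map M.out

end ProbTM

/-- A probabilistic polynomial-time Turing machine: for some polynomial `time`, on every input `x`
and for all coin tosses it halts within `time |x|` steps. -/
structure PPT extends ProbTM where
  time : Polynomial ℕ
  halts : ∀ (x : Word), ∀ c ∈ (toProbTM.run (time.eval x.length) (toProbTM.init x)).support,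
    toProbTM.Halted c

/-- The distribution of the output of `M` on input `x`. -/
noncomputable def PPT.output (M : PPT) (x : Word) : PMF Word :=
  (M.toProbTM.run (M.time.eval x.length) (M.toProbTM.init x)).map M.toProbTM.read

/-- Negligible functions of the security parameter. -/
def Negligible (f : ℕ → ℝ) : Prop :=
  Asymptotics.SuperpolynomialDecay atTop (fun n : ℕ => (n : ℝ)) f

/-! ## System parameters -/

/-- System parameters `(P, Q, g)`. -/
structure Params where
  P : ℕ
  Q : ℕ
  g : ℕ

/-- The primes `P` of bit length `n + δ` such that `Q = (P - 1) / γ` is a prime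
(and `γ` divides `P - 1`). -/
def moduli (δ γ n : ℕ) : Finset ℕ :=
  {P ∈ range (2 ^ (n + δ)) | P.Prime ∧ P.size = n + δ ∧ γ ∣ P - 1 ∧ ((P - 1) / γ).Prime}

open Classical in
/-- The generators of the subgroup `G_Q` of order `Q` of `ℤ_P^*`. -/
noncomputable def generators (P Q : ℕ) : Finset ℕ := {g ∈ range P | orderOf (g : ZMod P) = Q}

/-- `(P, Q, g)` is a possible output of the system setup on input `1ⁿ`. -/
def Params.IsInstance (δ γ n : ℕ) (pp : Params) : Prop :=
  pp.P ∈ moduli δ γ n ∧ pp.Q = (pp.P - 1) / γ ∧ pp.g ∈ generators pp.P pp.Q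

/-- The least residues modulo `P` of the elements of the group `G_Q` generated by `g`. -/
def Params.group (pp : Params) : Set ℕ :=
  {m | m < pp.P ∧ (m : ZMod pp.P) ∈ Submonoid.powers (pp.g : ZMod pp.P)}

/-- The uniform distribution on a nonempty finite set of numbers
(for the empty set: the point mass at `0`). -/
noncomputable def unif (s : Finset ℕ) : PMF ℕ :=
  if h : s.Nonempty then PMF.uniformOfFinset s h else PMF.pure 0

/-- System setup on input `1ⁿ`: a uniform prime `P`, then a uniform generator `g`. It is used only
when `moduli δ γ n` is nonempty. -/
noncomputable def setup (δ γ n : ℕ) : PMF Params := do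
  let P ← unif (moduli δ γ n)
  let g ← unif (generators P ((P - 1) / γ))
  return ⟨P, (P - 1) / γ, g⟩

/-! ## The re-encryption scheme -/

/-- Uniform element of `ℤ_Q`. -/
noncomputable def exponent (pp : Params) : PMF ℕ := unif (range pp.Q)

/-- `g ^ x mod P`. -/
def Params.pow (pp : Params) (x : ℕ) : ℕ := pp.g ^ x % pp.P

/-- ElGamal encryption `(g^k, m y^k)` of `m` under the public key `y`. -/
noncomputable def encrypt (pp : Params) (y m : ℕ) : PMF (ℕ × ℕ) := do
  let k ← exponent pp
  return (pp.pow k, m * y ^ k % pp.P)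

/-- Re-encryption `(y₁, g^k, y₂ y^k)` of the ciphertext `(y₁, y₂)` under the public key `y`. -/
noncomputable def reEncrypt (pp : Params) (y : ℕ) (ct : ℕ × ℕ) : PMF (ℕ × ℕ × ℕ) := do
  let k ← exponent pp
  return (ct.1, pp.pow k, ct.2 * y ^ k % pp.P)

/-- Key generation: a private key `x` in `ℤ_Q` and the public key `g ^ x mod P`. -/
noncomputable def keyGen (pp : Params) : PMF (ℕ × ℕ) := do
  let x ← exponent pp
  return (x, pp.pow x)

/-! ## Indistinguishability of encryptions -/

/-- The public information `(1ⁿ, P, Q, g, y_A, y_B)`. -/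
def publicFields (n : ℕ) (pp : Params) (yA yB : ℕ) : List Word :=
  [unary n, encNat pp.P, encNat pp.Q, encNat pp.g, encNat yA, encNat yB]

open Classical in
/-- The indistinguishability experiment. `F` sees the public information and outputs two messages
`m₀`, `m₁` and a state; `A` sees the public information, the two-layer encryption of `m_b` and the
state. The result is `true` iff `A` outputs the bit `1`; it is `false` if `m₀`, `m₁` are not
both elements of `G_Q`. -/
noncomputable def indGame (F A : PPT) (n : ℕ) (pp : Params) (b : Bool) : PMF Bool := do
  let kA ← keyGen pp
  let kB ← keyGen pp
  let w ← F.output (encFields (publicFields n pp kA.2 kB.2))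
  let m₀ := decNat (headField w)
  let m₁ := decNat (headField (tailFields w))
  let state := tailFields (tailFields w)
  if m₀ ∈ pp.group ∧ m₁ ∈ pp.group then do
    let ct ← encrypt pp kA.2 (if b then m₁ else m₀)
    let c ← reEncrypt pp kB.2 ct
    let r ← A.output (encFields
      (publicFields n pp kA.2 kB.2 ++ [encNat c.1, encNat c.2.1, encNat c.2.2]) ++ state)
    return decide (r = [some true])
  else return false

/-- The advantage of `(F, A)` for fixed system parameters. -/
noncomputable def indAdvantageAt (F A : PPT) (n : ℕ) (pp : Params) : ℝ :=
  |(indGame F A n pp true true).toReal - (indGame F A n pp false true).toReal|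

open Classical in
/-- The advantage of `(F, A)` for random system parameters
(`0` if there are none for this value of `n`). -/
noncomputable def indAdvantage (δ γ : ℕ) (F A : PPT) (n : ℕ) : ℝ :=
  if (moduli δ γ n).Nonempty then
    |((setup δ γ n).bind (fun pp => indGame F A n pp true) true).toReal -
      ((setup δ γ n).bind (fun pp => indGame F A n pp false) true).toReal|
  else 0

/-- The re-encryption scheme is secure in the sense of indistinguishability. -/
def INDSecure (δ γ : ℕ) : Prop := ∀ F A : PPT, Negligible (indAdvantage δ γ F A)

/-! ## The decision Diffie-Hellman problem -/

/-- The input `(1ⁿ, P, Q, g, X, Y, Z)` of a machine for the decision Diffie-Hellman problem. -/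
def ddhInput (n : ℕ) (pp : Params) (X Y Z : ℕ) : Word :=
  encFields [unary n, encNat pp.P, encNat pp.Q, encNat pp.g, encNat X, encNat Y, encNat Z]

/-- For the parameters `(P, Q, g)`, on every triple `(g^a, g^b, g^c)` the machine `M` outputs,
with probability at least `p` over its coins, the correct answer to the question
whether `g^c = g^(ab)`, as a single bit. -/
def SolvesDDHAt (M : PPT) (n : ℕ) (pp : Params) (p : ℝ) : Prop :=
  ∀ a < pp.Q, ∀ b < pp.Q, ∀ c < pp.Q,
    p ≤ (M.output (ddhInput n pp (pp.pow a) (pp.pow b) (pp.pow c))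
      [some (decide (pp.pow c = pp.pow (a * b)))]).toReal

/-- `M` solves the decision Diffie-Hellman problem with overwhelming probability, for infinitely
many `n`, on a non-negligible fraction of the system parameters generated by the setup. -/
def SolvesDDH (δ γ : ℕ) (M : PPT) : Prop :=
  ∃ ε : ℕ → ℝ, Negligible ε ∧ ∃ d : ℕ, ∃ᶠ n : ℕ in atTop, (moduli δ γ n).Nonempty ∧
    1 ≤ (n : ℝ) ^ d *
      ((setup δ γ n).toOuterMeasure {pp | SolvesDDHAt M n pp (1 - ε n)}).toReal

/-- The experiment in which `D` gets `(g^a, g^b, g^(ab))` if `real` is true and `(g^a, g^b, g^c)`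
otherwise; the result is `true` iff `D` outputs the bit `1`. -/
noncomputable def ddhGame (D : PPT) (n : ℕ) (pp : Params) (real : Bool) : PMF Bool := do
  let a ← exponent pp
  let b ← exponent pp
  let c ← exponent pp
  let r ← D.output (ddhInput n pp (pp.pow a) (pp.pow b)
    (if real then pp.pow (a * b) else pp.pow c))
  return decide (r = [some true])

open Classical in
/-- The advantage of `D` as a distinguisher of Diffie-Hellman triples from random triples
(`0` if there are no system parameters for this value of `n`). -/
noncomputable def ddhAdvantage (δ γ : ℕ) (D : PPT) (n : ℕ) : ℝ :=
  if (moduli δ γ n).Nonempty then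
    |((setup δ γ n).bind (fun pp => ddhGame D n pp true) true).toReal -
      ((setup δ γ n).bind (fun pp => ddhGame D n pp false) true).toReal|
  else 0

/-- The decision Diffie-Hellman assumption. -/
def DDHAssumption (δ γ : ℕ) : Prop := ∀ D : PPT, Negligible (ddhAdvantage δ γ D)

/-!
The three claims rest on the random self-reducibility of the Diffie-Hellman problem.
From `(X, Y, Z) = (g^a, g^b, g^c)` and random `u`, `v`, `w` one computes `X' = X^w g^u`,
`Y' = Y g^v` and `Z' = (Z X^v)^w Y'^u`, whose exponents are `a' = w a + u`, `b' = b + v` and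
`c' = a' b' + w (c - a b)`.
If `c = a b`, then `(X', Y', Z')` is a uniform Diffie-Hellman triple; if not, then `w (c - a b)` is
uniform because `Q` is prime, and `(X', Y', Z')` is a uniform triple (`avg_rerandomize_of_eq`,
`avg_rerandomize_of_ne`). Run the indistinguishability experiment with the key `y_A = X'`, with
`Y'` as the first component of the ciphertext, and with `Z'` in the place of `y_A^k_A`; this is
`trial`. In the first case it is the true experiment (`abs_trial_sub_indGame_le`). In the second
case the message is multiplied by a uniform element of `G_Q`, so that the two messages cannot be
told apart (`avg_layered_eq`, `abs_trial_sub_blind_le`). Fair coins do not give uniform elements of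
`ℤ_Q`; the exponents are random numbers of `n + |P|` bits instead, and each of the five costs a
statistical error of at most `2^-n` (`abs_ev_unif_sub_avg_le`).

If the advantage for `(P, Q, g)` is at least `n^-d`, then the two cases can be separated by
counting the answers `1` among `n^(2d+2)` trials for each message and comparing the counts. By a
Chernoff bound the error is exponentially small (`countOnes_concentration`, `decideDDH_correct`),
which gives `exists_solver`. A non-negligible average advantage means, by Markov's inequality, a
non-negligible fraction of parameters with a non-negligible advantage: `exists_solvesDDH`. The
trials for the two messages are themselves distinguishers. On real triples they behave like the
experiments for the two messages, on random ones their difference is at most `1/Q + 10 * 2^-n`,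
since a random triple is a Diffie-Hellman triple with probability `1/Q`
(`abs_ddhGame_random_sub_le`), and `1/Q` is exponentially small for a fixed `γ`. Hence
`indSecure_of_ddhAssumption`.

That these procedures are carried out by probabilistic polynomial-time machines is proved by
programming. A `Subroutine` is a probabilistic stack program that works in place on word registers;
subroutines can be composed (`seq`, `ite`, `loop`, `rename`), and a given machine can be run as a
subroutine (`call`). A randomized function of a tuple of words is `Samplable` if a subroutine
computes it within polynomially many steps. Samplable functions are closed under sequential
composition, case distinction, calls of machines (`Samplable.output`), and folds over words whose
accumulator stays polynomially long (`Samplable.foldlM`). Binary arithmetic up to modular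
exponentiation (`PolyNat`) and the trials are instances of these rules, and a samplable function of
one word is the output of a machine (`Samplable.exists_ppt`).
-/

open Turing.TM2

/-! ### Coin-tossing processes -/

/-- `Runs step H c T μ`: the process that starts in `c` and applies `step b` for a fresh fair coin
`b` in each round can be stopped, on every path within `T` rounds and before any step from a state
in `H`, so that the state at the stopping time has the distribution `μ`. Different paths may stop
after different numbers of rounds. -/
inductive Runs {C : Type} (step : Bool → C → C) (H : C → Prop) : C → ℕ → PMF C → Prop
  | done (c : C) (T : ℕ) : Runs step H c T (PMF.pure c)
  | step (c : C) (T : ℕ) (μ : Bool → PMF C) (hc : ¬ H c) (h : ∀ b, Runs step H (step b c) T (μ b)) :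
      Runs step H c (T + 1) ((PMF.uniformOfFintype Bool).bind μ)

namespace Runs

variable {C C' : Type} {step : Bool → C → C} {H : C → Prop}

theorem mono {c : C} {T : ℕ} {μ : PMF C} (h : Runs step H c T μ) :
    ∀ {T' : ℕ}, T ≤ T' → Runs step H c T' μ := by
  induction h with
  | done c T => intro T' _; exact .done c T'
  | step c T μ hc _ ih =>
    intro T' hT
    obtain ⟨k, rfl⟩ : ∃ k, T' = k + 1 := ⟨T' - 1, by omega⟩
    exact .step c k μ hc fun b => ih b (by omega)

theorem bind {c : C} {T : ℕ} {μ : PMF C} (h : Runs step H c T μ) {T' : ℕ} {ν : C → PMF C}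
    (hν : ∀ c' ∈ μ.support, Runs step H c' T' (ν c')) : Runs step H c (T + T') (μ.bind ν) := by
  induction h with
  | done c T =>
    rw [PMF.pure_bind]
    exact (hν c (by simp)).mono (by omega)
  | step c T μ hc _ ih =>
    rw [PMF.bind_bind, Nat.add_right_comm]
    refine .step c _ _ hc fun b => ih b fun c' hc' => hν c' ?_
    rw [PMF.mem_support_bind_iff]
    exact ⟨b, by simp, hc'⟩

theorem head {c c' : C} {T : ℕ} {μ : PMF C} (hc : ¬ H c) (hs : ∀ b, step b c = c')
    (h : Runs step H c' T μ) : Runs step H c (T + 1) μ := by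
  have := Runs.step (step := step) c T (fun _ => μ) hc fun b => by rw [hs b]; exact h
  rwa [PMF.bind_const] at this

/-- Simulation: a map that commutes with the steps from running states transports runs. -/
theorem map {step' : Bool → C' → C'} {H' : C' → Prop} (φ : C → C')
    (hH : ∀ c, ¬ H c → ¬ H' (φ c)) (hs : ∀ c b, ¬ H c → step' b (φ c) = φ (step b c))
    {c : C} {T : ℕ} {μ : PMF C} (h : Runs step H c T μ) :
    Runs step' H' (φ c) T (μ.map φ) := by
  induction h with
  | done c T => rw [PMF.pure_map]; exact .done _ _
  | step c T μ hc _ ih =>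
    rw [PMF.map_bind]
    exact .step _ _ _ (hH c hc) fun b => by rw [hs c b hc]; exact ih b

/-- A property whose rank grows by at most one per step holds at the stopping time. -/
theorem support_of_step {P : ℕ → C → Prop} (hP : ∀ n c b, ¬ H c → P n c → P (n + 1) (step b c))
    (hmono : ∀ n c, P n c → P (n + 1) c)
    {c : C} {T : ℕ} {μ : PMF C} (h : Runs step H c T μ) :
    ∀ n, P n c → ∀ c' ∈ μ.support, P (n + T) c' := by
  induction h with
  | done c T =>
    intro n hn c' hc'
    obtain rfl : c' = c := by simpa using hc'
    induction T with
    | zero => exact hn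
    | succ T ih => exact hmono _ _ ih
  | step c T μ hc _ ih =>
    intro n hn c' hc'
    rw [PMF.mem_support_bind_iff] at hc'
    obtain ⟨b, -, hb⟩ := hc'
    have := ih b (n + 1) (hP n c b hc hn) c' hb
    rwa [Nat.add_right_comm, Nat.add_assoc] at this

end Runs

/-! ### Embedding the statements of one stack machine into another -/

namespace Turing.TM2

section Embedding

variable {K K' : Type} {Γ : K → Type} {Γ' : K' → Type} {Λ Λ' σ σ' : Type}

/-- The statement that leaves for the label `x`, or halts if there is none. -/
def leave (x : Option Λ') : Stmt Γ' Λ' σ' :=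
  match x with
  | none => Stmt.halt
  | some l => Stmt.goto fun _ => l

/-- Translation of a statement along a map `i` of stacks, bijections `e` of alphabets, a lens
`(get, set)` on the internal states and a map `lab` of labels; halting becomes leaving for `x`. -/
def Stmt.emb (i : K → K') (e : ∀ k, Γ k ≃ Γ' (i k)) (get : σ' → σ) (set : σ → σ' → σ')
    (lab : Λ → Λ') (x : Option Λ') : Stmt Γ Λ σ → Stmt Γ' Λ' σ'
  | .push k f q => .push (i k) (fun v => e k (f (get v))) (q.emb i e get set lab x)
  | .peek k f q => .peek (i k) (fun v o => set (f (get v) (o.map (e k).symm)) v)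
      (q.emb i e get set lab x)
  | .pop k f q => .pop (i k) (fun v o => set (f (get v) (o.map (e k).symm)) v)
      (q.emb i e get set lab x)
  | .load a q => .load (fun v => set (a (get v)) v) (q.emb i e get set lab x)
  | .branch f q₁ q₂ => .branch (fun v => f (get v)) (q₁.emb i e get set lab x)
      (q₂.emb i e get set lab x)
  | .goto f => .goto fun v => lab (f (get v))
  | .halt => leave x

/-- The map of configurations that goes with `Stmt.emb`. -/
def Cfg.emb (ψ : σ → σ') (φ : (∀ k, List (Γ k)) → ∀ k, List (Γ' k)) (lab : Λ → Λ')
    (x : Option Λ') (c : Cfg Γ Λ σ) : Cfg Γ' Λ' σ' :=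
  ⟨c.l.elim x fun l => some (lab l), ψ c.var, φ c.stk⟩

variable [DecidableEq K] [DecidableEq K']

theorem stepAux_emb {i : K → K'} {e : ∀ k, Γ k ≃ Γ' (i k)} {get : σ' → σ} {set : σ → σ' → σ'}
    {lab : Λ → Λ'} {x : Option Λ'} {ψ : σ → σ'} {φ : (∀ k, List (Γ k)) → ∀ k, List (Γ' k)}
    (hget : ∀ v, get (ψ v) = v) (hset : ∀ v w, set v (ψ w) = ψ v)
    (hφ : ∀ S k l, φ (Function.update S k l) = Function.update (φ S) (i k) (l.map (e k)))
    (q : Stmt Γ Λ σ) : ∀ (v : σ) (S : ∀ k, List (Γ k)),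
    stepAux (q.emb i e get set lab x) (ψ v) (φ S) = (stepAux q v S).emb ψ φ lab x := by
  have hφ' : ∀ S k, φ S (i k) = (S k).map (e k) := fun S k => by
    conv_lhs => rw [← Function.update_eq_self k S, hφ, Function.update_self]
  have hhead : ∀ S k, Option.map (e k).symm ((φ S (i k)).head?) = (S k).head? := fun S k => by
    rw [hφ', List.head?_map, Option.map_map]; simp
  have htail : ∀ S k, (φ S (i k)).tail = ((S k).tail).map (e k) := fun S k => by
    rw [hφ', List.map_tail]
  induction q with
  | push k f q ih => intro v S; simp only [Stmt.emb, stepAux, hget]; rw [← ih, hφ, hφ']; rfl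
  | peek k f q ih => intro v S; simp only [Stmt.emb, stepAux, hget, hset, hhead, ih]
  | pop k f q ih =>
    intro v S; simp only [Stmt.emb, stepAux, hget, hset, hhead]; rw [← ih, hφ, htail]
  | load a q ih => intro v S; simp only [Stmt.emb, stepAux, hget, hset, ih]
  | branch f q₁ q₂ ih₁ ih₂ =>
    intro v S; simp only [Stmt.emb, stepAux, hget]; cases f v <;> simp [ih₁, ih₂]
  | goto f => intro v S; simp [Stmt.emb, stepAux, hget, Cfg.emb]
  | halt => intro v S; cases x <;> simp [Stmt.emb, stepAux, leave, Cfg.emb]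

end Embedding

section Growth

variable {K : Type} {Γ : K → Type} {Λ σ : Type}

/-- The largest number of pushes that a statement can execute. -/
def Stmt.pushes : Stmt Γ Λ σ → ℕ
  | .push _ _ q => q.pushes + 1
  | .peek _ _ q => q.pushes
  | .pop _ _ q => q.pushes
  | .load _ q => q.pushes
  | .branch _ q₁ q₂ => max q₁.pushes q₂.pushes
  | .goto _ => 0
  | .halt => 0

theorem length_stepAux_le [DecidableEq K] (q : Stmt Γ Λ σ) : ∀ (v : σ) (S : ∀ k, List (Γ k)) (k : K),
    ((stepAux q v S).stk k).length ≤ (S k).length + q.pushes := by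
  have key : ∀ (S : ∀ k, List (Γ k)) (k' k : K) (l : List (Γ k')) (c : ℕ),
      l.length ≤ (S k').length + c → (Function.update S k' l k).length ≤ (S k).length + c := by
    intro S k' k l c h
    by_cases hk : k = k'
    · subst hk; simpa using h
    · simp [Function.update_of_ne hk]
  induction q with
  | push k' f q ih =>
    intro v S k
    have h1 := ih v (Function.update S k' (f v :: S k')) k
    have h2 := key S k' k (f v :: S k') 1 (by simp)
    simp only [stepAux, Stmt.pushes]; omega
  | peek k' f q ih => intro v S k; exact ih _ _ _
  | pop k' f q ih =>
    intro v S k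
    have h1 := ih (f v (S k').head?) (Function.update S k' (S k').tail) k
    have h2 := key S k' k (S k').tail 0 (by simp)
    simp only [stepAux, Stmt.pushes]; omega
  | load a q ih => intro v S k; exact ih _ _ _
  | branch f q₁ q₂ ih₁ ih₂ =>
    intro v S k
    have h1 := ih₁ v S k
    have h2 := ih₂ v S k
    simp only [stepAux, Stmt.pushes]
    cases f v <;> simp only [cond] <;> omega
  | goto f => intro v S k; simp [stepAux]
  | halt => intro v S k; simp [stepAux]

end Growth

end Turing.TM2

/-! ### Probabilistic stack programs and their runs -/

namespace Turing.TM2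

variable {K K' : Type} {Γ : K → Type} {Γ' : K' → Type} {Λ Λ' σ σ' : Type}

/-- A stack map that acts along an injection `i` of stacks and fills the other stacks
independently of its argument commutes with the update of one stack. -/
theorem emb_update [DecidableEq K] [DecidableEq K'] {i : K → K'} {e : ∀ k, Γ k ≃ Γ' (i k)}
    {φ : (∀ k, List (Γ k)) → ∀ k, List (Γ' k)} (hi : Function.Injective i)
    (h₁ : ∀ S k, φ S (i k) = (S k).map (e k))
    (h₂ : ∀ S S' k', (∀ k, i k ≠ k') → φ S k' = φ S' k') (S : ∀ k, List (Γ k)) (k : K)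
    (l : List (Γ k)) : φ (Function.update S k l) = Function.update (φ S) (i k) (l.map (e k)) := by
  funext k'
  by_cases hk : ∃ k₂, i k₂ = k'
  · obtain ⟨k₂, rfl⟩ := hk
    by_cases h : k₂ = k
    · subst h; simp [h₁]
    · rw [h₁, Function.update_of_ne h, Function.update_of_ne (fun h' => h (hi h')), h₁]
  · push Not at hk
    rw [Function.update_of_ne (fun h => hk k h.symm), h₂ _ S k' hk]

/-- One step of the program `code` with coin `b`; halted configurations do not change. -/
def coinStep [DecidableEq K] (code : Bool → Λ → Stmt Γ Λ σ) (b : Bool) (c : Cfg Γ Λ σ) :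
    Cfg Γ Λ σ :=
  (step (code b) c).getD c

theorem coinStep_some [DecidableEq K] (code : Bool → Λ → Stmt Γ Λ σ) (b : Bool) (l : Λ) (v : σ)
    (S : ∀ k, List (Γ k)) : coinStep code b ⟨some l, v, S⟩ = stepAux (code b l) v S := rfl

/-- Started in `c`, the program halts within `T` steps for all coin tosses, and then the observable
`g` of the final configuration has the distribution `ν`. -/
def Yields [DecidableEq K] {α : Type} (code : Bool → Λ → Stmt Γ Λ σ) (g : Cfg Γ Λ σ → α)
    (c : Cfg Γ Λ σ) (T : ℕ) (ν : PMF α) : Prop :=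
  ∃ μ, Runs (coinStep code) (fun c => c.l = none) c T μ ∧ (∀ c' ∈ μ.support, c'.l = none) ∧
    μ.map g = ν

section Yields

variable [DecidableEq K] [DecidableEq K'] {α β : Type} {code : Bool → Λ → Stmt Γ Λ σ}
  {code' : Bool → Λ' → Stmt Γ' Λ' σ'} {g : Cfg Γ Λ σ → α} {g' : Cfg Γ' Λ' σ' → β}

theorem Yields.mono {c : Cfg Γ Λ σ} {T T' : ℕ} {ν : PMF α} (h : Yields code g c T ν)
    (hT : T ≤ T') : Yields code g c T' ν := by
  obtain ⟨μ, h1, h2⟩ := h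
  exact ⟨μ, h1.mono hT, h2⟩

theorem Yields.halted (c : Cfg Γ Λ σ) (hc : c.l = none) (T : ℕ) :
    Yields code g c T (PMF.pure (g c)) :=
  ⟨PMF.pure c, .done c T, by simp [hc], PMF.pure_map _ _⟩

theorem Yields.of_runs {c : Cfg Γ Λ σ} {T T' : ℕ} {μ : PMF (Cfg Γ Λ σ)}
    {κ : Cfg Γ Λ σ → PMF α} (h : Runs (coinStep code) (fun c => c.l = none) c T μ)
    (hκ : ∀ c' ∈ μ.support, Yields code g c' T' (κ c')) :
    Yields code g c (T + T') (μ.bind κ) := by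
  choose! ν h1 h2 h3 using hκ
  refine ⟨μ.bind ν, h.bind h1, ?_, ?_⟩
  · intro c' hc'
    rw [PMF.mem_support_bind_iff] at hc'
    obtain ⟨a, ha, hc'⟩ := hc'
    exact h2 a ha c' hc'
  · rw [PMF.map_bind]
    ext x
    rw [PMF.bind_apply, PMF.bind_apply]
    refine tsum_congr fun a => ?_
    by_cases ha : a ∈ μ.support
    · rw [h3 a ha]
    · rw [(PMF.apply_eq_zero_iff _ _).2 ha]; simp

theorem Yields.head {c c' : Cfg Γ Λ σ} {T : ℕ} {ν : PMF α} (hc : c.l ≠ none)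
    (hs : ∀ b, coinStep code b c = c') (h : Yields code g c' T ν) :
    Yields code g c (T + 1) ν := by
  obtain ⟨μ, h1, h2⟩ := h
  exact ⟨μ, h1.head hc hs, h2⟩

/-- The data of an embedding of the program `code` into the program `code'`. -/
structure ProgramEmb (code : Bool → Λ → Stmt Γ Λ σ) (code' : Bool → Λ' → Stmt Γ' Λ' σ')
    (lab : Λ → Λ') (x : Option Λ') (ψ : σ → σ')
    (φ : (∀ k, List (Γ k)) → ∀ k, List (Γ' k)) where
  i : K → K'
  e : ∀ k, Γ k ≃ Γ' (i k)
  get : σ' → σ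
  set : σ → σ' → σ'
  get_apply : ∀ v, get (ψ v) = v
  set_apply : ∀ v w, set v (ψ w) = ψ v
  inj : Function.Injective i
  stk_image : ∀ S k, φ S (i k) = (S k).map (e k)
  stk_frame : ∀ S S' k', (∀ k, i k ≠ k') → φ S k' = φ S' k'
  code_eq : ∀ b l, code' b (lab l) = (code b l).emb i e get set lab x

variable {lab : Λ → Λ'} {x : Option Λ'} {ψ : σ → σ'} {φ : (∀ k, List (Γ k)) → ∀ k, List (Γ' k)}

theorem ProgramEmb.runs (E : ProgramEmb code code' lab x ψ φ) {c : Cfg Γ Λ σ} {T : ℕ}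
    {μ : PMF (Cfg Γ Λ σ)} (h : Runs (coinStep code) (fun c => c.l = none) c T μ) :
    Runs (coinStep code') (fun c => c.l = none) (c.emb ψ φ lab x) T
      (μ.map fun c => c.emb ψ φ lab x) := by
  refine h.map _ ?_ ?_
  · rintro ⟨_ | l, v, S⟩ hc <;> simp_all [Cfg.emb]
  · rintro ⟨_ | l, v, S⟩ b hc
    · simp at hc
    · have := stepAux_emb (lab := lab) (x := x) E.get_apply E.set_apply
        (emb_update E.inj E.stk_image E.stk_frame) (code b l) v S
      rw [← E.code_eq] at this
      exact this

theorem ProgramEmb.yields (E : ProgramEmb code code' lab none ψ φ) {c : Cfg Γ Λ σ} {T : ℕ}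
    {ν : PMF α} (h : Yields code g c T ν) (up : α → β)
    (hup : ∀ c, g' (c.emb ψ φ lab none) = up (g c)) :
    Yields code' g' (c.emb ψ φ lab none) T (ν.map up) := by
  obtain ⟨μ, h1, h2, h3⟩ := h
  refine ⟨_, E.runs h1, ?_, ?_⟩
  · intro c' hc'
    rw [PMF.mem_support_map_iff] at hc'
    obtain ⟨a, ha, rfl⟩ := hc'
    simp [Cfg.emb, h2 a ha]
  · rw [← h3, PMF.map_comp, PMF.map_comp]
    congr 1
    funext c
    exact hup c

theorem length_stk_le {c : Cfg Γ Λ σ} {T : ℕ} {μ : PMF (Cfg Γ Λ σ)} {m : ℕ}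
    (hm : ∀ b l, (code b l).pushes ≤ m)
    (h : Runs (coinStep code) (fun c => c.l = none) c T μ) (k : K) :
    ∀ c' ∈ μ.support, (c'.stk k).length ≤ (c.stk k).length + T * m := by
  intro c' hc'
  have := h.support_of_step (P := fun n c' => (c'.stk k).length ≤ (c.stk k).length + n * m)
    (fun n c' b hh hn => ?_) (fun n c' hn => ?_) 0 (by simp) c' hc'
  · simpa using this
  · obtain ⟨_ | l, v, S⟩ := c'
    · simp at hh
    · have h1 := length_stepAux_le (code b l) v S k
      have h2 := hm b l
      simp only [coinStep_some, Nat.add_mul, one_mul] at *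
      omega
  · simp only [Nat.add_mul, one_mul] at *
    omega

end Yields

end Turing.TM2

/-- The alphabets of the stacks of a subroutine: registers hold words, hidden stacks have alphabets
of their own. -/
abbrev Alph {R H : Type} (Γ : H → Type) : R ⊕ H → Type
  | .inl _ => IOSymbol
  | .inr h => Γ h

/-- A probabilistic stack program that works in place on registers `R`, each holding a word, and has
its own hidden stacks `H`, labels and internal states. -/
structure Subroutine (R : Type) where
  H : Type
  [decH : DecidableEq H]
  [finH : Fintype H]
  Γ : H → Type
  finΓ : ∀ h, Finite (Γ h)
  Λ : Type
  [finΛ : Fintype Λ]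
  main : Λ
  σ : Type
  [finσ : Fintype σ]
  init : σ
  code : Bool → Λ → Stmt (Alph (R := R) Γ) Λ σ

namespace Subroutine

attribute [instance] decH finH finΛ finσ

/-- The stacks of a subroutine, given the registers and the hidden stacks. -/
def stk {R H : Type} {Γ : H → Type} (s : R → Word) (h : ∀ k, List (Γ k)) :
    ∀ k, List (Alph (R := R) Γ k)
  | .inl r => s r
  | .inr k => h k

/-- The contents of the registers. -/
def regs {R H Λ σ : Type} {Γ : H → Type} (c : Cfg (Alph (R := R) Γ) Λ σ) :
    R → Word :=
  fun r => c.stk (.inl r)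

variable {R : Type}

/-- The initial configuration with registers `s`: the hidden stacks are empty. -/
def start (F : Subroutine R) (s : R → Word) :
    Cfg (Alph (R := R) F.Γ) F.Λ F.σ :=
  ⟨some F.main, F.init, stk s fun _ => []⟩

/-- Started with registers `s`, the subroutine halts within `T` steps for all coin tosses, with
registers distributed as `ν`. The final contents of the hidden stacks are arbitrary. -/
def RunsTo [DecidableEq R] (F : Subroutine R) (s : R → Word) (T : ℕ) (ν : PMF (R → Word)) : Prop :=
  Yields F.code regs (F.start s) T ν

/-- A bound for the number of symbols that one step pushes. -/
theorem exists_pushes_le (F : Subroutine R) : ∃ m, ∀ b l, (F.code b l).pushes ≤ m :=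
  ⟨Finset.univ.sup fun x : Bool × F.Λ => (F.code x.1 x.2).pushes, fun b l =>
    Finset.le_sup (f := fun x : Bool × F.Λ => (F.code x.1 x.2).pushes) (Finset.mem_univ (b, l))⟩

variable [DecidableEq R]

theorem RunsTo.mono {F : Subroutine R} {s : R → Word} {T T' : ℕ} {ν : PMF (R → Word)}
    (h : F.RunsTo s T ν) (hT : T ≤ T') : F.RunsTo s T' ν :=
  Yields.mono h hT

theorem RunsTo.length_le {F : Subroutine R} {m : ℕ} (hm : ∀ b l, (F.code b l).pushes ≤ m)
    {s : R → Word} {T : ℕ} {ν : PMF (R → Word)} (h : F.RunsTo s T ν) (r : R) :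
    ∀ s' ∈ ν.support, (s' r).length ≤ (s r).length + T * m := by
  obtain ⟨μ, h1, -, rfl⟩ := h
  intro s' hs'
  rw [PMF.mem_support_map_iff] at hs'
  obtain ⟨c, hc, rfl⟩ := hs'
  exact length_stk_le hm h1 (.inl r) c hc

/-! ### Elementary subroutines -/

/-- The subroutine without hidden stacks that executes one statement, which may depend on a coin. -/
def single {σ : Type} [Fintype σ] (init : σ)
    (q : Bool → Stmt (Alph (R := R) (fun _ : Empty => Empty)) Unit σ) :
    Subroutine R where
  H := Empty
  Γ := fun _ => Empty
  finΓ := nofun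
  Λ := Unit
  main := ()
  σ := σ
  init := init
  code := fun b _ => q b

theorem single_runsTo {σ : Type} [Fintype σ] {init : σ}
    {q : Bool → Stmt (Alph (R := R) (fun _ : Empty => Empty)) Unit σ}
    {s : R → Word} (f : Bool → R → Word)
    (hl : ∀ b, (stepAux (q b) init (stk s fun _ => [])).l = none)
    (hf : ∀ b, regs (stepAux (q b) init (stk s fun _ => [])) = f b) :
    (single init q).RunsTo s 1 ((PMF.uniformOfFintype Bool).map f) := by
  refine ⟨(PMF.uniformOfFintype Bool).bind fun b => PMF.pure
    (stepAux (q b) init (stk s fun _ => [])), ?_, ?_, ?_⟩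
  · exact .step _ 0 _ (by simp [start]) fun b => .done _ _
  · intro c' hc'
    simp only [PMF.mem_support_bind_iff, PMF.mem_support_pure_iff] at hc'
    obtain ⟨b, -, rfl⟩ := hc'
    exact hl b
  · rw [PMF.map_bind]
    simp only [PMF.pure_map]
    exact congrArg _ (funext fun b => congrArg PMF.pure (hf b))

theorem single_runsTo_pure {σ : Type} [Fintype σ] {init : σ}
    {q : Stmt (Alph (R := R) (fun _ : Empty => Empty)) Unit σ}
    {s : R → Word} (t : R → Word)
    (hl : (stepAux q init (stk s fun _ => [])).l = none)
    (hf : regs (stepAux q init (stk s fun _ => [])) = t) :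
    (single init fun _ => q).RunsTo s 1 (PMF.pure t) := by
  have := single_runsTo (q := fun _ => q) (fun _ => t) (fun _ => hl) (fun _ => hf)
  rwa [show (fun _ : Bool => t) = Function.const Bool t from rfl, PMF.map_const] at this

/-- Push a symbol, which may depend on a coin. -/
def push (r : R) (a : Bool → IOSymbol) : Subroutine R :=
  single () fun b => .push (.inl r) (fun _ => a b) .halt

theorem push_runsTo (r : R) (a : Bool → IOSymbol) (s : R → Word) :
    (push r a).RunsTo s 1
      ((PMF.uniformOfFintype Bool).map fun b => Function.update s r (a b :: s r)) := by
  refine single_runsTo _ (fun b => rfl) fun b => ?_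
  funext r'
  by_cases h : r' = r
  · subst h; simp [regs, stk]
  · simp [regs, stk, h]

/-- The statement that pushes the symbol in the internal state to all the listed registers. -/
def pushAll {H Λ : Type} {Γ : H → Type} : List R →
    Stmt (Alph (R := R) Γ) Λ (Option IOSymbol) →
    Stmt (Alph (R := R) Γ) Λ (Option IOSymbol)
  | [], q => q
  | r :: rs, q => .push (.inl r) (fun v => v.getD none) (pushAll rs q)

/-- Pop a symbol from `r`, if there is one, and push it to all the registers in `rs`. -/
def mv (r : R) (rs : List R) : Subroutine R :=
  single (none : Option IOSymbol) fun _ => .pop (.inl r) (fun _ o => o)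
    (.branch (fun v => v.isSome) (pushAll rs .halt) .halt)

theorem stepAux_pushAll {H Λ : Type} [DecidableEq H] {Γ : H → Type} (a : IOSymbol)
    (rs : List R) (hrs : rs.Nodup) : ∀ (S : ∀ k, List (Alph (R := R) Γ k)),
    (stepAux (pushAll rs .halt : Stmt _ Λ _) (some a) S).l = none ∧
    regs (stepAux (pushAll rs .halt : Stmt _ Λ _) (some a) S) =
      fun r => if r ∈ rs then a :: S (.inl r) else S (.inl r) := by
  induction rs with
  | nil => intro S; exact ⟨rfl, funext fun r => (if_neg List.not_mem_nil).symm⟩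
  | cons r rs ih =>
    intro S
    obtain ⟨h1, h2⟩ := ih hrs.tail (Function.update S (.inl r) (a :: S (.inl r)))
    refine ⟨h1, ?_⟩
    simp only [pushAll, stepAux, Option.getD_some]
    rw [h2]
    funext r'
    by_cases h : r' = r
    · subst h
      simp [(List.nodup_cons.1 hrs).1]
    · simp [h]

theorem mv_runsTo (r : R) (rs : List R) (hrs : rs.Nodup) (hr : r ∉ rs) (s : R → Word)
    (a : IOSymbol) (w : Word) (hs : s r = a :: w) :
    (mv r rs).RunsTo s 1
      (PMF.pure fun r' => if r' = r then w else if r' ∈ rs then a :: s r' else s r') := by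
  have key := stepAux_pushAll (Λ := Unit) (Γ := fun _ : Empty => Empty) a rs hrs
    (Function.update (stk s fun _ => []) (.inl r) w)
  refine single_runsTo_pure _ ?_ ?_
  · simpa [stk, hs] using key.1
  · simp only [stepAux, stk, hs, List.head?_cons, List.tail_cons, Option.isSome_some, cond]
    refine key.2.trans (funext fun r' => ?_)
    by_cases h : r' = r
    · subst h; simp [hr]
    · simp [h, stk]

theorem mv_runsTo_nil (r : R) (rs : List R) (s : R → Word) (hs : s r = []) :
    (mv r rs).RunsTo s 1 (PMF.pure s) := by
  refine single_runsTo_pure _ ?_ ?_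
  · simp [stk, hs]
  · funext r'
    by_cases h : r' = r
    · subst h; simp [stk, hs, regs]
    · simp [stk, hs, regs, h]

end Subroutine

namespace Subroutine

/-! ### Control structures -/

variable {R : Type}

/-- Run `F`, then `G`. -/
abbrev seq (F G : Subroutine R) : Subroutine R where
  H := F.H ⊕ G.H
  Γ := Sum.elim F.Γ G.Γ
  finΓ := by rintro (h | h); exacts [F.finΓ h, G.finΓ h]
  Λ := F.Λ ⊕ G.Λ
  main := .inl F.main
  σ := F.σ × G.σ
  init := (F.init, G.init)
  code := fun b l => match l with
    | .inl l => (F.code b l).emb (fun | .inl r => .inl r | .inr h => .inr (.inl h))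
        (fun | .inl _ => Equiv.refl _ | .inr _ => Equiv.refl _) Prod.fst (fun v w => (v, w.2))
        .inl (some (.inr G.main))
    | .inr l => (G.code b l).emb (fun | .inl r => .inl r | .inr h => .inr (.inr h))
        (fun | .inl _ => Equiv.refl _ | .inr _ => Equiv.refl _) Prod.snd (fun v w => (w.1, v))
        .inr none

/-- The embedding of `F` into `F.seq G`; meanwhile the internal state of `G` is `v` and its hidden
stacks are `h`. -/
def seqLeft (F G : Subroutine R) (v : G.σ) (h : ∀ k, List (G.Γ k)) :
    ProgramEmb F.code (F.seq G).code .inl (some (.inr G.main)) (fun w => (w, v))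
      (fun S => stk (Γ := Sum.elim F.Γ G.Γ) (fun r => S (.inl r))
        fun | .inl k => S (.inr k) | .inr k => h k) where
  i := fun | .inl r => .inl r | .inr h => .inr (.inl h)
  e := fun | .inl _ => Equiv.refl _ | .inr _ => Equiv.refl _
  get := Prod.fst
  set := fun v w => (v, w.2)
  get_apply := fun _ => rfl
  set_apply := fun _ _ => rfl
  inj := by rintro (a | a) (b | b) h <;> simp_all
  stk_image := by rintro S (a | a) <;> exact (List.map_id _).symm
  stk_frame := by
    rintro S S' (a | a | a) h
    · exact absurd rfl (h (.inl a))
    · exact absurd rfl (h (.inr a))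
    · rfl
  code_eq := fun _ _ => rfl

/-- The embedding of `G` into `F.seq G`; meanwhile the internal state of `F` is `v` and its hidden
stacks are `h`, as the run of `F` has left them. -/
def seqRight (F G : Subroutine R) (v : F.σ) (h : ∀ k, List (F.Γ k)) :
    ProgramEmb G.code (F.seq G).code .inr none (fun w => (v, w))
      (fun S => stk (Γ := Sum.elim F.Γ G.Γ) (fun r => S (.inl r))
        fun | .inl k => h k | .inr k => S (.inr k)) where
  i := fun | .inl r => .inl r | .inr h => .inr (.inr h)
  e := fun | .inl _ => Equiv.refl _ | .inr _ => Equiv.refl _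
  get := Prod.snd
  set := fun v w => (w.1, v)
  get_apply := fun _ => rfl
  set_apply := fun _ _ => rfl
  inj := by rintro (a | a) (b | b) h <;> simp_all
  stk_image := by rintro S (a | a) <;> exact (List.map_id _).symm
  stk_frame := by
    rintro S S' (a | a | a) h
    · exact absurd rfl (h (.inl a))
    · rfl
    · exact absurd rfl (h (.inr a))
  code_eq := fun _ _ => rfl

theorem stk_eq {H : Type} {Γ : H → Type} (S : ∀ k, List (Alph (R := R) Γ k)) :
    stk (fun r => S (.inl r)) (fun k => S (.inr k)) = S := by
  funext k; cases k <;> rfl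

variable [DecidableEq R]

theorem RunsTo.seq {F G : Subroutine R} {s : R → Word} {T T' : ℕ} {ν : PMF (R → Word)}
    {κ : (R → Word) → PMF (R → Word)} (hF : F.RunsTo s T ν)
    (hG : ∀ s' ∈ ν.support, G.RunsTo s' T' (κ s')) :
    (F.seq G).RunsTo s (T + T') (ν.bind κ) := by
  obtain ⟨μ, h1, h2, rfl⟩ := hF
  have hstart : (F.start s).emb (fun w => (w, G.init))
      (fun S => stk (Γ := Sum.elim F.Γ G.Γ) (fun r => S (.inl r))
        fun | .inl k => S (.inr k) | .inr k => []) .inl (some (.inr G.main)) =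
      (F.seq G).start s := by
    simp only [start, Cfg.emb, Option.elim, Subroutine.seq]
    congr 1
    funext k
    rcases k with r | k | k <;> rfl
  have key := (seqLeft F G G.init fun _ => []).runs h1
  replace key := Eq.subst (motive := fun c => Runs (coinStep (F.seq G).code)
    (fun c => c.l = none) c T _) hstart key
  have := Yields.of_runs (g := regs) (κ := fun c => κ (regs c)) key (T' := T') ?_
  · rw [PMF.bind_map] at this
    rw [PMF.bind_map]
    exact this
  · intro c' hc'
    rw [PMF.mem_support_map_iff] at hc'
    obtain ⟨c, hc, rfl⟩ := hc'
    have hr := hG (regs c) ((PMF.mem_support_map_iff _ _ _).2 ⟨c, hc, rfl⟩)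
    have := (seqRight F G c.var fun k => c.stk (.inr k)).yields (g' := regs) hr id
      (fun c => rfl)
    rw [PMF.map_id] at this
    convert this using 1
    · simp only [start, Cfg.emb, Option.elim, h2 c hc]
      refine congrArg (Cfg.mk _ _) ?_
      funext k
      rcases k with r | k | k <;> rfl
    · rfl

/-- Run `F` if the top symbol of `r` is `o` (with `o = none` for the empty word), else run `G`. -/
abbrev ite (r : R) (o : Option IOSymbol) (F G : Subroutine R) : Subroutine R where
  H := F.H ⊕ G.H
  Γ := Sum.elim F.Γ G.Γ
  finΓ := by rintro (h | h); exacts [F.finΓ h, G.finΓ h]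
  Λ := Option (F.Λ ⊕ G.Λ)
  main := none
  σ := Bool × F.σ × G.σ
  init := (false, F.init, G.init)
  code := fun b l => match l with
    | none => .peek (.inl r) (fun v o' => (decide (o' = o), v.2)) (.branch Prod.fst
        (.goto fun _ => some (.inl F.main)) (.goto fun _ => some (.inr G.main)))
    | some (.inl l) => (F.code b l).emb (fun | .inl r => .inl r | .inr h => .inr (.inl h))
        (fun | .inl _ => Equiv.refl _ | .inr _ => Equiv.refl _) (fun v => v.2.1)
        (fun v w => (w.1, v, w.2.2)) (fun l => some (.inl l)) none
    | some (.inr l) => (G.code b l).emb (fun | .inl r => .inl r | .inr h => .inr (.inr h))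
        (fun | .inl _ => Equiv.refl _ | .inr _ => Equiv.refl _) (fun v => v.2.2)
        (fun v w => (w.1, w.2.1, v)) (fun l => some (.inr l)) none

/-- The embedding of the first branch into `ite r o F G`, after the test with result `b`. -/
def iteLeft (r : R) (o : Option IOSymbol) (F G : Subroutine R) (b : Bool) :
    ProgramEmb F.code (ite r o F G).code (fun l => some (.inl l)) none
      (fun w => (b, w, G.init))
      (fun S => stk (Γ := Sum.elim F.Γ G.Γ) (fun r => S (.inl r))
        fun | .inl k => S (.inr k) | .inr _ => []) where
  i := fun | .inl r => .inl r | .inr h => .inr (.inl h)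
  e := fun | .inl _ => Equiv.refl _ | .inr _ => Equiv.refl _
  get := fun v => v.2.1
  set := fun v w => (w.1, v, w.2.2)
  get_apply := fun _ => rfl
  set_apply := fun _ _ => rfl
  inj := by rintro (a | a) (b | b) h <;> simp_all
  stk_image := by rintro S (a | a) <;> exact (List.map_id _).symm
  stk_frame := by
    rintro S S' (a | a | a) h
    · exact absurd rfl (h (.inl a))
    · exact absurd rfl (h (.inr a))
    · rfl
  code_eq := fun _ _ => rfl

/-- The embedding of the second branch into `ite r o F G`, after the test with result `b`. -/
def iteRight (r : R) (o : Option IOSymbol) (F G : Subroutine R) (b : Bool) :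
    ProgramEmb G.code (ite r o F G).code (fun l => some (.inr l)) none
      (fun w => (b, F.init, w))
      (fun S => stk (Γ := Sum.elim F.Γ G.Γ) (fun r => S (.inl r))
        fun | .inl _ => [] | .inr k => S (.inr k)) where
  i := fun | .inl r => .inl r | .inr h => .inr (.inr h)
  e := fun | .inl _ => Equiv.refl _ | .inr _ => Equiv.refl _
  get := fun v => v.2.2
  set := fun v w => (w.1, w.2.1, v)
  get_apply := fun _ => rfl
  set_apply := fun _ _ => rfl
  inj := by rintro (a | a) (b | b) h <;> simp_all
  stk_image := by rintro S (a | a) <;> exact (List.map_id _).symm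
  stk_frame := by
    rintro S S' (a | a | a) h
    · exact absurd rfl (h (.inl a))
    · rfl
    · exact absurd rfl (h (.inr a))
  code_eq := fun _ _ => rfl

theorem RunsTo.ite {F G : Subroutine R} {r : R} {o : Option IOSymbol} {s : R → Word} {T : ℕ}
    {ν : PMF (R → Word)} (hF : (s r).head? = o → F.RunsTo s T ν)
    (hG : (s r).head? ≠ o → G.RunsTo s T ν) : (ite r o F G).RunsTo s (T + 1) ν := by
  let A : Option IOSymbol → Cfg (Alph (Subroutine.ite r o F G).Γ)
      (Subroutine.ite r o F G).Λ (Subroutine.ite r o F G).σ := fun o =>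
    ⟨some (some (.inl F.main)), (decide ((s r).head? = o), F.init, G.init), stk s fun _ => []⟩
  let B : Option IOSymbol → Cfg (Alph (Subroutine.ite r o F G).Γ)
      (Subroutine.ite r o F G).Λ (Subroutine.ite r o F G).σ := fun o =>
    ⟨some (some (.inr G.main)), (decide ((s r).head? = o), F.init, G.init), stk s fun _ => []⟩
  by_cases h : (s r).head? = o
  · have := (iteLeft r o F G true).yields (g' := regs) (hF h) id (fun c => rfl)
    rw [PMF.map_id] at this
    refine Yields.head (Option.some_ne_none _) (fun b => ?_) this
    refine Eq.trans (b := cond (decide ((s r).head? = o)) (A o) (B o)) rfl ?_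
    simp only [h, decide_true, cond, A]
    refine congrArg (Cfg.mk _ _) ?_
    funext k
    rcases k with r | k | k <;> rfl
  · have := (iteRight r o F G false).yields (g' := regs) (hG h) id (fun c => rfl)
    rw [PMF.map_id] at this
    refine Yields.head (Option.some_ne_none _) (fun b => ?_) this
    refine Eq.trans (b := cond (decide ((s r).head? = o)) (A o) (B o)) rfl ?_
    simp only [h, decide_false, cond, B]
    refine congrArg (Cfg.mk _ _) ?_
    funext k
    rcases k with r | k | k <;> rfl

/-- The statement that pops all the listed hidden stacks and clears the flag in the internal state
if one of them was nonempty. -/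
def popAll {H Λ σ : Type} {Γ : H → Type} : List H →
    Stmt (Alph (R := R) Γ) Λ (σ × Bool) → Stmt (Alph (R := R) Γ) Λ (σ × Bool)
  | [], q => q
  | h :: hs, q => .pop (.inr h) (fun v o => (v.1, v.2 && o.isNone)) (popAll hs q)

theorem stepAux_popAll {H Λ σ : Type} [DecidableEq H] {Γ : H → Type}
    (q : Stmt (Alph (R := R) Γ) Λ (σ × Bool)) (hs : List H) (hn : hs.Nodup) :
    ∀ (v : σ) (b : Bool) (t : R → Word) (S : ∀ k, List (Γ k)),
    stepAux (popAll hs q) (v, b) (stk t S) =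
      stepAux q (v, b && hs.all fun h => (S h).isEmpty)
        (stk t fun h => if h ∈ hs then (S h).tail else S h) := by
  induction hs with
  | nil => intro v b t S; simp [popAll]
  | cons h hs ih =>
    intro v b t S
    obtain ⟨hh, hn⟩ := List.nodup_cons.1 hn
    have hu : Function.update (stk (R := R) t S) (.inr h) (S h).tail =
        stk t (Function.update S h (S h).tail) := by
      funext k
      rcases k with r | k
      · rw [Function.update_of_ne (by simp)]; rfl
      · by_cases hk : k = h
        · subst hk; simp [stk]
        · rw [Function.update_of_ne (by simpa using hk)]; simp [stk, hk]
    have h0 : (stk (R := R) t S (.inr h)) = S h := rfl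
    rw [popAll, stepAux, h0, hu, ih hn]
    congr 1
    · have h1 : (S h).head?.isNone = (S h).isEmpty := by cases S h <;> rfl
      have h2 : (hs.all fun x => (Function.update S h (S h).tail x).isEmpty) =
          hs.all fun x => (S x).isEmpty := by
        rw [Bool.eq_iff_iff, List.all_eq_true, List.all_eq_true]
        refine forall₂_congr fun x hx => ?_
        rw [Function.update_of_ne (fun e : x = h => hh (e ▸ hx))]
      rw [h2, List.all_cons, h1, Bool.and_assoc]
    · congr 1
      funext k
      by_cases hk : k = h
      · subst hk; simp [hh]
      · simp [hk]

/-- Run `F` again and again as long as the register `r` is nonempty, emptying the hidden stacks and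
resetting the internal state of `F` after each round. -/
noncomputable abbrev loop (r : R) (F : Subroutine R) : Subroutine R where
  H := F.H
  Γ := F.Γ
  finΓ := F.finΓ
  Λ := Option (Option F.Λ)
  main := none
  σ := F.σ × Bool
  init := (F.init, true)
  code := fun b l => match l with
    | none => .peek (.inl r) (fun v o => (v.1, o.isSome)) (.branch Prod.snd
        (.goto fun _ => some (some F.main)) .halt)
    | some none => .load (fun v => (v.1, true)) (popAll Finset.univ.toList (.branch Prod.snd
        (.load (fun _ => (F.init, true)) (.goto fun _ => none)) (.goto fun _ => some none)))
    | some (some l) => (F.code b l).emb id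
        (fun | .inl _ => Equiv.refl _ | .inr _ => Equiv.refl _) Prod.fst (fun v w => (v, w.2))
        (fun l => some (some l)) (some (some none))

/-- The embedding of `F` into `loop r F`; halting of `F` becomes a jump to the cleaning phase. -/
noncomputable def loopBody (r : R) (F : Subroutine R) :
    ProgramEmb F.code (loop r F).code (fun l => some (some l)) (some (some none))
      (fun w => (w, true)) id where
  i := id
  e := fun | .inl _ => Equiv.refl _ | .inr _ => Equiv.refl _
  get := Prod.fst
  set := fun v w => (v, w.2)
  get_apply := fun _ => rfl
  set_apply := fun _ _ => rfl
  inj := Function.injective_id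
  stk_image := by rintro S (a | a) <;> exact (List.map_id _).symm
  stk_frame := fun S S' k' h => absurd rfl (h k')
  code_eq := fun _ _ => rfl

theorem loop_runsTo_nil (r : R) (F : Subroutine R) {s : R → Word} (hs : s r = []) :
    (loop r F).RunsTo s 1 (PMF.pure s) := by
  refine Yields.head (c' := ⟨none, (F.init, false), stk s fun _ => []⟩) (Option.some_ne_none _)
    (fun b => ?_) (Yields.halted _ rfl 0)
  refine Eq.trans (b := cond (s r).head?.isSome
    ⟨some (some (some F.main)), (F.init, (s r).head?.isSome), stk s fun _ => []⟩
    ⟨none, (F.init, (s r).head?.isSome), stk s fun _ => []⟩) rfl ?_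
  simp [hs]

/-- The cleaning phase, which pops one symbol from every hidden stack per step, ends at the start
of the next round after as many steps as the longest hidden stack has symbols. -/
theorem loop_clean (r : R) (F : Subroutine R) {T : ℕ} {ν : PMF (R → Word)} (s : R → Word)
    (h : (loop r F).RunsTo s T ν) (N : ℕ) : ∀ (v : F.σ) (b : Bool) (S : ∀ k, List (F.Γ k)),
    (∀ k, (S k).length ≤ N) →
    Yields (loop r F).code regs ⟨some (some none), (v, b), stk s S⟩ (T + (N + 1)) ν := by
  have hstep : ∀ (v : F.σ) (b c : Bool) (S : ∀ k, List (F.Γ k)),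
      coinStep (loop r F).code c ⟨some (some none), (v, b), stk s S⟩ =
        if ∀ k, S k = [] then (loop r F).start s
        else ⟨some (some none), (v, false), stk s fun k => (S k).tail⟩ := by
    intro v b c S
    refine (stepAux_popAll _ _ (Finset.nodup_toList _) v true s S).trans ?_
    simp only [stepAux, Bool.true_and, Finset.mem_toList, Finset.mem_univ, if_true]
    by_cases hS : ∀ k, S k = []
    · have : (Finset.univ.toList.all fun h => (S h).isEmpty) = true := by simp [hS]
      rw [if_pos hS, this]
      simp [hS, start]
    · have : (Finset.univ.toList.all fun h => (S h).isEmpty) = false := by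
        simpa using hS
      rw [if_neg hS, this]
      rfl
  induction N with
  | zero =>
    intro v b S hS
    refine Yields.head (Option.some_ne_none _) (fun c => ?_) h
    rw [hstep, if_pos fun k => by simpa using hS k]
  | succ N ih =>
    intro v b S hS
    by_cases hS' : ∀ k, S k = []
    · refine Yields.mono (Yields.head (Option.some_ne_none _) (fun c => ?_) h) (by omega : T + 1 ≤ _)
      rw [hstep, if_pos hS']
    · refine Yields.head (c' := ⟨some (some none), (v, false), stk s fun k => (S k).tail⟩)
        (Option.some_ne_none _) (fun c => ?_) (ih v false _ fun k => ?_)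
      · rw [hstep, if_neg hS']
      · have := hS k
        simp only [List.length_tail]; omega

/-- One round of a loop. The body needs at most `T` steps, so that it leaves at most `T * m` symbols
on each hidden stack; this bounds the time for cleaning up. -/
theorem loop_runsTo_cons {r : R} {F : Subroutine R} {m : ℕ}
    (hm : ∀ b l, (F.code b l).pushes ≤ m) {s : R → Word} (hs : s r ≠ []) {T T' : ℕ}
    {ν : PMF (R → Word)} {κ : (R → Word) → PMF (R → Word)} (hF : F.RunsTo s T ν)
    (h : ∀ s' ∈ ν.support, (loop r F).RunsTo s' T' (κ s')) :
    (loop r F).RunsTo s (T + T' + T * m + 2) (ν.bind κ) := by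
  obtain ⟨μ, h1, h2, rfl⟩ := hF
  refine Yields.mono (T := T + (T' + (T * m + 1)) + 1) ?_ (by omega)
  refine Yields.head (c' := (F.start s).emb (fun w => (w, true)) id (fun l => some (some l))
    (some (some none))) (Option.some_ne_none _) (fun b => ?_) ?_
  · obtain ⟨a, w, hw⟩ := List.exists_cons_of_ne_nil hs
    refine Eq.trans (b := cond (s r).head?.isSome
      ⟨some (some (some F.main)), (F.init, (s r).head?.isSome), stk s fun _ => []⟩
      ⟨none, (F.init, (s r).head?.isSome), stk s fun _ => []⟩) rfl ?_
    rw [hw]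
    rfl
  · have := Yields.of_runs (g := regs) (κ := fun c => κ (regs c)) ((loopBody r F).runs h1)
      (T' := T' + (T * m + 1)) ?_
    · rw [PMF.bind_map] at this
      rw [PMF.bind_map]
      exact this
    · intro c' hc'
      rw [PMF.mem_support_map_iff] at hc'
      obtain ⟨c, hc, rfl⟩ := hc'
      have := loop_clean r F (regs c) (h (regs c) ((PMF.mem_support_map_iff _ _ _).2 ⟨c, hc, rfl⟩))
        (T * m) c.var true (fun k => c.stk (.inr k)) fun k => by
          have := length_stk_le hm h1 (.inr k) c hc
          simpa [start, stk] using this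
      convert this using 1
      · simp only [Cfg.emb, h2 c hc, Option.elim]
        exact congrArg (Cfg.mk _ _) (stk_eq _).symm
      · rfl

/-! ### Renaming of registers and local registers -/

/-- The stack of a renamed subroutine that is meant by a visible or local register. -/
def sideStk {R' L H : Type} : R' ⊕ L → R' ⊕ (L ⊕ H)
  | .inl r => .inl r
  | .inr l => .inr (.inl l)

/-- Visible and local registers both hold words. -/
def sideAlph {R' L H : Type} (Γ : H → Type) : ∀ x : R' ⊕ L,
    IOSymbol ≃ Alph (Sum.elim (fun _ : L => IOSymbol) Γ) (sideStk x)
  | .inl _ => Equiv.refl _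
  | .inr _ => Equiv.refl _

/-- The stack of a renamed subroutine that holds a given stack of the original one. -/
def renameStk {R' L H : Type} (j : R → R' ⊕ L) : R ⊕ H → R' ⊕ (L ⊕ H)
  | .inl r => sideStk (j r)
  | .inr h => .inr (.inr h)

/-- Renaming does not change the alphabets. -/
def renameAlph {R' L H : Type} (Γ : H → Type) (j : R → R' ⊕ L) : ∀ k : R ⊕ H,
    Alph Γ k ≃ Alph (Sum.elim (fun _ : L => IOSymbol) Γ) (renameStk j k)
  | .inl r => sideAlph Γ (j r)
  | .inr _ => Equiv.refl _

/-- The subroutine `F` with its registers renamed by `j`; the registers in `L` are local. -/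
abbrev rename {R' L : Type} [DecidableEq L] [Fintype L] (j : R → R' ⊕ L) (F : Subroutine R) :
    Subroutine R' where
  H := L ⊕ F.H
  Γ := Sum.elim (fun _ => IOSymbol) F.Γ
  finΓ := by
    rintro (h | h)
    · exact inferInstanceAs (Finite IOSymbol)
    · exact F.finΓ h
  Λ := F.Λ
  main := F.main
  σ := F.σ
  init := F.init
  code := fun b l => (F.code b l).emb (renameStk j) (renameAlph F.Γ j) id (fun v _ => v) id none

open Classical in
/-- The effect on the registers `R'` of a renamed subroutine: `s'` are the initial contents, `t` the
final contents of the registers of the original subroutine. -/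
noncomputable def renameRegs {R' L : Type} (j : R → R' ⊕ L) (s' : R' → Word) (t : R → Word)
    (r' : R') : Word :=
  if h : ∃ r, j r = .inl r' then t h.choose else s' r'

omit [DecidableEq R] in
theorem renameRegs_eq {R' L : Type} {j : R → R' ⊕ L} (hj : Function.Injective j) {s' : R' → Word}
    {t : R → Word} {r : R} {r' : R'} (h : j r = .inl r') : renameRegs j s' t r' = t r := by
  have hex : ∃ r, j r = .inl r' := ⟨r, h⟩
  rw [renameRegs, dif_pos hex]
  exact congrArg t (hj (hex.choose_spec.trans h.symm))

omit [DecidableEq R] in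
theorem renameRegs_of_ne {R' L : Type} {j : R → R' ⊕ L} {s' : R' → Word}
    {t : R → Word} {r' : R'} (h : ∀ r, j r ≠ .inl r') : renameRegs j s' t r' = s' r' := by
  rw [renameRegs, dif_neg (by simpa using h)]

/-- The hidden stacks of a renamed subroutine: its local registers and the stacks of the original
subroutine. -/
def withLocals {L H : Type} {Γ : H → Type} (t : L → Word) (S : ∀ h, List (Γ h)) :
    ∀ k, List (Sum.elim (fun _ : L => IOSymbol) Γ k)
  | .inl l => t l
  | .inr h => S h

omit [DecidableEq R] in
theorem stk_sideStk {R' L H : Type} (Γ : H → Type) (x : R' ⊕ L)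
    (s : R' → Word) (t : L → Word) (S : ∀ h, List (Γ h)) :
    stk (Γ := Sum.elim (fun _ : L => IOSymbol) Γ) s (withLocals t S)
      (sideStk x) = List.map (sideAlph Γ x) (Sum.elim s t x) := by
  rcases x with x | x <;> exact (List.map_id _).symm

open Classical in
/-- The contents of the local registers of a renamed subroutine. -/
noncomputable def renameLocals {R' L : Type} (j : R → R' ⊕ L) (t : R → Word) (l : L) : Word :=
  if h : ∃ r, j r = .inr l then t h.choose else []

/-- The embedding of `F` into `rename j F`, whose registers contain `s'` at the start. -/
noncomputable def renameEmb {R' L : Type} [DecidableEq L] [Fintype L] {j : R → R' ⊕ L}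
    (hj : Function.Injective j) (F : Subroutine R) (s' : R' → Word) :
    ProgramEmb F.code (rename j F).code id none id
      (fun S => stk (Γ := Sum.elim (fun _ => IOSymbol) F.Γ)
        (renameRegs j s' fun r => S (.inl r))
        (withLocals (renameLocals j fun r => S (.inl r)) fun k => S (.inr k))) where
  i := renameStk j
  e := renameAlph F.Γ j
  get := id
  set := fun v _ => v
  get_apply := fun _ => rfl
  set_apply := fun _ _ => rfl
  inj := by
    rintro (a | a) (b | b) h
    · refine congrArg _ (hj ?_)
      rcases ha : j a with x | x <;> rcases hb : j b with y | y <;>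
        simp_all [renameStk, sideStk]
    · rcases ha : j a with x | x <;> simp_all [renameStk, sideStk]
    · rcases hb : j b with x | x <;> simp_all [renameStk, sideStk]
    · simpa [renameStk, sideStk] using h
  stk_image := by
    rintro S (r | h)
    · have h1 := stk_sideStk F.Γ (j r) (renameRegs j s' fun r => S (.inl r))
        (renameLocals j fun r => S (.inl r)) fun k => S (.inr k)
      have h2 : Sum.elim (renameRegs j s' fun r => S (.inl r))
          (renameLocals j fun r => S (.inl r)) (j r) = S (.inl r) := by
        rcases hr : j r with r' | l
        · exact renameRegs_eq (t := fun r => S (.inl r)) hj hr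
        · have hex : ∃ r, j r = .inr l := ⟨r, hr⟩
          have hc : hex.choose = r := hj (hex.choose_spec.trans hr.symm)
          refine (dif_pos hex).trans ?_
          rw [hc]
      rw [h2] at h1
      exact h1
    · exact (List.map_id _).symm
  stk_frame := by
    rintro S S' (r' | l | k) h
    · have : ∀ r, j r ≠ .inl r' := fun r hr => h (.inl r) (by simp [renameStk, sideStk, hr])
      change renameRegs j s' (fun r => S (.inl r)) r' = renameRegs j s' (fun r => S' (.inl r)) r'
      rw [renameRegs_of_ne this, renameRegs_of_ne this]
    · have : ¬ ∃ r, j r = .inr l := fun ⟨r, hr⟩ => h (.inl r) (by simp [renameStk, sideStk, hr])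
      change renameLocals j (fun r => S (.inl r)) l = renameLocals j (fun r => S' (.inl r)) l
      rw [renameLocals, renameLocals, dif_neg this, dif_neg this]
    · exact absurd rfl (h (.inr k))
  code_eq := fun _ _ => rfl

theorem RunsTo.rename {R' L : Type} [DecidableEq R'] [DecidableEq L] [Fintype L] {j : R → R' ⊕ L}
    (hj : Function.Injective j) {F : Subroutine R} {s' : R' → Word} {T : ℕ} {ν : PMF (R → Word)}
    (h : F.RunsTo (fun r => Sum.elim s' (fun _ => []) (j r)) T ν) :
    (rename j F).RunsTo s' T (ν.map (renameRegs j s')) := by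
  have := (renameEmb hj F s').yields (g' := regs) h (renameRegs j s') (fun c => rfl)
  refine Eq.subst (motive := fun c => Yields (Subroutine.rename j F).code regs c T _) ?_ this
  refine congrArg (Cfg.mk _ _) (Eq.symm ?_)
  funext k
  rcases k with r' | l | k
  · change s' r' = renameRegs j s' (fun r => Sum.elim s' (fun _ => []) (j r)) r'
    by_cases hr : ∃ r, j r = .inl r'
    · obtain ⟨r, hr⟩ := hr
      rw [renameRegs_eq hj hr, hr]; rfl
    · push Not at hr
      rw [renameRegs_of_ne hr]
  · change [] = renameLocals j (fun r => Sum.elim s' (fun _ => []) (j r)) l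
    rw [renameLocals]
    split_ifs with hl
    · change [] = Sum.elim s' (fun _ => []) (j hl.choose)
      rw [hl.choose_spec]; rfl
    · rfl
  · rfl

end Subroutine

/-! ### Probabilistic Turing machines as subroutines, and back -/

namespace ProbTM

/-- The two transition programs of a probabilistic Turing machine, indexed by the coin. -/
def program (M : ProbTM) (b : Bool) : M.tm.Λ → Stmt M.tm.Γ M.tm.Λ M.tm.σ :=
  if b then M.m' else M.tm.m

theorem run_of_halted (M : ProbTM) {c : M.tm.Cfg} (hc : M.Halted c) (t : ℕ) :
    M.run t c = PMF.pure c := by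
  have hs : ∀ b, M.stepWith b c = c := by
    intro b
    obtain ⟨l, v, S⟩ := c
    obtain rfl : l = none := hc
    rfl
  induction t with
  | zero => rfl
  | succ t ih => simp only [run, hs, ih, PMF.bind_const]

theorem runs_run (M : ProbTM) (t : ℕ) : ∀ c : M.tm.Cfg,
    (∀ c' ∈ (M.run t c).support, M.Halted c') →
    Runs (coinStep M.program) (fun c => c.l = none) c t (M.run t c) := by
  induction t with
  | zero => intro c _; exact .done c 0
  | succ t ih =>
    intro c hc
    by_cases h : M.Halted c
    · rw [M.run_of_halted h]; exact .done c _
    · refine .step c t (fun b => M.run t (M.stepWith b c)) h fun b => ih _ fun c' hc' => hc c' ?_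
      simp only [run, PMF.mem_support_bind_iff]
      exact ⟨b, by simp, hc'⟩

/-- The clock of `ProbTM.run` does not matter once all paths have halted. -/
theorem run_eq_of_runs (M : ProbTM) {c : M.tm.Cfg} {t : ℕ} {μ : PMF M.tm.Cfg}
    (h : Runs (coinStep M.program) (fun c => c.l = none) c t μ)
    (hμ : ∀ c' ∈ μ.support, M.Halted c') : M.run t c = μ := by
  induction h with
  | done c t => exact M.run_of_halted (hμ c (by simp)) t
  | step c t μ hc h ih =>
    simp only [run]
    congr 1
    funext b
    refine ih b fun c' hc' => hμ c' ?_
    rw [PMF.mem_support_bind_iff]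
    exact ⟨b, by simp, hc'⟩

end ProbTM

namespace Subroutine

/-- The machine `M` as a subroutine. It reads its input, reversed, from register `0`, and leaves its
output, reversed, in register `1`. -/
abbrev call (M : ProbTM) : Subroutine (Fin 2) where
  H := M.tm.K
  decH := M.tm.kDecidableEq
  finH := M.tm.kFin
  Γ := M.tm.Γ
  finΓ := M.finΓ
  Λ := Option (Option M.tm.Λ)
  finΛ := @instFintypeOption _ (@instFintypeOption _ M.tm.ΛFin)
  main := none
  σ := M.tm.σ × Option IOSymbol
  finσ := @instFintypeProd _ _ M.tm.σFin _
  init := (M.tm.initialState, none)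
  code := fun b l => match l with
    | none => .pop (.inl 0) (fun v o => (v.1, o)) (.branch (fun v => v.2.isSome)
        (.push (.inr M.tm.k₀) (fun v => M.inp (v.2.getD none)) (.goto fun _ => none))
        (.goto fun _ => some (some M.tm.main)))
    | some none => .pop (.inr M.tm.k₁) (fun v o => (v.1, o.map M.out))
        (.branch (fun v => v.2.isSome)
        (.push (.inl 1) (fun v => v.2.getD none) (.goto fun _ => some none)) .halt)
    | some (some l) => (M.program b l).emb .inr (fun _ => Equiv.refl _) Prod.fst
        (fun v w => (v, w.2)) (fun l => some (some l)) (some (some none))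

/-- The embedding of the program of `M` into `call M`; halting becomes a jump to the unloading
phase. -/
def callEmb (M : ProbTM) :
    ProgramEmb M.program (call M).code (fun l => some (some l)) (some (some none))
      (fun w => (w, none)) (fun S => stk (fun _ : Fin 2 => []) S) where
  i := .inr
  e := fun _ => Equiv.refl _
  get := Prod.fst
  set := fun v w => (v, w.2)
  get_apply := fun _ => rfl
  set_apply := fun _ _ => rfl
  inj := Sum.inr_injective
  stk_image := fun _ _ => (List.map_id _).symm
  stk_frame := by
    rintro S S' (r | k) h
    · rfl
    · exact absurd rfl (h k)
  code_eq := fun _ _ => rfl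

theorem stk_update_inl {R H : Type} [DecidableEq R] [DecidableEq H] {Γ : H → Type} (s : R → Word)
    (S : ∀ k, List (Γ k)) (r : R) (w : Word) :
    Function.update (stk s S) (.inl r) w = stk (Function.update s r w) S := by
  funext k
  rcases k with k | k
  · by_cases h : k = r
    · subst h; simp [stk]
    · simp [stk, h]
  · simp [stk]

theorem stk_update_inr {R H : Type} [DecidableEq R] [DecidableEq H] {Γ : H → Type} (s : R → Word)
    (S : ∀ k, List (Γ k)) (h : H) (w : List (Γ h)) :
    Function.update (stk s S) (.inr h) w = stk s (Function.update S h w) := by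
  funext k
  rcases k with k | k
  · simp [stk]
  · by_cases hk : k = h
    · subst hk; simp [stk]
    · simp [stk, hk]

/-- The loading phase moves the register `0` to the input stack, which reverses it. -/
theorem call_load (M : ProbTM) {T : ℕ} {ν : PMF (Fin 2 → Word)} (w : Word) :
    ∀ (o : Option IOSymbol) (w' : Word),
    Yields (call M).code regs
      ⟨some (some (some M.tm.main)), (M.tm.initialState, none), stk (fun _ => [])
        (Function.update (fun _ => []) M.tm.k₀ ((w.reverse ++ w').map M.inp))⟩ T ν →
    Yields (call M).code regs
      ⟨some none, (M.tm.initialState, o), stk (fun i => if i = 0 then w else [])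
        (Function.update (fun _ => []) M.tm.k₀ (w'.map M.inp))⟩ (T + w.length + 1) ν := by
  induction w with
  | nil =>
    intro o w' h
    refine Yields.head (Option.some_ne_none _) (fun b => ?_) h
    refine Eq.trans (b := ⟨some (some (some M.tm.main)), (M.tm.initialState, none),
      Function.update (stk (fun i : Fin 2 => if i = 0 then [] else []) (Function.update
        (fun _ => []) M.tm.k₀ (w'.map M.inp))) (.inl 0) []⟩) rfl ?_
    rw [stk_update_inl]
    refine congrArg (Cfg.mk _ _) ?_
    congr 1
    funext i
    by_cases hi : i = 0 <;> simp [hi]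
  | cons a w ih =>
    intro o w' h
    have := ih (some a) (a :: w') (by simpa using h)
    refine Yields.mono (Yields.head (Option.some_ne_none _) (fun b => ?_) this)
      (by simp only [List.length_cons]; omega)
    refine Eq.trans (b := ⟨some none, (M.tm.initialState, some a),
      Function.update (Function.update (stk (fun i : Fin 2 => if i = 0 then a :: w else [])
        (Function.update (fun _ => []) M.tm.k₀ (w'.map M.inp))) (.inl 0) w)
        (.inr M.tm.k₀) (M.inp a :: Function.update (fun _ => []) M.tm.k₀ (w'.map M.inp) M.tm.k₀)⟩)
      rfl ?_
    rw [stk_update_inl, stk_update_inr]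
    refine congrArg (Cfg.mk _ _) ?_
    congr 1
    · funext i
      by_cases hi : i = 0 <;> simp [hi]
    · simp

/-- The unloading phase moves the output stack to the register `1`, which reverses it. -/
theorem call_unload (M : ProbTM) (n : ℕ) : ∀ (v : M.tm.σ × Option IOSymbol) (w : Word)
    (S : ∀ k, List (M.tm.Γ k)), (S M.tm.k₁).length ≤ n →
    Yields (call M).code regs
      ⟨some (some none), v, stk (fun i => if i = 0 then [] else w) S⟩ (n + 1)
      (PMF.pure fun i => if i = 0 then [] else ((S M.tm.k₁).map M.out).reverse ++ w) := by
  induction n with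
  | zero =>
    intro v w S hS
    have hS : S M.tm.k₁ = [] := by simpa using hS
    refine Yields.head (c' := ⟨none, (v.1, none), stk (fun i => if i = 0 then [] else w) S⟩)
      (Option.some_ne_none _) (fun b => ?_) ?_
    · refine Eq.trans (b := cond ((S M.tm.k₁).head?.map M.out).isSome
        ⟨some (some none), (v.1, (S M.tm.k₁).head?.map M.out), Function.update
          (Function.update (stk (fun i : Fin 2 => if i = 0 then [] else w) S) (.inr M.tm.k₁)
            (S M.tm.k₁).tail) (.inl 1) (((S M.tm.k₁).head?.map M.out).getD none :: w)⟩
        ⟨none, (v.1, (S M.tm.k₁).head?.map M.out),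
          (Function.update (stk (fun i : Fin 2 => if i = 0 then [] else w) S) (.inr M.tm.k₁)
            (S M.tm.k₁).tail)⟩) rfl ?_
      rw [stk_update_inr, hS]
      refine congrArg (Cfg.mk _ _) ?_
      congr 1
      simp only [List.tail_nil]
      rw [← hS, Function.update_eq_self]
    · rw [hS]
      exact Yields.halted _ rfl 0
  | succ n ih =>
    intro v w S hS
    rcases hk : S M.tm.k₁ with _ | ⟨a, l⟩
    · have := ih v w S (by simp [hk])
      rw [hk] at this
      exact this.mono (by omega)
    · have := ih (v.1, some (M.out a)) (M.out a :: w) (Function.update S M.tm.k₁ l) (by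
        rw [hk] at hS; simpa using hS)
      rw [Function.update_self] at this
      simp only [List.map_cons, List.reverse_cons, List.append_assoc, List.singleton_append]
      refine Yields.head (Option.some_ne_none _) (fun b => ?_) this
      refine Eq.trans (b := cond ((S M.tm.k₁).head?.map M.out).isSome
        ⟨some (some none), (v.1, (S M.tm.k₁).head?.map M.out), Function.update
          (Function.update (stk (fun i : Fin 2 => if i = 0 then [] else w) S) (.inr M.tm.k₁)
            (S M.tm.k₁).tail) (.inl 1) (((S M.tm.k₁).head?.map M.out).getD none :: w)⟩
        ⟨none, (v.1, (S M.tm.k₁).head?.map M.out),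
          (Function.update (stk (fun i : Fin 2 => if i = 0 then [] else w) S) (.inr M.tm.k₁)
            (S M.tm.k₁).tail)⟩) rfl ?_
      rw [stk_update_inr, stk_update_inl, hk]
      refine congrArg (Cfg.mk _ _) ?_
      congr 1
      funext i
      by_cases hi : i = 1
      · subst hi; simp
      · obtain rfl : i = 0 := by omega
        simp

theorem exists_program_pushes_le (M : ProbTM) : ∃ m, ∀ b l, (M.program b l).pushes ≤ m :=
  letI := M.tm.ΛFin
  ⟨Finset.univ.sup fun x : Bool × M.tm.Λ => (M.program x.1 x.2).pushes, fun b l =>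
    Finset.le_sup (f := fun x : Bool × M.tm.Λ => (M.program x.1 x.2).pushes)
      (Finset.mem_univ (b, l))⟩

theorem call_runsTo (M : PPT) {m : ℕ} (hm : ∀ b l, (M.toProbTM.program b l).pushes ≤ m)
    (w : Word) :
    (call M.toProbTM).RunsTo (fun i => if i = 0 then w.reverse else [])
      (M.time.eval w.length + (w.length + M.time.eval w.length * m + 1) + w.length + 1)
      ((M.output w).map fun w' i => if i = 0 then [] else w'.reverse) := by
  have hr := M.runs_run _ (M.init w) (M.halts w)
  obtain ⟨μ, hμ⟩ : ∃ μ : PMF (Cfg M.tm.Γ M.tm.Λ M.tm.σ),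
      μ = M.run (M.time.eval w.length) (M.init w) := ⟨_, rfl⟩
  have hhalt : ∀ c ∈ μ.support, c.l = none := by rw [hμ]; exact M.halts w
  have hout : M.output w = μ.map fun c => (c.stk M.tm.k₁).map M.out := by rw [hμ]; rfl
  rw [← hμ] at hr
  have key := Yields.of_runs (g := regs) (T' := w.length + M.time.eval w.length * m + 1)
    (κ := fun c => PMF.pure fun i : Fin 2 => if i = 0 then [] else
      (((c.stk (.inr M.tm.k₁) : List (M.tm.Γ M.tm.k₁)).map M.out).reverse ++ []))
    ((callEmb M.toProbTM).runs hr) ?_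
  · have := call_load M.toProbTM (T := M.time.eval w.length +
      (w.length + M.time.eval w.length * m + 1)) (ν := (M.output w).map fun w' i =>
        if i = 0 then [] else w'.reverse) w.reverse none [] ?_
    · rw [List.length_reverse] at this
      refine Eq.subst (motive := fun c => Yields (call M.toProbTM).code regs c _ _) ?_ this
      refine congrArg (Cfg.mk _ _) ?_
      congr 1
      simp
    · convert key using 1
      · rw [List.reverse_reverse, List.append_nil]
        rfl
      · rw [PMF.bind_map, hout, PMF.map_comp]
        simp only [List.append_nil]
        rfl
  · intro c' hc'
    rw [PMF.mem_support_map_iff] at hc'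
    obtain ⟨c, hc, rfl⟩ := hc'
    have hl : c.l = none := hhalt c hc
    have hlen := length_stk_le hm hr M.tm.k₁ c hc
    have hlen' : ((M.init w).stk M.tm.k₁).length ≤ w.length := by
      simp only [ProbTM.init]
      by_cases h : M.tm.k₁ = M.tm.k₀
      · rw [h]; simp
      · simp [h]
    have := call_unload M.toProbTM (w.length + M.time.eval w.length * m) (c.var, none) [] c.stk
      (by omega)
    refine Eq.subst (motive := fun c => Yields (call M.toProbTM).code regs c _ _) ?_ this
    rw [Cfg.emb, hl]
    refine congrArg (Cfg.mk _ _) ?_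
    congr 1
    funext i
    by_cases hi : i = 0 <;> simp [hi]

variable (F : Subroutine (Option Unit))

/-- A subroutine as a machine with the input register `some ()` and the output register `none`. -/
def toProbTM : ProbTM where
  tm :=
    { K := Option Unit ⊕ F.H
      k₀ := .inl (some ())
      k₁ := .inl none
      Γ := Alph F.Γ
      Λ := F.Λ
      main := F.main
      σ := F.σ
      initialState := F.init
      Γk₀Fin := inferInstanceAs (Fintype IOSymbol)
      m := F.code false }
  m' := F.code true
  finΓ := by
    rintro (r | h)
    · exact inferInstanceAs (Finite IOSymbol)
    · exact F.finΓ h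
  inp := Equiv.refl _
  out := Equiv.refl _

theorem toProbTM_program : (toProbTM F).program = F.code := by
  funext b
  cases b <;> rfl

/-- A subroutine that computes its output register from its input register in polynomial time gives
a probabilistic polynomial-time Turing machine. -/
theorem exists_ppt {e : Word → PMF Word} (p : Polynomial ℕ)
    (h : ∀ w, ∃ ν, F.RunsTo (fun o => o.elim [] fun _ => w) (p.eval w.length) ν ∧
      ν.map (fun s => s none) = e w) : ∃ M : PPT, ∀ w, M.output w = e w := by
  have key : ∀ w, ∃ μ, (toProbTM F).run (p.eval w.length) ((toProbTM F).init w) = μ ∧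
      (∀ c ∈ μ.support, (toProbTM F).Halted c) ∧ μ.map (toProbTM F).read = e w := by
    intro w
    obtain ⟨_, ⟨μ, h1, h2, rfl⟩, h3⟩ := h w
    refine ⟨μ, ?_, h2, ?_⟩
    · refine (toProbTM F).run_eq_of_runs ?_ h2
      rw [toProbTM_program]
      refine Eq.subst (motive := fun c => Runs (coinStep F.code) (fun c => c.l = none) c _ μ) ?_ h1
      refine congrArg (Cfg.mk _ _) ?_
      funext k
      have hu : ∀ (k : Option Unit ⊕ F.H), stk (Γ := F.Γ) (fun o => o.elim [] fun _ => w)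
          (fun _ => []) k = Function.update (β := fun k => List (Alph F.Γ k)) (fun _ => [])
            (.inl (some ())) w k := by
        rintro ((_ | _) | k)
        · simp [stk]
        · simp [stk]
        · simp [stk]
      refine (hu k).trans ?_
      refine congrFun (congrArg (Function.update (β := fun k => List (Alph F.Γ k)) (fun _ => [])
        (.inl (some ()))) ?_) k
      exact (List.map_id w).symm
    · rw [← h3, PMF.map_comp]
      congr 1
      funext c
      exact List.map_id _
  refine ⟨{ toProbTM := toProbTM F, time := p, halts := fun w => ?_ }, fun w => ?_⟩
  · obtain ⟨μ, h1, h2, -⟩ := key w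
    rw [h1]; exact h2
  · obtain ⟨μ, h1, -, h3⟩ := key w
    rw [PPT.output, h1]; exact h3

end Subroutine

/-! ### Polynomial bounds -/

theorem Polynomial.eval_mono_nat (p : Polynomial ℕ) {a b : ℕ} (h : a ≤ b) :
    p.eval a ≤ p.eval b := by
  rw [Polynomial.eval_eq_sum, Polynomial.eval_eq_sum]
  exact Finset.sum_le_sum fun i _ => Nat.mul_le_mul_left _ (Nat.pow_le_pow_left h i)

section Bounds

variable {ι κ : Type} [Fintype ι] [Fintype κ]

/-- The total length of a tuple of words. -/
def size (s : ι → Word) : ℕ := ∑ i, (s i).length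

theorem length_le_size (s : ι → Word) (i : ι) : (s i).length ≤ size s :=
  Finset.single_le_sum (f := fun i => (s i).length) (fun _ _ => Nat.zero_le _) (Finset.mem_univ i)

/-- A tuple of words, extended by the word `w` at the new index `none`. -/
def extend (s : ι → Word) (w : Word) : Option ι → Word := fun o => o.elim w s

theorem size_extend (s : ι → Word) (w : Word) : size (extend s w) = size s + w.length := by
  simp [size, extend, Fintype.sum_option, add_comm]

theorem size_comp_le {ρ : κ → ι} (hρ : Function.Injective ρ) (s : ι → Word) :
    size (s ∘ ρ) ≤ size s := by
  have := Finset.sum_map Finset.univ ⟨ρ, hρ⟩ fun i => (s i).length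
  refine (le_of_eq this.symm).trans (Finset.sum_le_sum_of_subset (Finset.subset_univ _))

/-- Functions of a tuple of words that are bounded by a polynomial in the total length. -/
def PolyBdd (f : (ι → Word) → ℕ) : Prop := ∃ p : Polynomial ℕ, ∀ s, f s ≤ p.eval (size s)

namespace PolyBdd

variable {f g : (ι → Word) → ℕ}

theorem of_le (hg : PolyBdd g) (h : ∀ s, f s ≤ g s) : PolyBdd f := by
  obtain ⟨p, hp⟩ := hg
  exact ⟨p, fun s => (h s).trans (hp s)⟩

theorem const (c : ℕ) : PolyBdd fun _ : ι → Word => c := ⟨Polynomial.C c, fun s => by simp⟩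

theorem size : PolyBdd (size : (ι → Word) → ℕ) := ⟨Polynomial.X, fun s => by simp⟩

theorem length (i : ι) : PolyBdd fun s : ι → Word => (s i).length :=
  size.of_le fun s => length_le_size s i

theorem add (hf : PolyBdd f) (hg : PolyBdd g) : PolyBdd fun s => f s + g s := by
  obtain ⟨p, hp⟩ := hf
  obtain ⟨q, hq⟩ := hg
  exact ⟨p + q, fun s => by rw [Polynomial.eval_add]; exact Nat.add_le_add (hp s) (hq s)⟩

theorem mul (hf : PolyBdd f) (hg : PolyBdd g) : PolyBdd fun s => f s * g s := by
  obtain ⟨p, hp⟩ := hf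
  obtain ⟨q, hq⟩ := hg
  exact ⟨p * q, fun s => by rw [Polynomial.eval_mul]; exact Nat.mul_le_mul (hp s) (hq s)⟩

theorem eval (p : Polynomial ℕ) (hf : PolyBdd f) : PolyBdd fun s => p.eval (f s) := by
  obtain ⟨q, hq⟩ := hf
  exact ⟨p.comp q, fun s => by rw [Polynomial.eval_comp]; exact p.eval_mono_nat (hq s)⟩

end PolyBdd

end Bounds

/-! ### Randomized word functions computable in polynomial time -/

open Subroutine

/-- A randomized function of a tuple of words is samplable if a subroutine computes it in polynomial
time for all coin tosses, leaving the arguments unchanged and the value in the register `none`. -/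
def Samplable {ι : Type} [Fintype ι] [DecidableEq ι] (e : (ι → Word) → PMF Word) : Prop :=
  ∃ (F : Subroutine (Option ι)) (t : (ι → Word) → ℕ), PolyBdd t ∧
    ∀ s, F.RunsTo (extend s []) (t s) ((e s).map (extend s))

namespace Subroutine

variable {R : Type} [DecidableEq R]

/-- Empty the register `r` while pushing its symbols to the registers in `rs`. -/
noncomputable abbrev move (r : R) (rs : List R) : Subroutine R := loop r (mv r rs)

/-- Moving takes time linear in the length of the word, and reverses it. -/
theorem move_runsTo (r : R) (rs : List R) (hrs : rs.Nodup) (hr : r ∉ rs) :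
    ∃ c, ∀ s : R → Word, (move r rs).RunsTo s ((s r).length * c + 1)
      (PMF.pure fun r' => if r' = r then [] else if r' ∈ rs then (s r).reverse ++ s r' else s r') := by
  obtain ⟨m, hm⟩ := (mv r rs).exists_pushes_le
  refine ⟨m + 3, fun s => ?_⟩
  generalize hw : s r = w
  induction w generalizing s with
  | nil =>
    have := loop_runsTo_nil r (mv r rs) hw
    convert this.mono (T' := ([] : Word).length * (m + 3) + 1) (by simp) using 2
    funext r'
    by_cases h : r' = r
    · subst h; simp [hw]
    · simp [h]
  | cons a w ih =>
    have h1 := mv_runsTo r rs hrs hr s a w hw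
    have := loop_runsTo_cons hm (r := r) (by simp [hw]) h1 (T' := w.length * (m + 3) + 1)
      (κ := fun s' => PMF.pure fun r' => if r' = r then [] else
        if r' ∈ rs then w.reverse ++ s' r' else s' r') fun s' hs' => ?_
    · rw [PMF.pure_bind] at this
      convert this.mono (T' := (a :: w).length * (m + 3) + 1)
        (by simp only [List.length_cons, Nat.add_mul]; omega) using 2
      funext r'
      by_cases h : r' = r
      · simp [h]
      · by_cases h' : r' ∈ rs <;> simp [h, h']
    · refine ih s' ?_
      rw [PMF.mem_support_pure_iff] at hs'
      simp [hs']

/-- Renaming the registers along an injection into a larger set of registers. -/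
theorem RunsTo.rename_inj {R' : Type} [DecidableEq R'] {j : R → R'} (hj : Function.Injective j)
    {F : Subroutine R} {s' : R' → Word} {T : ℕ} {ν : PMF (R → Word)}
    (h : F.RunsTo (s' ∘ j) T ν) {α : Type} {μ : PMF α} {g : α → R → Word} (hν : ν = μ.map g)
    {g' : α → R' → Word} (h₁ : ∀ a r, g' a (j r) = g a r)
    (h₂ : ∀ a r', (∀ r, j r ≠ r') → g' a r' = s' r') :
    (F.rename fun r => (Sum.inl (j r) : R' ⊕ Empty)).RunsTo s' T (μ.map g') := by
  have hinj : Function.Injective fun r => (Sum.inl (j r) : R' ⊕ Empty) :=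
    fun a b hab => hj (Sum.inl_injective hab)
  have := RunsTo.rename hinj (s' := s') h
  rw [hν, PMF.map_comp] at this
  convert this using 2
  funext a r'
  by_cases hr : ∃ r, j r = r'
  · obtain ⟨r, rfl⟩ := hr
    rw [h₁, Function.comp_apply, renameRegs_eq hinj rfl]
  · push Not at hr
    rw [h₂ a r' hr, Function.comp_apply, renameRegs_of_ne fun r hr' => hr r (Sum.inl_injective hr')]

theorem RunsTo.seq_pure {F G : Subroutine R} {s s' : R → Word} {T T' : ℕ} {ν : PMF (R → Word)}
    (hF : F.RunsTo s T (PMF.pure s')) (hG : G.RunsTo s' T' ν) :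
    (F.seq G).RunsTo s (T + T') ν := by
  have := hF.seq (G := G) (T' := T') (κ := fun _ => ν) fun t ht => by
    rw [PMF.mem_support_pure_iff] at ht
    rwa [ht]
  rwa [PMF.pure_bind] at this

theorem RunsTo.seq_map {F G : Subroutine R} {s : R → Word} {T T' : ℕ} {α : Type} {μ : PMF α}
    {g : α → R → Word} (hg : Function.Injective g) {κ : α → PMF (R → Word)}
    (hF : F.RunsTo s T (μ.map g)) (hG : ∀ a ∈ μ.support, G.RunsTo (g a) T' (κ a)) :
    (F.seq G).RunsTo s (T + T') (μ.bind κ) := by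
  have : Nonempty α := ⟨μ.support_nonempty.some⟩
  have := hF.seq (G := G) (T' := T') (κ := fun t => κ (Function.invFun g t)) fun t ht => by
    obtain ⟨a, ha, rfl⟩ := (PMF.mem_support_map_iff _ _ _).1 ht
    rw [Function.leftInverse_invFun hg]
    exact hG a ha
  rw [PMF.bind_map] at this
  convert this using 2
  funext a
  rw [Function.comp_apply, Function.leftInverse_invFun hg]

/-- Hiding the registers of the second kind. -/
theorem RunsTo.hide {L : Type} [DecidableEq L] [Fintype L] {F : Subroutine (R ⊕ L)}
    {s : R → Word} {T : ℕ} {ν : PMF (R ⊕ L → Word)}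
    (h : F.RunsTo (Sum.elim s fun _ => []) T ν) :
    (F.rename (id : R ⊕ L → R ⊕ L)).RunsTo s T (ν.map fun t r => t (.inl r)) := by
  have := RunsTo.rename (j := (id : R ⊕ L → R ⊕ L)) Function.injective_id (s' := s) h
  convert this using 2
  funext t r
  rw [renameRegs_eq Function.injective_id rfl]

/-- The subroutine that does nothing. -/
def skip : Subroutine R := single () fun _ => .halt

theorem skip_runsTo (s : R → Word) : skip.RunsTo s 1 (PMF.pure s) :=
  single_runsTo_pure _ rfl rfl

end Subroutine

namespace Samplable

variable {ι κ : Type} [Fintype ι] [DecidableEq ι] [Fintype κ] [DecidableEq κ]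
  {e e₁ e₂ : (ι → Word) → PMF Word}

/-- The values of a samplable function have polynomial length. -/
theorem exists_length_le (he : Samplable e) :
    ∃ t, PolyBdd t ∧ ∀ s, ∀ w ∈ (e s).support, w.length ≤ t s := by
  obtain ⟨F, t, ht, hF⟩ := he
  obtain ⟨m, hm⟩ := F.exists_pushes_le
  refine ⟨fun s => t s * m, ht.mul (.const m), fun s w hw => ?_⟩
  have := (hF s).length_le hm none (extend s w) ((PMF.mem_support_map_iff _ _ _).2 ⟨w, hw, rfl⟩)
  simpa [extend] using this

theorem nil : Samplable fun _ : ι → Word => PMF.pure [] :=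
  ⟨skip, _, .const 1, fun s => by rw [PMF.pure_map]; exact skip_runsTo _⟩

theorem coin : Samplable fun _ : ι → Word =>
    (PMF.uniformOfFintype Bool).map fun b => [some b] := by
  refine ⟨push none some, _, .const 1, fun s => ?_⟩
  have := push_runsTo none some (extend s [])
  rw [PMF.map_comp]
  convert this using 2
  funext b o
  cases o <;> simp [extend]

theorem cons (a : IOSymbol) (he : Samplable e) : Samplable fun s => (e s).map (a :: ·) := by
  obtain ⟨F, t, ht, hF⟩ := he
  refine ⟨F.seq (push none fun _ => a), _, ht.add (.const 1), fun s => ?_⟩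
  have := (hF s).seq (G := push none fun _ => a) fun s' _ => push_runsTo none (fun _ => a) s'
  convert this using 1
  rw [PMF.map_comp, PMF.bind_map]
  refine congrArg _ (funext fun w => ?_)
  simp only [Function.comp_apply]
  rw [show (fun _ : Bool => Function.update (extend s w) none (a :: extend s w none)) =
    Function.const Bool (extend s (a :: w)) by
      funext b o; cases o <;> simp [extend], PMF.map_const]

theorem tail (he : Samplable e) : Samplable fun s => (e s).map List.tail := by
  obtain ⟨F, t, ht, hF⟩ := he
  refine ⟨F.seq (mv none []), _, ht.add (.const 1), fun s => ?_⟩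
  have := (hF s).seq (G := mv none []) (T' := 1)
    (κ := fun s' => PMF.pure fun o => if o = none then (s' none).tail else s' o) fun s' _ => ?_
  · convert this using 1
    rw [PMF.map_comp, PMF.bind_map]
    refine congrArg _ (funext fun w => congrArg PMF.pure (funext fun o => ?_))
    cases o <;> simp [extend]
  · rcases hs : s' none with _ | ⟨a, w⟩
    · convert mv_runsTo_nil none [] s' hs using 2
      funext o
      cases o <;> simp [hs]
    · convert mv_runsTo none [] (by simp) (by simp) s' a w hs using 2
      simp

/-- Copying an argument. It is moved to a local register, which reverses it, and from there back to
its place and to the register of the value. -/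
theorem var (i : ι) : Samplable fun s : ι → Word => PMF.pure (s i) := by
  obtain ⟨c₁, h₁⟩ := move_runsTo (R := Option ι ⊕ Unit) (.inl (some i)) [.inr ()]
    (by simp) (by simp)
  obtain ⟨c₂, h₂⟩ := move_runsTo (R := Option ι ⊕ Unit) (.inr ()) [.inl (some i), .inl none]
    (by simp) (by simp)
  have hl := PolyBdd.length i
  refine ⟨Subroutine.rename (id : Option ι ⊕ Unit → Option ι ⊕ Unit) (Subroutine.seq
    (move (.inl (some i)) [.inr ()]) (move (.inr ()) [.inl (some i), .inl none])),
    _, ((hl.mul (.const c₁)).add (.const 1)).add ((hl.mul (.const c₂)).add (.const 1)),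
    fun s => ?_⟩
  let st : Word → Word → Word → Option ι ⊕ Unit → Word := fun o a w =>
    Sum.elim (extend (Function.update s i a) o) fun _ => w
  have f1 : (move (.inl (some i)) [.inr ()]).RunsTo (st [] (s i) []) ((s i).length * c₁ + 1)
      (PMF.pure (st [] [] (s i).reverse)) := by
    convert h₁ (st [] (s i) []) using 2
    · simp [st, extend]
    funext r
    rcases r with (_ | k) | r
    · simp [st, extend]
    · by_cases hk : k = i
      · subst hk; simp [st, extend]
      · simp [st, extend, hk]
    · simp [st, extend]
  have f2 : (move (.inr ()) [.inl (some i), .inl none]).RunsTo (st [] [] (s i).reverse)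
      ((s i).length * c₂ + 1)
      (PMF.pure (st (s i) (s i) [])) := by
    convert h₂ (st [] [] (s i).reverse) using 2
    · simp [st]
    funext r
    rcases r with (_ | k) | r
    · simp [st, extend]
    · by_cases hk : k = i
      · subst hk; simp [st, extend]
      · simp [st, extend, hk]
    · simp [st]
  have f := (f1.seq_pure f2).hide
  rw [PMF.pure_map, Function.update_eq_self] at f
  convert f using 1
  rw [PMF.pure_map]
  refine congrArg _ (funext fun o => ?_)
  simp [st]

theorem ite_var (i : ι) (o : Option IOSymbol) (h₁ : Samplable e₁) (h₂ : Samplable e₂) :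
    Samplable fun s => if (s i).head? = o then e₁ s else e₂ s := by
  obtain ⟨F, t, ht, hF⟩ := h₁
  obtain ⟨G, u, hu, hG⟩ := h₂
  refine ⟨ite (some i) o F G, _, (ht.add hu).add (.const 1), fun s => ?_⟩
  refine RunsTo.ite (fun h => ?_) fun h => ?_
  · have h : (s i).head? = o := h
    simp only [if_pos h]
    exact (hF s).mono (Nat.le_add_right _ _)
  · have h : ¬ (s i).head? = o := h
    simp only [if_neg h]
    exact (hG s).mono (Nat.le_add_left _ _)

/-- Renaming the arguments, and adding irrelevant ones. -/
theorem comp_injective {e : (κ → Word) → PMF Word} (he : Samplable e) {ρ : κ → ι}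
    (hρ : Function.Injective ρ) : Samplable fun s : ι → Word => e (s ∘ ρ) := by
  obtain ⟨F, t, ⟨p, hp⟩, hF⟩ := he
  refine ⟨F.rename fun o => (Sum.inl (o.map ρ) : Option ι ⊕ Empty), fun s => p.eval (size s),
    .eval p .size, fun s => ?_⟩
  refine RunsTo.rename_inj (j := Option.map ρ) (Option.map_injective hρ) (ν := (e (s ∘ ρ)).map
    (extend (s ∘ ρ))) ?_ rfl (fun w o => ?_) fun w o ho => ?_
  · have := (hF (s ∘ ρ)).mono ((hp _).trans (p.eval_mono_nat (size_comp_le hρ s)))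
    convert this using 1
    funext o
    cases o <;> rfl
  · cases o <;> rfl
  · cases o
    · exact absurd rfl (ho none)
    · rfl

/-- Sequencing: the value of `e` is an additional argument of `f`. -/
theorem bind {f : (Option ι → Word) → PMF Word} (he : Samplable e) (hf : Samplable f) :
    Samplable fun s => (e s).bind fun w => f (extend s w) := by
  obtain ⟨b, hb, hlen⟩ := he.exists_length_le
  obtain ⟨F, t, ht, hF⟩ := he
  obtain ⟨G, u, ⟨q, hq⟩, hG⟩ := hf
  -- The value of `e` is computed into a register that is local in the end.
  let j : Option (Option ι) → Option ι ⊕ Unit := fun o => match o with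
    | none => .inl none
    | some none => .inr ()
    | some (some i) => .inl (some i)
  have hj : Function.Injective j := by
    rintro (_ | _ | a) (_ | _ | b) h <;> simp_all [j]
  refine ⟨Subroutine.rename j (Subroutine.seq (F.rename fun o => (Sum.inl (o.elim (some none)
    fun i => some (some i)) : Option (Option ι) ⊕ Empty)) G),
    fun s => t s + q.eval (size s + b s), ht.add (.eval q (PolyBdd.size.add hb)), fun s => ?_⟩
  have h1 : (F.rename fun o => (Sum.inl (o.elim (some none)
      fun i => some (some i)) : Option (Option ι) ⊕ Empty)).RunsTo (extend (extend s []) []) (t s)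
      ((e s).map fun w => extend (extend s w) []) := by
    refine RunsTo.rename_inj ?_ (ν := (e s).map (extend s)) ?_ rfl ?_ ?_
    · rintro (_ | a) (_ | b) h <;> simp_all
    · convert hF s using 1
      funext o
      cases o <;> rfl
    · rintro w (_ | i) <;> rfl
    · rintro w (_ | _ | i) h
      · rfl
      · exact absurd rfl (h none)
      · rfl
  have h2 := h1.seq (G := G) (T' := q.eval (size s + b s))
    (κ := fun s' => (f fun o => s' (some o)).map fun w o => o.elim w fun o => s' (some o))
    fun s' hs' => by
      rw [PMF.mem_support_map_iff] at hs'
      obtain ⟨w, hw, rfl⟩ := hs'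
      refine (hG (extend s w)).mono ((hq _).trans (q.eval_mono_nat ?_))
      rw [size_extend]
      exact Nat.add_le_add_left (hlen s w hw) _
  have h3 := RunsTo.rename (s' := extend s []) hj (T := t s + q.eval (size s + b s)) (ν := _) (by
    convert h2 using 1
    funext o
    rcases o with _ | _ | i <;> rfl)
  convert h3 using 1
  rw [PMF.map_bind, PMF.bind_map, PMF.map_bind]
  refine congrArg _ (funext fun w => ?_)
  simp only [Function.comp_apply]
  rw [PMF.map_comp]
  refine congrArg₂ _ (funext fun w' => funext fun o => ?_) rfl
  rcases o with _ | i
  · rw [Function.comp_apply, renameRegs_eq (r := none) hj rfl]; rfl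
  · rw [Function.comp_apply, renameRegs_eq (r := some (some i)) hj rfl]; rfl

/-- Probabilistic polynomial-time Turing machines sample their output. -/
theorem output (M : PPT) : Samplable fun s : Unit → Word => M.output (s ()) := by
  obtain ⟨m, hm⟩ := exists_program_pushes_le M.toProbTM
  obtain ⟨c₁, h₁⟩ := move_runsTo (R := Option Unit ⊕ Fin 3) (.inl (some ())) [.inr 0, .inr 1]
    (by simp) (by simp)
  obtain ⟨c₂, h₂⟩ := move_runsTo (R := Option Unit ⊕ Fin 3) (.inr 0) [.inl (some ())]
    (by simp) (by simp)
  obtain ⟨c₃, h₃⟩ := move_runsTo (R := Option Unit ⊕ Fin 3) (.inr 2) [.inl none]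
    (by simp) (by simp)
  let u : ℕ → ℕ := fun n => M.time.eval n + (n + M.time.eval n * m + 1) + n + 1
  -- The output `y` of the machine satisfies `|y| ≤ |w| + u |w| * m`.
  obtain ⟨m', hm'⟩ := (call M.toProbTM).exists_pushes_le
  let st : Word → Word → Word → Word → Word → Option Unit ⊕ Fin 3 → Word := fun o w t a b =>
    Sum.elim (extend (fun _ => w) o) ![t, a, b]
  let T : ℕ → ℕ := fun n => ((n * c₁ + 1 + (n * c₂ + 1)) + u n) + ((u n * m') * c₃ + 1)
  have hT : PolyBdd fun s : Unit → Word => T (s ()).length := by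
    have hl := PolyBdd.length (ι := Unit) ()
    have hu : PolyBdd fun s : Unit → Word => u (s ()).length :=
      (((PolyBdd.eval M.time hl).add ((hl.add ((PolyBdd.eval M.time hl).mul (.const _))).add
        (.const _))).add hl).add (.const _)
    exact ((((hl.mul (.const _)).add (.const _)).add ((hl.mul (.const _)).add (.const _))).add
      hu).add (((hu.mul (.const _)).mul (.const _)).add (.const _))
  refine ⟨Subroutine.rename (id : Option Unit ⊕ Fin 3 → Option Unit ⊕ Fin 3) (Subroutine.seq
    (Subroutine.seq (Subroutine.seq (move (.inl (some ())) [.inr 0, .inr 1])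
    (move (.inr 0) [.inl (some ())])) ((call M.toProbTM).rename fun i => (Sum.inl (.inr (i.succ)) :
    (Option Unit ⊕ Fin 3) ⊕ Empty))) (move (.inr 2) [.inl none])), _, hT, fun s => ?_⟩
  generalize hw : s () = w
  obtain rfl : s = fun _ => w := by funext i; exact hw
  have hcall := call_runsTo M hm w
  have f1 : (move (.inl (some ())) [.inr 0, .inr 1]).RunsTo (st [] w [] [] []) (w.length * c₁ + 1)
      (PMF.pure (st [] [] w.reverse w.reverse [])) := by
    convert h₁ (st [] w [] [] []) using 2
    · simp [st, extend]
    funext r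
    rcases r with (_ | _) | r
    · simp [st, extend]
    · simp [st, extend]
    · fin_cases r <;> simp [st, extend]
  have f2 : (move (.inr 0) [.inl (some ())]).RunsTo (st [] [] w.reverse w.reverse [])
      (w.length * c₂ + 1)
      (PMF.pure (st [] w [] w.reverse [])) := by
    convert h₂ (st [] [] w.reverse w.reverse []) using 2
    · simp [st]
    funext r
    rcases r with (_ | _) | r
    · simp [st, extend]
    · simp [st, extend]
    · fin_cases r <;> simp [st]
  have f3 : ((call M.toProbTM).rename fun i => (Sum.inl (.inr (i.succ)) :
      (Option Unit ⊕ Fin 3) ⊕ Empty)).RunsTo (st [] w [] w.reverse []) (u w.length)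
      ((M.output w).map fun y => st [] w [] [] y.reverse) := by
    refine RunsTo.rename_inj (j := fun i : Fin 2 => (.inr i.succ : Option Unit ⊕ Fin 3))
      (fun a b h => by simpa using h) (ν := _) ?_ rfl
      (g := fun y i => if i = 0 then [] else y.reverse) ?_ ?_
    · convert hcall using 1
      funext i
      fin_cases i <;> rfl
    · intro y i
      fin_cases i <;> rfl
    · rintro y (o | i) h
      · rfl
      · fin_cases i
        · rfl
        · exact absurd rfl (h 0)
        · exact absurd rfl (h 1)
  have f4 : ∀ y ∈ (M.output w).support, (move (.inr 2) [.inl none]).RunsTo (st [] w [] [] y.reverse)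
      ((u w.length * m') * c₃ + 1) (PMF.pure (st y w [] [] [])) := by
    intro y hy
    have hlen := hcall.length_le hm' 1 _ ((PMF.mem_support_map_iff _ _ _).2 ⟨y, hy, rfl⟩)
    have := (h₃ (st [] w [] [] y.reverse)).mono (T' := (u w.length * m') * c₃ + 1)
      (Nat.add_le_add_right (Nat.mul_le_mul_right _ (by simpa [st] using hlen)) _)
    convert this using 2
    funext r
    rcases r with (_ | _) | r
    · simp [st, extend]
    · simp [st, extend]
    · fin_cases r <;> simp [st]
  have hinj : Function.Injective fun y : Word => st [] w [] [] y.reverse := fun y y' h => by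
    simpa [st] using congrFun h (.inr 2)
  have f := ((f1.seq_pure f2).seq_pure f3).seq_map hinj f4
  have hst : (Sum.elim (extend (fun _ => w) []) fun _ => [] : Option Unit ⊕ Fin 3 → Word) =
      st [] w [] [] [] := by
    funext r
    rcases r with r | r
    · rfl
    · fin_cases r <;> rfl
  rw [← hst] at f
  have := f.hide
  convert this using 1
  rw [PMF.map_bind]
  simp only [PMF.pure_map]
  rfl

end Samplable

/-! ### Folding a randomized step over a word -/

namespace Subroutine

variable {R : Type} [DecidableEq R]

theorem loop_runsTo_cons_map {r : R} {F : Subroutine R} {m : ℕ}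
    (hm : ∀ b l, (F.code b l).pushes ≤ m) {s : R → Word} (hs : s r ≠ []) {T T' : ℕ}
    {α : Type} {μ : PMF α} {g : α → R → Word} (hg : Function.Injective g)
    {κ : α → PMF (R → Word)} (hF : F.RunsTo s T (μ.map g))
    (h : ∀ a ∈ μ.support, (loop r F).RunsTo (g a) T' (κ a)) :
    (loop r F).RunsTo s (T + T' + T * m + 2) (μ.bind κ) := by
  have : Nonempty α := ⟨μ.support_nonempty.some⟩
  have := loop_runsTo_cons hm hs (T' := T') (κ := fun t => κ (Function.invFun g t)) hF fun t ht => by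
    obtain ⟨a, ha, rfl⟩ := (PMF.mem_support_map_iff _ _ _).1 ht
    rw [Function.leftInverse_invFun hg]
    exact h a ha
  rw [PMF.bind_map] at this
  convert this using 2
  funext a
  rw [Function.comp_apply, Function.leftInverse_invFun hg]

end Subroutine

open Subroutine

namespace Samplable

variable {ι : Type} [Fintype ι] [DecidableEq ι]

/-- The randomized fold with step `e`. The step sees the accumulator at the index `none`, the
current symbol, as a word of length one, at the index `some none`, and the context `s`. -/
noncomputable def fold (e : (Option (Option ι) → Word) → PMF Word) (s : ι → Word) (l : Word)
    (a : Word) : PMF Word :=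
  l.foldlM (fun acc x => e (extend (extend s [x]) acc)) a

omit [Fintype ι] [DecidableEq ι] in
theorem fold_cons (e : (Option (Option ι) → Word) → PMF Word) (s : ι → Word) (x : IOSymbol)
    (l a : Word) : fold e s (x :: l) a =
      (e (extend (extend s [x]) a)).bind fun a' => fold e s l a' := by
  rw [fold, List.foldlM_cons]
  rfl

/-- The registers of a fold: arguments, accumulator, list, symbol, new value, scratch. -/
def foldRegs (s : ι → Word) (a l x v w : Word) : Option ι ⊕ Fin 4 → Word :=
  Sum.elim (extend s a) ![l, x, v, w]

/-- The body of the loop that computes a fold. -/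
noncomputable abbrev foldBody (F : Subroutine (Option (Option (Option ι)))) :
    Subroutine (Option ι ⊕ Fin 4) :=
  Subroutine.seq (Subroutine.seq (Subroutine.seq (Subroutine.seq (Subroutine.seq
    (mv (.inr 0) [.inr 1])
    (F.rename fun o => (Sum.inl (o.elim (.inr 2) fun o => o.elim (.inl none) fun o =>
      o.elim (.inr 1) fun i => .inl (some i)) : (Option ι ⊕ Fin 4) ⊕ Empty)))
    (mv (.inr 1) [])) (move (.inl none) [])) (move (.inr 2) [.inr 3])) (move (.inr 3) [.inl none])

omit [Fintype ι] in
theorem foldBody_runsTo (F : Subroutine (Option (Option (Option ι)))) : ∃ c, ∀ (s : ι → Word)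
    (x : IOSymbol) (l a : Word) (T N : ℕ) (ν : PMF Word),
    F.RunsTo (extend (extend (extend s [x]) a) []) T (ν.map (extend (extend (extend s [x]) a))) →
    a.length ≤ N → (∀ v ∈ ν.support, v.length ≤ N) →
    (foldBody F).RunsTo (foldRegs s a (x :: l) [] [] []) (T + N * c + 5)
      (ν.map fun v => foldRegs s v l [] [] []) := by
  obtain ⟨c₁, h₁⟩ := move_runsTo (R := Option ι ⊕ Fin 4) (.inl none) [] (by simp) (by simp)
  obtain ⟨c₂, h₂⟩ := move_runsTo (R := Option ι ⊕ Fin 4) (.inr 2) [.inr 3] (by simp) (by simp)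
  obtain ⟨c₃, h₃⟩ := move_runsTo (R := Option ι ⊕ Fin 4) (.inr 3) [.inl none] (by simp) (by simp)
  refine ⟨c₁ + c₂ + c₃, fun s x l a T N ν hF ha hN => ?_⟩
  have f1 : (mv (.inr 0) [.inr 1]).RunsTo (foldRegs s a (x :: l) [] [] []) 1
      (PMF.pure (foldRegs s a l [x] [] [])) := by
    convert mv_runsTo (.inr 0) [.inr 1] (by simp) (by simp) (foldRegs s a (x :: l) [] [] []) x l
      rfl using 2
    funext r
    rcases r with r | r
    · simp [foldRegs]
    · fin_cases r <;> simp [foldRegs]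
  have f2 := RunsTo.rename_inj (R' := Option ι ⊕ Fin 4) (j := fun o : Option (Option (Option ι)) =>
      o.elim (Sum.inr 2) fun o => o.elim (.inl none) fun o => o.elim (.inr 1) fun i => .inl (some i))
    (by rintro (_ | _ | _ | i) (_ | _ | _ | j) h <;> simp_all) (F := F)
    (s' := foldRegs s a l [x] [] []) (T := T)
    (by convert hF using 1; funext o; rcases o with _ | _ | _ | i <;> rfl) rfl
    (g' := fun v => foldRegs s a l [x] v [])
    (by rintro v (_ | _ | _ | i) <;> rfl) (by
      rintro v ((_ | i) | r) h
      · exact absurd rfl (h (some none))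
      · rfl
      · fin_cases r
        · rfl
        · rfl
        · exact absurd rfl (h none)
        · rfl)
  have f3 : ∀ v, (mv (.inr 1) []).RunsTo (foldRegs s a l [x] v []) 1
      (PMF.pure (foldRegs s a l [] v [])) := fun v => by
    convert mv_runsTo (.inr 1) [] (by simp) (by simp) (foldRegs s a l [x] v []) x []
      rfl using 2
    funext r
    rcases r with r | r
    · simp [foldRegs]
    · fin_cases r <;> simp [foldRegs]
  have f4 : ∀ v, (move (.inl none) []).RunsTo (foldRegs s a l [] v []) (N * c₁ + 1)
      (PMF.pure (foldRegs s [] l [] v [])) := fun v => by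
    convert (h₁ (foldRegs s a l [] v [])).mono (Nat.add_le_add_right (Nat.mul_le_mul_right _ ha) _)
      using 2
    funext r
    rcases r with (_ | r) | r
    · simp [foldRegs, extend]
    · simp [foldRegs, extend]
    · simp [foldRegs]
  have f5 : ∀ v : Word, v.length ≤ N →
      (move (.inr 2) [.inr 3]).RunsTo (foldRegs s [] l [] v []) (N * c₂ + 1)
      (PMF.pure (foldRegs s [] l [] [] v.reverse)) := fun v hv => by
    convert (h₂ (foldRegs s [] l [] v [])).mono
      (Nat.add_le_add_right (Nat.mul_le_mul_right _ hv) _) using 2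
    funext r
    rcases r with r | r
    · simp [foldRegs]
    · fin_cases r <;> simp [foldRegs]
  have f6 : ∀ v : Word, v.length ≤ N →
      (move (.inr 3) [.inl none]).RunsTo (foldRegs s [] l [] [] v.reverse) (N * c₃ + 1)
      (PMF.pure (foldRegs s v l [] [] [])) := fun v hv => by
    convert (h₃ (foldRegs s [] l [] [] v.reverse)).mono (T' := N * c₃ + 1)
      (Nat.add_le_add_right (Nat.mul_le_mul_right _ (by simpa [foldRegs] using hv)) _) using 2
    funext r
    rcases r with (_ | r) | r
    · simp [foldRegs, extend]
    · simp [foldRegs, extend]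
    · fin_cases r <;> simp [foldRegs]
  have i2 : Function.Injective fun v => foldRegs s a l [x] v [] :=
    fun v v' h => congrFun h (.inr 2)
  have i3 : Function.Injective fun v => foldRegs s a l [] v [] :=
    fun v v' h => congrFun h (.inr 2)
  have i4 : Function.Injective fun v => foldRegs s [] l [] v [] :=
    fun v v' h => congrFun h (.inr 2)
  have i5 : Function.Injective fun v : Word => foldRegs s [] l [] [] v.reverse :=
    fun v v' h => List.reverse_injective (congrFun h (.inr 3))
  have g3 := (f1.seq_pure f2).seq_map i2 fun v _ => f3 v
  have g4 := RunsTo.seq_map i3 g3 fun v _ => f4 v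
  have g5 := RunsTo.seq_map i4 g4 fun v hv => f5 v (hN v hv)
  have g6 := RunsTo.seq_map i5 g5 fun v hv => f6 v (hN v hv)
  exact g6.mono (by simp only [Nat.mul_add]; omega)

/-- Folding a samplable step over a word is samplable if the accumulator has polynomial length. -/
theorem foldlM {l : (ι → Word) → Word} (hl : Samplable fun s => PMF.pure (l s))
    {e₀ : (ι → Word) → PMF Word} (h₀ : Samplable e₀)
    {e : (Option (Option ι) → Word) → PMF Word} (he : Samplable e) {B : (ι → Word) → ℕ}
    (hB : PolyBdd B) (hb : ∀ s l', l' <+: l s →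
      ∀ w ∈ ((e₀ s).bind (fold e s l')).support, w.length ≤ B s) :
    Samplable fun s => (e₀ s).bind (fold e s (l s)) := by
  obtain ⟨tl, htl, hlen⟩ := hl.exists_length_le
  obtain ⟨G, u, hu, hG⟩ := hl
  obtain ⟨K, v, hv, hK⟩ := h₀
  obtain ⟨F, t, ⟨p, hp⟩, hF⟩ := he
  obtain ⟨c, hc⟩ := foldBody_runsTo F
  obtain ⟨m, hm⟩ := (foldBody F).exists_pushes_le
  -- A bound for the running time of the body.
  let D : (ι → Word) → ℕ := fun s => p.eval (size s + 1 + B s) + B s * c + 5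
  have hD : PolyBdd D := ((PolyBdd.eval p ((PolyBdd.size.add (.const 1)).add hB)).add
    (hB.mul (.const c))).add (.const 5)
  have key : ∀ (s : ι → Word) (w a : Word),
      (∀ l', l' <+: w → ∀ y ∈ (fold e s l' a).support, y.length ≤ B s) →
      (loop (.inr 0) (foldBody F)).RunsTo (foldRegs s a w [] [] [])
        (w.length * (D s + D s * m + 2) + 1)
        ((fold e s w a).map fun y => foldRegs s y [] [] [] []) := by
    intro s w
    induction w with
    | nil =>
      intro a _
      have := loop_runsTo_nil (.inr 0) (foldBody F) (s := foldRegs s a [] [] [] []) rfl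
      convert this.mono (Nat.le_add_left 1 _) using 1
      exact PMF.pure_map _ _
    | cons x w ih =>
      intro a hsup
      have ha : a.length ≤ B s := hsup [] (by simp) a ((PMF.mem_support_pure_iff _ _).2 rfl)
      have h1 := (hF (extend (extend s [x]) a)).mono (T' := p.eval (size s + 1 + B s))
        ((hp _).trans (p.eval_mono_nat (by
          rw [size_extend, size_extend, List.length_singleton]; omega)))
      have h2 := hc s x w a _ (B s) _ h1 ha fun y hy => hsup [x] (by simp) y (by
        rw [fold_cons]
        exact (PMF.mem_support_bind_iff _ _ _).2 ⟨y, hy, (PMF.mem_support_pure_iff _ _).2 rfl⟩)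
      have h3 := loop_runsTo_cons_map hm (r := Sum.inr 0) (by simp [foldRegs])
        (T' := w.length * (D s + D s * m + 2) + 1)
        (fun y y' h => congrFun h (.inl none)) h2 fun y hy => ih y fun l' hl' z hz =>
          hsup (x :: l') (by simpa using hl') z (by
            rw [fold_cons]
            exact (PMF.mem_support_bind_iff _ _ _).2 ⟨y, hy, hz⟩)
      rw [fold_cons, PMF.map_bind]
      refine h3.mono ?_
      simp only [List.length_cons, D]
      ring_nf
      omega
  refine ⟨Subroutine.rename (id : Option ι ⊕ Fin 4 → Option ι ⊕ Fin 4) (Subroutine.seq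
    (Subroutine.seq (G.rename fun o => (Sum.inl (o.elim (.inr 0) fun i => .inl (some i)) :
      (Option ι ⊕ Fin 4) ⊕ Empty)) (K.rename fun o => (Sum.inl (.inl o) :
      (Option ι ⊕ Fin 4) ⊕ Empty))) (loop (.inr 0) (foldBody F))),
    fun s => u s + v s + (tl s * (D s + D s * m + 2) + 1),
    (hu.add hv).add ((htl.mul ((hD.add (hD.mul (.const m))).add (.const 2))).add (.const 1)),
    fun s => ?_⟩
  have f1 : (G.rename fun o => (Sum.inl (o.elim (.inr 0) fun i => .inl (some i)) :
      (Option ι ⊕ Fin 4) ⊕ Empty)).RunsTo (foldRegs s [] [] [] [] []) (u s)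
      (PMF.pure (foldRegs s [] (l s) [] [] [])) := by
    have := RunsTo.rename_inj (R' := Option ι ⊕ Fin 4) (j := fun o : Option ι =>
      o.elim (Sum.inr 0) fun i => .inl (some i)) (by rintro (_ | i) (_ | j) h <;> simp_all) (F := G)
      (s' := foldRegs s [] [] [] [] []) (T := u s)
      (ν := (PMF.pure (l s)).map (extend s))
      (by convert hG s using 1; funext o; rcases o with _ | i <;> rfl) rfl
      (g' := fun v => foldRegs s [] v [] [] [])
      (by rintro v (_ | i) <;> rfl) (by
        rintro v ((_ | i) | r) h
        · rfl
        · rfl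
        · fin_cases r
          · exact absurd rfl (h none)
          all_goals rfl)
    rwa [PMF.pure_map] at this
  have f2 := RunsTo.rename_inj (R' := Option ι ⊕ Fin 4) (j := fun o : Option ι => Sum.inl o)
      Sum.inl_injective (F := K) (s' := foldRegs s [] (l s) [] [] []) (T := v s)
      (by convert hK s using 1; rfl) rfl (g' := fun a => foldRegs s a (l s) [] [] [])
      (by rintro v (_ | i) <;> rfl) (by
        rintro v ((_ | i) | r) h
        · exact absurd rfl (h none)
        · rfl
        · rfl)
  have f := ((f1.seq_pure f2).seq_map (fun y y' h => congrFun h (.inl none)) fun a ha =>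
    (key s (l s) a fun l' hl' y hy => hb s l' hl' y
      ((PMF.mem_support_bind_iff _ _ _).2 ⟨a, ha, hy⟩)).mono
      (T' := tl s * (D s + D s * m + 2) + 1) (Nat.add_le_add_right
        (Nat.mul_le_mul_right _ (hlen s _ ((PMF.mem_support_pure_iff _ _).2 rfl))) 1))
  have hst : (Sum.elim (extend s []) fun _ => [] : Option ι ⊕ Fin 4 → Word) =
      foldRegs s [] [] [] [] [] := by
    funext r
    rcases r with r | r
    · rfl
    · fin_cases r <;> rfl
  rw [← hst] at f
  have := f.hide
  convert this using 1
  rw [← PMF.map_bind, PMF.map_comp]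
  rfl

end Samplable

/-! ### Word functions computable in polynomial time -/

section PolyTime

variable {ι : Type} [Fintype ι] [DecidableEq ι]

/-- Deterministic functions of a tuple of words that are computable in polynomial time. -/
def PolyTime (a : (ι → Word) → Word) : Prop := Samplable fun s => PMF.pure (a s)

variable {a b c l : (ι → Word) → Word} {e e₁ e₂ : (ι → Word) → PMF Word}

theorem Samplable.weaken (he : Samplable e) :
    Samplable fun s : Option ι → Word => e fun i => s (some i) :=
  he.comp_injective (Option.some_injective ι)

theorem PolyTime.weaken (ha : PolyTime a) :
    PolyTime fun s : Option ι → Word => a fun i => s (some i) :=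
  Samplable.weaken ha

/-- Substituting the value of a polynomial-time function for an additional argument. -/
theorem Samplable.subst {f : (Option ι → Word) → PMF Word} (hf : Samplable f) (ha : PolyTime a) :
    Samplable fun s => f (extend s (a s)) := by
  have := Samplable.bind ha hf
  simpa only [PMF.pure_bind] using this

theorem Samplable.ite_head? (ha : PolyTime a) (o : Option IOSymbol) (h₁ : Samplable e₁)
    (h₂ : Samplable e₂) : Samplable fun s => if (a s).head? = o then e₁ s else e₂ s :=
  (Samplable.ite_var none o h₁.weaken h₂.weaken).subst ha

theorem Samplable.ite_headI (ha : PolyTime a) (x : IOSymbol) (h₁ : Samplable e₁)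
    (h₂ : Samplable e₂) : Samplable fun s => if (a s).headI = x then e₁ s else e₂ s := by
  by_cases hx : x = none
  · subst hx
    convert Samplable.ite_head? ha (some none) h₁ (Samplable.ite_head? ha none h₁ h₂) using 2 with s
    rcases a s with _ | ⟨y, w⟩
    · simp [default]
    · by_cases hy : y = none <;> simp [hy]
  · convert Samplable.ite_head? ha (some x) h₁ h₂ using 2 with s
    rcases a s with _ | ⟨y, w⟩
    · simp [default, Ne.symm hx]
    · by_cases hy : y = x <;> simp [hy]

/-- Case distinction on a bit. Only the functions `e true`, `e false` have to be samplable, so that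
`e` need not be uniform in the bit. -/
theorem Samplable.bool (ha : PolyTime a) {e : Bool → (ι → Word) → PMF Word}
    (he : ∀ b, Samplable (e b)) : Samplable fun s => e (decide ((a s).headI = some true)) s := by
  convert Samplable.ite_headI ha (some true) (he true) (he false) using 2 with s
  split_ifs with h <;> simp [h]

theorem Samplable.output_of_polyTime (M : PPT) (ha : PolyTime a) :
    Samplable fun s => M.output (a s) := by
  have : Samplable fun s : Option ι → Word => M.output (s none) :=
    (Samplable.output M).comp_injective (ρ := fun _ => none) fun _ _ _ => rfl
  exact this.subst ha

/-- Folding a randomized step whose values have polynomial length. -/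
theorem Samplable.foldlM_of_length_le (hl : PolyTime l) (h₀ : Samplable e)
    {g : (ι → Word) → Word → IOSymbol → PMF Word}
    (hg : Samplable fun s : Option (Option ι) → Word =>
      g (fun i => s (some (some i))) (s none) (s (some none)).headI)
    {B : (ι → Word) → ℕ} (hB : PolyBdd B)
    (hb : ∀ s l', l' <+: l s → ∀ w ∈ ((e s).bind (l'.foldlM (g s))).support, w.length ≤ B s) :
    Samplable fun s => (e s).bind ((l s).foldlM (g s)) :=
  Samplable.foldlM hl h₀ hg hB hb

namespace PolyTime

theorem exists_length_le (ha : PolyTime a) : ∃ t, PolyBdd t ∧ ∀ s, (a s).length ≤ t s := by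
  obtain ⟨t, ht, h⟩ := Samplable.exists_length_le ha
  exact ⟨t, ht, fun s => h s _ ((PMF.mem_support_pure_iff _ _).2 rfl)⟩

theorem var (i : ι) : PolyTime fun s => s i := Samplable.var i

theorem nil : PolyTime fun _ : ι → Word => [] := Samplable.nil

theorem cons (x : IOSymbol) (ha : PolyTime a) : PolyTime fun s => x :: a s := by
  have := Samplable.cons x ha
  unfold PolyTime
  simpa only [PMF.pure_map] using this

theorem const (w : Word) : PolyTime fun _ : ι → Word => w := by
  induction w with
  | nil => exact nil
  | cons x w ih => exact ih.cons x

theorem tail (ha : PolyTime a) : PolyTime fun s => (a s).tail := by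
  have := Samplable.tail ha
  unfold PolyTime
  simpa only [PMF.pure_map] using this

theorem ite_head? (ha : PolyTime a) (o : Option IOSymbol) (hb : PolyTime b) (hc : PolyTime c) :
    PolyTime fun s => if (a s).head? = o then b s else c s := by
  have := Samplable.ite_head? ha o hb hc
  unfold PolyTime
  simpa only [apply_ite PMF.pure] using this

theorem ite_headI (ha : PolyTime a) (x : IOSymbol) (hb : PolyTime b) (hc : PolyTime c) :
    PolyTime fun s => if (a s).headI = x then b s else c s := by
  have := Samplable.ite_headI ha x hb hc
  unfold PolyTime
  simpa only [apply_ite PMF.pure] using this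

theorem bool (ha : PolyTime a) {b : Bool → (ι → Word) → Word} (hb : ∀ x, PolyTime (b x)) :
    PolyTime fun s => b (decide ((a s).headI = some true)) s :=
  Samplable.bool (e := fun x s => PMF.pure (b x s)) ha hb

theorem cons_headI (ha : PolyTime a) (hb : PolyTime b) : PolyTime fun s => (a s).headI :: b s := by
  convert ite_headI ha (some true) (hb.cons (some true)) (ite_headI ha (some false)
    (hb.cons (some false)) (hb.cons none)) using 2 with s
  rcases (a s).headI with _ | _ | _ <;> simp

theorem foldl_of_length_le (hl : PolyTime l) (ha : PolyTime a)
    {g : (ι → Word) → Word → IOSymbol → Word}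
    (hg : PolyTime fun s : Option (Option ι) → Word =>
      g (fun i => s (some (some i))) (s none) (s (some none)).headI)
    {B : (ι → Word) → ℕ} (hB : PolyBdd B)
    (hb : ∀ s l', l' <+: l s → (l'.foldl (g s) (a s)).length ≤ B s) :
    PolyTime fun s => (l s).foldl (g s) (a s) := by
  have key : ∀ (s : ι → Word) (l w : Word),
      l.foldlM (fun acc x => PMF.pure (g s acc x)) w = PMF.pure (l.foldl (g s) w) := by
    intro s l
    induction l with
    | nil => intro w; rfl
    | cons x l ih =>
      intro w
      rw [List.foldlM_cons, List.foldl_cons, ← ih]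
      exact PMF.pure_bind _ _
  have := Samplable.foldlM_of_length_le hl ha (g := fun s acc x => PMF.pure (g s acc x)) hg hB
    fun s l' hl' w hw => by
      rw [PMF.pure_bind, key, PMF.mem_support_pure_iff] at hw
      exact hw ▸ hb s l' hl'
  unfold PolyTime
  simpa only [PMF.pure_bind, key] using this

/-- Folding a step that lengthens the accumulator by a polynomial amount, independent of the
accumulator. -/
theorem foldl (hl : PolyTime l) (ha : PolyTime a) {g : (ι → Word) → Word → IOSymbol → Word}
    (hg : PolyTime fun s : Option (Option ι) → Word =>
      g (fun i => s (some (some i))) (s none) (s (some none)).headI)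
    {B : (ι → Word) → ℕ} (hB : PolyBdd B)
    (hb : ∀ s w x, (g s w x).length ≤ w.length + B s) :
    PolyTime fun s => (l s).foldl (g s) (a s) := by
  obtain ⟨tl, htl, hl'⟩ := hl.exists_length_le
  obtain ⟨ta, hta, ha'⟩ := ha.exists_length_le
  refine foldl_of_length_le hl ha hg (B := fun s => ta s + tl s * B s) (hta.add (htl.mul hB))
    fun s l' h => ?_
  have key : ∀ (l w : Word), (l.foldl (g s) w).length ≤ w.length + l.length * B s := by
    intro l
    induction l with
    | nil => intro w; simp
    | cons x l ih =>
      intro w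
      refine (ih _).trans ?_
      have := hb s w x
      simp only [List.length_cons, Nat.add_mul]
      omega
  exact (key _ _).trans (Nat.add_le_add (ha' s) (Nat.mul_le_mul_right _ (h.length_le.trans (hl' s))))

theorem reverse (ha : PolyTime a) : PolyTime fun s => (a s).reverse := by
  have := foldl ha nil (g := fun _ w x => x :: w) (cons_headI (var (some none)) (var none))
    (.const 1) fun s w x => by simp
  convert this using 2 with s
  simp [← List.foldr_reverse]

theorem foldr_of_length_le (hl : PolyTime l) (ha : PolyTime a)
    {g : (ι → Word) → IOSymbol → Word → Word}
    (hg : PolyTime fun s : Option (Option ι) → Word =>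
      g (fun i => s (some (some i))) (s (some none)).headI (s none))
    {B : (ι → Word) → ℕ} (hB : PolyBdd B)
    (hb : ∀ s l', l' <:+ l s → (l'.foldr (g s) (a s)).length ≤ B s) :
    PolyTime fun s => (l s).foldr (g s) (a s) := by
  have := foldl_of_length_le hl.reverse ha (g := fun s w x => g s x w) hg hB fun s l' h => by
    have := hb s l'.reverse (by simpa using List.reverse_suffix.2 h)
    simpa using this
  simpa using this

theorem foldr (hl : PolyTime l) (ha : PolyTime a) {g : (ι → Word) → IOSymbol → Word → Word}
    (hg : PolyTime fun s : Option (Option ι) → Word =>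
      g (fun i => s (some (some i))) (s (some none)).headI (s none))
    {B : (ι → Word) → ℕ} (hB : PolyBdd B)
    (hb : ∀ s w x, (g s x w).length ≤ w.length + B s) :
    PolyTime fun s => (l s).foldr (g s) (a s) := by
  have := foldl hl.reverse ha (g := fun s w x => g s x w) hg hB hb
  simpa using this

theorem append (ha : PolyTime a) (hb : PolyTime b) : PolyTime fun s => a s ++ b s := by
  have := foldr ha hb (g := fun _ x w => x :: w) (cons_headI (var (some none)) (var none))
    (.const 1) fun s w x => by simp
  simpa using this

theorem drop_length (ha : PolyTime a) (hb : PolyTime b) :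
    PolyTime fun s => (b s).drop (a s).length := by
  have := foldl ha hb (g := fun _ w _ => w.tail) (var none).tail (.const 0) fun s w x => by simp
  convert this using 2 with s
  have key : ∀ l w : Word, l.foldl (fun w _ => w.tail) w = w.drop l.length := by
    intro l
    induction l with
    | nil => intro w; rfl
    | cons x l ih => intro w; simp [ih]
  rw [key]

theorem headField (ha : PolyTime a) : PolyTime fun s => headField (a s) := by
  have := foldr ha nil (g := fun _ x w => if x = none then [] else x :: w)
    (ite_headI (var (some none)) none nil (cons_headI (var (some none)) (var none)))
    (.const 1) fun s w x => by split_ifs <;> simp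
  convert this using 2 with s
  induction a s with
  | nil => rfl
  | cons x w ih => cases x <;> simp_all [_root_.headField]

theorem tailFields (ha : PolyTime a) : PolyTime fun s => tailFields (a s) := by
  convert (drop_length ha.headField ha).tail using 2 with s
  rw [_root_.tailFields]
  congr 1
  induction a s with
  | nil => rfl
  | cons x w ih => cases x <;> simp_all [_root_.headField]

theorem encFields_cons {ws : (ι → Word) → List Word} (ha : PolyTime a)
    (hws : PolyTime fun s => encFields (ws s)) : PolyTime fun s => encFields (a s :: ws s) := by
  convert ha.append (hws.cons none) using 2 with s
  simp [encFields]

theorem encFields_nil : PolyTime fun _ : ι → Word => encFields [] := nil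

end PolyTime

theorem Samplable.ite_eq_true (ha : PolyTime a) (h₁ : Samplable e₁) (h₂ : Samplable e₂) :
    Samplable fun s => if a s = [some true] then e₁ s else e₂ s := by
  convert Samplable.ite_head? ha (some (some true)) (Samplable.ite_head? ha.tail none h₁ h₂) h₂
    using 2 with s
  rcases a s with _ | ⟨x, _ | ⟨y, w⟩⟩ <;> simp

/-! ### Unary numbers -/

/-- Number-valued functions whose value is computable in unary in polynomial time. -/
def PolyUnary (f : (ι → Word) → ℕ) : Prop := PolyTime fun s => unary (f s)

namespace PolyUnary

variable {f g : (ι → Word) → ℕ}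

theorem length (ha : PolyTime a) : PolyUnary fun s => (a s).length := by
  have := PolyTime.foldl ha .nil (g := fun _ w _ => some true :: w)
    ((PolyTime.var none).cons (some true)) (.const 1) fun s w x => by simp
  unfold PolyUnary
  convert this using 2 with s
  have key : ∀ (l : Word) (k : ℕ), l.foldl (fun w _ => some true :: w) (unary k) =
      unary (l.length + k) := by
    intro l
    induction l with
    | nil => intro k; simp
    | cons x l ih =>
      intro k
      rw [List.foldl_cons, show some true :: unary k = unary (k + 1) from rfl, ih, List.length_cons]
      congr 1
      omega
  exact (key _ 0).symm

theorem const (k : ℕ) : PolyUnary fun _ : ι → Word => k := PolyTime.const _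

theorem add (hf : PolyUnary f) (hg : PolyUnary g) : PolyUnary fun s => f s + g s := by
  unfold PolyUnary
  simpa only [unary, List.replicate_add] using PolyTime.append hf hg

theorem sub (hf : PolyUnary f) (hg : PolyUnary g) : PolyUnary fun s => f s - g s := by
  have := PolyTime.drop_length hg hf
  unfold PolyUnary
  simpa only [unary, List.drop_replicate, List.length_replicate] using this

theorem mul (hf : PolyUnary f) (hg : PolyUnary g) : PolyUnary fun s => f s * g s := by
  obtain ⟨t, ht, hb⟩ := PolyTime.exists_length_le hg
  have := PolyTime.foldl hf .nil (g := fun s w _ => unary (g s) ++ w)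
    (PolyTime.append (PolyTime.weaken (PolyTime.weaken hg)) (PolyTime.var none)) ht fun s w x => by
      have := hb s
      simp only [List.length_append]
      omega
  unfold PolyUnary
  convert this using 2 with s
  have key : ∀ (m k : ℕ), (unary m).foldl (fun w _ => unary (g s) ++ w) (unary k) =
      unary (m * g s + k) := by
    intro m
    induction m with
    | zero => intro k; simp [unary]
    | succ m ih =>
      intro k
      rw [show unary (m + 1) = some true :: unary m from rfl, List.foldl_cons,
        show unary (g s) ++ unary k = unary (g s + k) from List.replicate_append_replicate, ih]
      congr 1
      ring
  exact (key _ 0).symm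

theorem pow (hf : PolyUnary f) (d : ℕ) : PolyUnary fun s => f s ^ d := by
  induction d with
  | zero => simpa using const 1
  | succ d ih => simpa only [pow_succ] using ih.mul hf

end PolyUnary

theorem Samplable.ite_unary_le {f g : (ι → Word) → ℕ} (hf : PolyUnary f) (hg : PolyUnary g)
    (h₁ : Samplable e₁) (h₂ : Samplable e₂) :
    Samplable fun s => if f s ≤ g s then e₁ s else e₂ s := by
  convert Samplable.ite_head? (hf.sub hg) none h₁ h₂ using 2 with s
  simp [unary, Nat.sub_eq_zero_iff_le]

end PolyTime

/-! ### Binary numbers -/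

theorem decNat_nil : decNat [] = 0 := rfl

theorem decNat_cons (x : IOSymbol) (w : Word) :
    decNat (x :: w) = (if x = some true then 1 else 0) + 2 * decNat w := rfl

theorem decNat_append (v w : Word) : decNat (v ++ w) = decNat v + 2 ^ v.length * decNat w := by
  induction v with
  | nil => simp [decNat_nil]
  | cons x v ih =>
    rw [List.cons_append, decNat_cons, ih, decNat_cons, List.length_cons, pow_succ]
    ring

theorem decNat_lt (w : Word) : decNat w < 2 ^ w.length := by
  induction w with
  | nil => simp [decNat_nil]
  | cons x w ih =>
    rw [decNat_cons, List.length_cons, pow_succ]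
    split_ifs <;> omega

theorem encNat_zero : encNat 0 = [] := by simp [encNat]

theorem encNat_bit (b : Bool) {m : ℕ} (h : m = 0 → b = true) :
    encNat (b.toNat + 2 * m) = some b :: encNat m := by
  have := Nat.bits_append_bit m b h
  rw [encNat, show b.toNat + 2 * m = Nat.bit b m by cases b <;> simp [Nat.bit, add_comm], this]
  rfl

theorem decNat_encNat (m : ℕ) : decNat (encNat m) = m := by
  induction m using Nat.binaryRec' with
  | zero => simp [encNat_zero, decNat_nil]
  | bit b m h ih =>
    rw [show Nat.bit b m = b.toNat + 2 * m by cases b <;> simp [Nat.bit, add_comm],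
      encNat_bit b h, decNat_cons, ih]
    cases b <;> simp

theorem length_encNat (m : ℕ) : (encNat m).length = m.size := by
  rw [encNat, List.length_map, Nat.size_eq_bits_len]

theorem encNat_eq_nil {m : ℕ} : encNat m = [] ↔ m = 0 := by
  rw [← List.length_eq_zero_iff, length_encNat, Nat.size_eq_zero]

theorem isSome_of_mem_encNat {m : ℕ} {x : IOSymbol} (h : x ∈ encNat m) : x.isSome := by
  rw [encNat, List.mem_map] at h
  obtain ⟨b, -, rfl⟩ := h
  rfl

theorem headI_drop_encNat (m k : ℕ) : ((encNat m).drop k).headI = some true ↔ m.testBit k = true := by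
  rw [Nat.testBit_eq_inth, encNat, ← List.map_drop, List.getI_eq_getElem?_getD, ← List.head?_drop]
  rcases m.bits.drop k with _ | ⟨b, w⟩
  · simp only [List.map_nil, List.headI_nil, List.head?_nil, Option.getD_none]
    exact iff_of_false (by simp [default]) (by simp [show (default : Bool) = false from rfl])
  · simp

section PolyNat

variable {ι : Type} [Fintype ι] [DecidableEq ι]

/-- Number-valued functions whose binary expansion is computable in polynomial time. -/
def PolyNat (f : (ι → Word) → ℕ) : Prop := PolyTime fun s => encNat (f s)

variable {a l : (ι → Word) → Word} {e₁ e₂ : (ι → Word) → PMF Word}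

theorem PolyTime.decNat (ha : PolyTime a) : PolyNat fun s => decNat (a s) := by
  have := PolyTime.foldr ha .nil
    (g := fun _ x w => if x = some true then some true :: w else
      if w.head? = none then [] else some false :: w)
    (ite_headI (var (some none)) (some true) ((var none).cons _) (ite_head? (var none) none nil
      ((var none).cons _))) (.const 1) fun s w x => by split_ifs <;> simp
  unfold PolyNat
  convert this using 2 with s
  simp only
  induction a s with
  | nil => exact encNat_zero
  | cons x w ih =>
    rw [List.foldr_cons, ← ih, decNat_cons]
    split_ifs with h₁ h₂
    · exact encNat_bit true fun _ => rfl
    · rw [List.head?_eq_none_iff, encNat_eq_nil] at h₂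
      simp [h₂, encNat_zero]
    · exact encNat_bit false fun h => absurd (by simp [h, encNat_zero]) h₂

/-- One step of a digit by digit operation with a carry. The accumulator is the carry, followed by
the digits of the result so far, the most significant digit first. -/
def rippleStep (F : Bool → Bool → Bool → Bool × Bool) (a b acc : Word) : Word :=
  let r := F (decide ((a.drop acc.tail.length).headI = some true))
    (decide ((b.drop acc.tail.length).headI = some true)) (decide (acc.headI = some true))
  some r.2 :: some r.1 :: acc.tail

/-- The carry and the digits of the result of a digit by digit operation, on `|l|` digits. -/
def ripple (F : Bool → Bool → Bool → Bool × Bool) (l a b : Word) : Word :=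
  l.foldl (fun acc _ => rippleStep F a b acc) [some false]

theorem PolyTime.ripple (F : Bool → Bool → Bool → Bool × Bool) {b : (ι → Word) → Word}
    (hl : PolyTime l) (ha : PolyTime a) (hb : PolyTime b) :
    PolyTime fun s => ripple F (l s) (a s) (b s) := by
  refine foldl hl (const [some false]) (g := fun s acc _ => rippleStep F (a s) (b s) acc) ?_
    (.const 2) fun s w x => by simp [rippleStep]
  have hacc : PolyTime fun s : Option (Option ι) → Word => s none := var none
  refine bool (drop_length hacc.tail ha.weaken.weaken) (b := fun x s =>
    let r := F x (decide (((b fun i => s (some (some i))).drop (s none).tail.length).headI =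
      some true)) (decide ((s none).headI = some true))
    some r.2 :: some r.1 :: (s none).tail) fun x => ?_
  refine bool (drop_length hacc.tail hb.weaken.weaken) (b := fun y s =>
    let r := F x y (decide ((s none).headI = some true))
    some r.2 :: some r.1 :: (s none).tail) fun y => ?_
  exact bool hacc (b := fun z s => some (F x y z).2 :: some (F x y z).1 :: (s none).tail)
    fun z => (hacc.tail.cons _).cons _

/-- The invariant of a digit by digit operation on numbers: if each step preserves the relation `R`
between number of digits, result and carry, then the relation holds in the end. -/
theorem ripple_encNat (F : Bool → Bool → Bool → Bool × Bool) (m n : ℕ) (R : ℕ → ℕ → Bool → Prop)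
    (h₀ : R 0 0 false) (h : ∀ k r c, r < 2 ^ k → R k r c →
      R (k + 1) (r + 2 ^ k * (F (m.testBit k) (n.testBit k) c).1.toNat)
        (F (m.testBit k) (n.testBit k) c).2) (l : Word) :
    ∃ c w, ripple F l (encNat m) (encNat n) = some c :: w ∧ R l.length (decNat w.reverse) c ∧
      w.length = l.length := by
  induction l using List.reverseRecOn with
  | nil => exact ⟨false, [], rfl, h₀, rfl⟩
  | append_singleton l x ih =>
    obtain ⟨c, w, h₁, h₂, h₃⟩ := ih
    have : ripple F (l ++ [x]) (encNat m) (encNat n) =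
        rippleStep F (encNat m) (encNat n) (some c :: w) := by
      rw [← h₁, ripple, List.foldl_append]
      rfl
    have hlt : decNat w.reverse < 2 ^ l.length := by
      have := decNat_lt w.reverse
      rwa [List.length_reverse, h₃] at this
    refine ⟨_, _, this, ?_, by simp [h₃]⟩
    have := h _ _ _ hlt h₂
    simp only [headI_drop_encNat, List.tail_cons, List.headI_cons, h₃, List.length_append,
      List.length_singleton, List.reverse_cons, Bool.decide_eq_true, Option.some.injEq,
      decNat_append, List.length_reverse, decNat_cons, decNat_nil]
    convert this using 3
    rcases (F (m.testBit l.length) (n.testBit l.length) c).1 <;> simp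

theorem mod_two_pow_succ_eq (m k : ℕ) :
    m % 2 ^ (k + 1) = m % 2 ^ k + 2 ^ k * (m.testBit k).toNat := by
  rw [Nat.mod_pow_succ, Nat.toNat_testBit]

theorem lt_two_pow_of_size_le {m k : ℕ} (h : m.size ≤ k) : m < 2 ^ k := Nat.size_le.1 h

namespace PolyNat

variable {f g h : (ι → Word) → ℕ}

theorem exists_size_le (hf : PolyNat f) : ∃ t, PolyBdd t ∧ ∀ s, (f s).size ≤ t s := by
  obtain ⟨t, ht, h⟩ := PolyTime.exists_length_le hf
  exact ⟨t, ht, fun s => length_encNat (f s) ▸ h s⟩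

theorem weaken (hf : PolyNat f) : PolyNat fun s : Option ι → Word => f fun i => s (some i) :=
  PolyTime.weaken hf

theorem const (m : ℕ) : PolyNat fun _ : ι → Word => m := PolyTime.const _

theorem add (hf : PolyNat f) (hg : PolyNat g) : PolyNat fun s => f s + g s := by
  let F : Bool → Bool → Bool → Bool × Bool := fun x y c =>
    (Bool.xor (Bool.xor x y) c, (x && y) || (x && c) || (y && c))
  have := (PolyTime.ripple F (((PolyTime.append hf hg)).cons none) hf hg).tail.reverse.decNat
  convert this using 2 with s
  obtain ⟨c, w, h₁, h₂, h₃⟩ := ripple_encNat F (f s) (g s)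
    (fun k r c => r + 2 ^ k * c.toNat = f s % 2 ^ k + g s % 2 ^ k) (by simp [Nat.mod_one])
    (fun k r c _ h => by
      rw [mod_two_pow_succ_eq, mod_two_pow_succ_eq, pow_succ]
      cases hx : (f s).testBit k <;> cases hy : (g s).testBit k <;> cases c <;>
        simp [F] at h ⊢ <;> omega)
    (none :: (encNat (f s) ++ encNat (g s)))
  rw [h₁, List.tail_cons]
  simp only [List.length_cons, List.length_append, length_encNat] at h₂ h₃
  have hlt := decNat_lt w.reverse
  rw [List.length_reverse, h₃] at hlt
  have hf' := lt_two_pow_of_size_le (m := f s) (k := (f s).size + (g s).size) (by omega)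
  have hg' := lt_two_pow_of_size_le (m := g s) (k := (f s).size + (g s).size) (by omega)
  rw [pow_succ] at h₂ hlt
  rw [Nat.mod_eq_of_lt (by omega), Nat.mod_eq_of_lt (by omega)] at h₂
  cases c
  · simp at h₂; omega
  · simp at h₂; omega

theorem sub (hf : PolyNat f) (hg : PolyNat g) : PolyNat fun s => f s - g s := by
  let F : Bool → Bool → Bool → Bool × Bool := fun x y c =>
    (Bool.xor (Bool.xor x y) c, (!x && (y || c)) || (y && c))
  have hr := PolyTime.ripple F (PolyTime.append hf hg) hf hg
  have := PolyTime.decNat (PolyTime.ite_headI hr (some true) .nil hr.tail.reverse)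
  convert this using 2 with s
  obtain ⟨c, w, h₁, h₂, h₃⟩ := ripple_encNat F (f s) (g s)
    (fun k r c => r + g s % 2 ^ k = f s % 2 ^ k + 2 ^ k * c.toNat) (by simp [Nat.mod_one])
    (fun k r c _ h => by
      rw [mod_two_pow_succ_eq, mod_two_pow_succ_eq, pow_succ]
      cases hx : (f s).testBit k <;> cases hy : (g s).testBit k <;> cases c <;>
        simp [F] at h ⊢ <;> omega)
    (encNat (f s) ++ encNat (g s))
  rw [h₁, List.tail_cons]
  simp only [List.length_append, length_encNat] at h₂ h₃
  have hlt := decNat_lt w.reverse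
  rw [List.length_reverse, h₃] at hlt
  have hf' := lt_two_pow_of_size_le (m := f s) (k := (f s).size + (g s).size) (by omega)
  have hg' := lt_two_pow_of_size_le (m := g s) (k := (f s).size + (g s).size) (by omega)
  rw [Nat.mod_eq_of_lt hf', Nat.mod_eq_of_lt hg'] at h₂
  cases c
  · simp at h₂ ⊢; omega
  · simp [decNat_nil] at h₂ ⊢; omega

end PolyNat

theorem Samplable.ite_eq_zero {f : (ι → Word) → ℕ} (hf : PolyNat f) (h₁ : Samplable e₁)
    (h₂ : Samplable e₂) : Samplable fun s => if f s = 0 then e₁ s else e₂ s := by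
  convert Samplable.ite_head? hf none h₁ h₂ using 2 with s
  simp [encNat_eq_nil]

theorem Samplable.ite_le {f g : (ι → Word) → ℕ} (hf : PolyNat f) (hg : PolyNat g)
    (h₁ : Samplable e₁) (h₂ : Samplable e₂) :
    Samplable fun s => if f s ≤ g s then e₁ s else e₂ s := by
  convert Samplable.ite_eq_zero (hf.sub hg) h₁ h₂ using 2 with s
  simp [Nat.sub_eq_zero_iff_le]

theorem Samplable.ite_eq {f g : (ι → Word) → ℕ} (hf : PolyNat f) (hg : PolyNat g)
    (h₁ : Samplable e₁) (h₂ : Samplable e₂) :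
    Samplable fun s => if f s = g s then e₁ s else e₂ s := by
  convert Samplable.ite_le hf hg (Samplable.ite_le hg hf h₁ h₂) h₂ using 2 with s
  simp only [le_antisymm_iff]
  by_cases h : f s ≤ g s <;> simp [h]

namespace PolyNat

variable {f g h : (ι → Word) → ℕ}

theorem ite_eq_zero (hf : PolyNat f) (hg : PolyNat g) (hh : PolyNat h) :
    PolyNat fun s => if f s = 0 then g s else h s := by
  have := Samplable.ite_eq_zero hf hg hh
  unfold PolyNat PolyTime
  simpa only [apply_ite encNat, apply_ite PMF.pure] using this

theorem ite_le {f' : (ι → Word) → ℕ} (hf : PolyNat f) (hf' : PolyNat f') (hg : PolyNat g)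
    (hh : PolyNat h) : PolyNat fun s => if f s ≤ f' s then g s else h s := by
  have := Samplable.ite_le hf hf' hg hh
  unfold PolyNat PolyTime
  simpa only [apply_ite encNat, apply_ite PMF.pure] using this

/-- Recursion on the binary expansion of a number `f`, from the most significant digit on. -/
theorem foldr (hf : PolyNat f) (hh : PolyNat h) {g : (ι → Word) → Bool → ℕ → ℕ}
    (hg : ∀ b, PolyNat fun s : Option ι → Word =>
      g (fun i => s (some i)) b (decNat (s none)))
    {B : (ι → Word) → ℕ} (hB : PolyBdd B)
    (hb : ∀ s l, l <:+ (f s).bits → (l.foldr (g s) (h s)).size ≤ B s) :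
    PolyNat fun s => (f s).bits.foldr (g s) (h s) := by
  have key : ∀ (s : ι → Word) (l : List Bool), (l.map some).foldr
      (fun x w => encNat (g s (decide (x = some true)) (decNat w))) (encNat (h s)) =
      encNat (l.foldr (g s) (h s)) := by
    intro s l
    induction l with
    | nil => rfl
    | cons b l ih =>
      rw [List.map_cons, List.foldr_cons, ih, decNat_encNat]
      simp
  have := PolyTime.foldr_of_length_le hf hh
    (g := fun s x w => encNat (g s (decide (x = some true)) (decNat w))) (by
      refine PolyTime.bool (PolyTime.var (some none)) (b := fun b s =>
        encNat (g (fun i => s (some (some i))) b (decNat (s none)))) fun b => ?_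
      have hinj : Function.Injective (Option.map some : Option ι → Option (Option ι)) :=
        Option.map_injective (Option.some_injective ι)
      exact Samplable.comp_injective (hg b) hinj) hB fun s l' hl' => by
        obtain ⟨l, rfl, hl⟩ : ∃ l, l' = l.map some ∧ l <:+ (f s).bits := by
          refine ⟨l'.map (Option.getD · false), ?_, ?_⟩
          · rw [List.map_map]
            refine (List.map_id l').symm.trans (List.map_congr_left fun x hx => ?_)
            obtain ⟨y, rfl⟩ := Option.isSome_iff_exists.1 (isSome_of_mem_encNat (hl'.mem hx))
            rfl
          · have := hl'.map (Option.getD · false)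
            rwa [encNat, List.map_map, show ((Option.getD · false) ∘ some : Bool → Bool) = id from rfl,
              List.map_id] at this
        rw [key, length_encNat]
        exact hb s l hl
  unfold PolyNat
  convert this using 2 with s
  exact (key s _).symm

/-- The number with a given binary expansion, least significant bit first. -/
def _root_.ofBits (l : List Bool) : ℕ := l.foldr (fun b m => b.toNat + 2 * m) 0

theorem _root_.ofBits_bits (m : ℕ) : ofBits m.bits = m := by
  have key : ∀ l : List Bool, _root_.decNat (l.map some) = ofBits l := by
    intro l
    induction l with
    | nil => rfl
    | cons b l ih =>
      rw [List.map_cons, decNat_cons, ih]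
      cases b <;> simp [ofBits]
  rw [← key]
  exact decNat_encNat m

theorem _root_.ofBits_le_of_suffix {l : List Bool} {m : ℕ} (h : l <:+ m.bits) : ofBits l ≤ m := by
  obtain ⟨l', hl⟩ := h
  rw [← ofBits_bits m, ← hl]
  clear hl
  induction l' with
  | nil => exact le_rfl
  | cons b l' ih =>
    have : ofBits (b :: l' ++ l) = b.toNat + 2 * ofBits (l' ++ l) := rfl
    omega

/-- Multiplication by shifting and adding. -/
theorem mul (hf : PolyNat f) (hg : PolyNat g) : PolyNat fun s => f s * g s := by
  obtain ⟨t, ht, hbt⟩ := hf.exists_size_le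
  obtain ⟨u, hu, hbu⟩ := hg.exists_size_le
  have hacc : PolyNat fun s : Option ι → Word => _root_.decNat (s none) := (PolyTime.var none).decNat
  have key : ∀ s l, l.foldr (fun (b : Bool) acc => (if b then g s else 0) + (acc + acc)) 0 =
      ofBits l * g s := by
    intro s l
    induction l with
    | nil => simp [ofBits]
    | cons b l ih =>
      rw [List.foldr_cons, ih, show ofBits (b :: l) = b.toNat + 2 * ofBits l from rfl]
      cases b <;> simp <;> ring
  have := foldr hf (const 0) (g := fun s b acc => (if b then g s else 0) + (acc + acc))
    (fun b => by cases b; exacts [(const 0).add (hacc.add hacc), hg.weaken.add (hacc.add hacc)])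
    (ht.add hu) fun s l hl => by
      rw [key]
      refine (Nat.size_le_size (Nat.mul_le_mul_right _ (ofBits_le_of_suffix hl))).trans ?_
      rw [Nat.size_le, pow_add]
      exact Nat.mul_lt_mul'' (lt_two_pow_of_size_le (hbt s)) (lt_two_pow_of_size_le (hbu s))
  convert this using 2 with s
  rw [key, ofBits_bits]

/-- Division with remainder, by the recursion `(b + 2 m) % g = (b + 2 (m % g)) % g` on the binary
expansion: each step needs at most one subtraction. -/
theorem mod (hf : PolyNat f) (hg : PolyNat g) : PolyNat fun s => f s % g s := by
  obtain ⟨t, ht, hbt⟩ := hf.exists_size_le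
  have hacc : PolyNat fun s : Option ι → Word => _root_.decNat (s none) := (PolyTime.var none).decNat
  have hacc' : ∀ b : Bool, PolyNat fun s : Option ι → Word => b.toNat + (_root_.decNat (s none) +
    _root_.decNat (s none)) := fun b => (const _).add (hacc.add hacc)
  have key : ∀ s l, l.foldr (fun (b : Bool) acc => if g s ≤ b.toNat + (acc + acc) then
      b.toNat + (acc + acc) - g s else b.toNat + (acc + acc)) 0 = ofBits l % g s := by
    intro s l
    induction l with
    | nil => simp [ofBits]
    | cons b l ih =>
      rw [List.foldr_cons, ih, show ofBits (b :: l) = b.toNat + 2 * ofBits l from rfl]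
      rcases Nat.eq_zero_or_pos (g s) with h0 | h0
      · simp [h0, two_mul]
      · have h1 := Nat.mod_lt (ofBits l) h0
        have h2 : (b.toNat + 2 * ofBits l) % g s =
            (b.toNat + (ofBits l % g s + ofBits l % g s)) % g s := by
          rw [two_mul]
          exact Nat.ModEq.add_left _ (((Nat.mod_modEq _ _).add (Nat.mod_modEq _ _)).symm)
        rw [h2]
        generalize ofBits l % g s = r at h1
        have hb := Bool.toNat_lt b
        split_ifs with h3
        · rw [Nat.mod_eq_sub_mod h3, Nat.mod_eq_of_lt (by omega)]
        · rw [Nat.mod_eq_of_lt (by omega)]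
  have := foldr hf (const 0) (g := fun s b acc => if g s ≤ b.toNat + (acc + acc) then
      b.toNat + (acc + acc) - g s else b.toNat + (acc + acc))
    (fun b => ite_le hg.weaken (hacc' b) ((hacc' b).sub hg.weaken) (hacc' b))
    ht fun s l hl => by
      rw [key]
      exact (Nat.size_le_size ((Nat.mod_le _ _).trans (ofBits_le_of_suffix hl))).trans (hbt s)
  convert this using 2 with s
  rw [key, ofBits_bits]

/-- Modular exponentiation, with value `0` for the modulus `0`. -/
def _root_.powMod (b e p : ℕ) : ℕ := if p = 0 then 0 else b ^ e % p

/-- Modular exponentiation by squaring and multiplying. -/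
theorem powMod (hf : PolyNat f) (hg : PolyNat g) (hh : PolyNat h) :
    PolyNat fun s => powMod (f s) (g s) (h s) := by
  obtain ⟨t, ht, hbt⟩ := hh.exists_size_le
  have hacc : PolyNat fun s : Option ι → Word => _root_.decNat (s none) := (PolyTime.var none).decNat
  have key : ∀ s l, l.foldr (fun (b : Bool) acc => if h s = 0 then 0 else
      acc * acc * (if b then f s else 1) % h s) (_root_.powMod (f s) 0 (h s)) =
      _root_.powMod (f s) (ofBits l) (h s) := by
    intro s l
    induction l with
    | nil => simp [ofBits]
    | cons b l ih =>
      rw [List.foldr_cons, ih, show ofBits (b :: l) = b.toNat + 2 * ofBits l from rfl]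
      rcases Nat.eq_zero_or_pos (h s) with h0 | h0
      · simp [h0, _root_.powMod]
      · simp only [_root_.powMod, h0.ne', if_false]
        have : f s ^ (b.toNat + 2 * ofBits l) =
            f s ^ ofBits l * f s ^ ofBits l * (if b then f s else 1) := by
          rw [pow_add, two_mul, pow_add]
          cases b <;> simp [mul_comm]
        rw [this, Nat.mul_mod, ← Nat.mul_mod, Nat.mul_mod (_ * _), Nat.mul_mod _ _ (h s)]
        simp only [Nat.mod_mod, Nat.mul_mod]
  have h1 : PolyNat fun s => _root_.powMod (f s) 0 (h s) := by
    have := ite_eq_zero hh (const 0) ((const 1).mod hh)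
    simpa only [_root_.powMod, pow_zero] using this
  have := foldr hg h1 (g := fun s b acc => if h s = 0 then 0 else
      acc * acc * (if b then f s else 1) % h s)
    (fun b => ite_eq_zero hh.weaken (const 0) (PolyNat.mod
      ((hacc.mul hacc).mul (by cases b; exacts [const 1, hf.weaken])) hh.weaken))
    ht fun s l hl => by
      rw [key, _root_.powMod]
      split_ifs with h0
      · simp
      · exact (Nat.size_le_size (Nat.mod_lt _ (Nat.pos_of_ne_zero h0)).le).trans (hbt s)
  convert this using 2 with s
  rw [key, ofBits_bits]

end PolyNat
end PolyNat

/-- Samplable functions of one word are sampled by probabilistic polynomial-time Turing machines. -/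
theorem Samplable.exists_ppt {e : Word → PMF Word} (h : Samplable fun s : Unit → Word => e (s ())) :
    ∃ M : PPT, ∀ w, M.output w = e w := by
  obtain ⟨F, t, ⟨p, hp⟩, hF⟩ := h
  refine Subroutine.exists_ppt F p fun w => ⟨(e w).map (extend fun _ => w), ?_, ?_⟩
  · convert (hF fun _ => w).mono
      ((hp _).trans (p.eval_mono_nat (by simp [size] : _ ≤ w.length))) using 1
    rfl
  · rw [PMF.map_comp]
    exact PMF.map_id _

/-! ### The randomized self-reduction as a samplable function -/

section Reduction

variable {ι : Type} [Fintype ι] [DecidableEq ι]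

theorem Samplable.bind' {e : (ι → Word) → PMF Word} {f : (ι → Word) → Word → PMF Word}
    (he : Samplable e)
    (hf : Samplable fun s : Option ι → Word => f (fun i => s (some i)) (s none)) :
    Samplable fun s => (e s).bind (f s) :=
  Samplable.bind he hf

theorem Samplable.bool_word (b : Bool) : Samplable fun _ : ι → Word => PMF.pure [some b] :=
  PolyTime.const _

/-- Normalizing an answer to one bit. -/
noncomputable def answer (r : Word) : PMF Word :=
  if r = [some true] then PMF.pure [some true] else PMF.pure [some false]

theorem Samplable.answer {a : (ι → Word) → Word} (ha : PolyTime a) :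
    Samplable fun s => answer (a s) :=
  Samplable.ite_eq_true ha (.bool_word true) (.bool_word false)

/-- A word of `|w|` fair coins. -/
noncomputable def randomBits (w : Word) : PMF Word :=
  w.foldlM (fun acc _ => (PMF.uniformOfFintype Bool).map fun b => some b :: acc) []

theorem randomBits_append_singleton (w : Word) (x : IOSymbol) : randomBits (w ++ [x]) =
    (randomBits w).bind fun v => (PMF.uniformOfFintype Bool).map fun b => some b :: v := by
  rw [randomBits, List.foldlM_append]
  refine congrArg (PMF.bind _) (funext fun v => ?_)
  rw [List.foldlM_cons]
  exact PMF.bind_pure _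

theorem length_of_mem_support_randomBits (w : Word) :
    ∀ v ∈ (randomBits w).support, v.length = w.length := by
  induction w using List.reverseRecOn with
  | nil =>
    intro v hv
    rw [(PMF.mem_support_pure_iff _ _).1 hv]
  | append_singleton w x ih =>
    intro v hv
    rw [randomBits_append_singleton, PMF.mem_support_bind_iff] at hv
    obtain ⟨v', hv', hv⟩ := hv
    obtain ⟨b, -, rfl⟩ := (PMF.mem_support_map_iff _ _ _).1 hv
    simp [ih v' hv']

theorem Samplable.randomBits {a : (ι → Word) → Word} (ha : PolyTime a) :
    Samplable fun s => randomBits (a s) := by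
  obtain ⟨t, ht, h⟩ := ha.exists_length_le
  have hg : Samplable fun s : Option (Option ι) → Word =>
      (PMF.uniformOfFintype Bool).map fun b => some b :: s none := by
    have := Samplable.bind' (ι := Option (Option ι)) Samplable.coin
      (f := fun s w => PMF.pure (w.headI :: s none))
      (PolyTime.cons_headI (PolyTime.var none) (PolyTime.var (some none)))
    convert this using 2 with s
    rw [PMF.bind_map]
    rfl
  have := Samplable.foldlM_of_length_le ha Samplable.nil (g := fun _ acc _ =>
    (PMF.uniformOfFintype Bool).map fun b => some b :: acc) hg ht fun s l' hl' w hw => by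
      rw [PMF.pure_bind] at hw
      rw [length_of_mem_support_randomBits l' w hw]
      exact hl'.length_le.trans (h s)
  simp only [PMF.pure_bind] at this
  exact this

/-- The last stage of the indistinguishability experiment, with computable checks that the messages
belong to the group: the keys are `yA`, `yB`, and the ciphertext of the message `m_β` is
`(c₁, c₂, m_β T)`. The security parameter is given by the word `nw`. -/
noncomputable def challenge (F A : PPT) (β : Bool) (nw : Word) (P Q g yA yB c₁ c₂ T : ℕ) :
    PMF Word :=
  (F.output (encFields [nw, encNat P, encNat Q, encNat g, encNat yA, encNat yB])).bind fun w =>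
    if P ≤ decNat (headField w) then PMF.pure [some false] else
    if P ≤ decNat (headField (tailFields w)) then PMF.pure [some false] else
    if powMod (decNat (headField w)) Q P = 1 then
      if powMod (decNat (headField (tailFields w))) Q P = 1 then
        (A.output (encFields [nw, encNat P, encNat Q, encNat g, encNat yA, encNat yB, encNat c₁,
          encNat c₂, encNat (decNat (headField (if β then tailFields w else w)) * T % P)] ++
          tailFields (tailFields w))).bind answer
      else PMF.pure [some false]
    else PMF.pure [some false]

theorem Samplable.challenge (F A : PPT) (β : Bool) {nw : (ι → Word) → Word}
    {P Q g yA yB c₁ c₂ T : (ι → Word) → ℕ} (hn : PolyTime nw) (hP : PolyNat P) (hQ : PolyNat Q)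
    (hg : PolyNat g) (hA : PolyNat yA) (hB : PolyNat yB) (h₁ : PolyNat c₁) (h₂ : PolyNat c₂)
    (hT : PolyNat T) : Samplable fun s =>
      challenge F A β (nw s) (P s) (Q s) (g s) (yA s) (yB s) (c₁ s) (c₂ s) (T s) := by
  refine Samplable.bind' (.output_of_polyTime F (hn.encFields_cons (PolyTime.encFields_cons hP
    (PolyTime.encFields_cons hQ (PolyTime.encFields_cons hg (PolyTime.encFields_cons hA
    (PolyTime.encFields_cons hB .encFields_nil))))))) ?_
  have hw : PolyTime fun s : Option ι → Word => s none := .var none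
  refine .ite_le hP.weaken hw.headField.decNat (.bool_word false) ?_
  refine .ite_le hP.weaken hw.tailFields.headField.decNat (.bool_word false) ?_
  refine .ite_eq (hw.headField.decNat.powMod hQ.weaken hP.weaken) (.const 1) ?_ (.bool_word false)
  refine .ite_eq (hw.tailFields.headField.decNat.powMod hQ.weaken hP.weaken) (.const 1) ?_
    (.bool_word false)
  have hm : PolyTime fun s : Option ι → Word => if β then tailFields (s none) else s none := by
    cases β
    · exact hw
    · exact hw.tailFields
  exact .bind' (.output_of_polyTime A (PolyTime.append (hn.weaken.encFields_cons
    (PolyTime.encFields_cons hP.weaken (PolyTime.encFields_cons hQ.weaken (PolyTime.encFields_cons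
    hg.weaken (PolyTime.encFields_cons hA.weaken (PolyTime.encFields_cons hB.weaken
    (PolyTime.encFields_cons h₁.weaken (PolyTime.encFields_cons h₂.weaken (PolyTime.encFields_cons
    ((hm.headField.decNat.mul hT.weaken).mod hP.weaken) .encFields_nil)))))))))
    hw.tailFields.tailFields)) (.answer (.var none))

/-- The experiment on a rerandomized triple: from `(X, Y, Z) = (g^a, g^b, g^c)` one obtains
`X' = g^a'`, `Y' = g^b'` and `Z' = g^(a' b' + w (c - a b))` with `a' = w a + u` and `b' = b + v`.
The key `yA` is `X'`, the randomness of the encryption is `b'`, and `Z'` takes the place of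
`yA^b'`. -/
noncomputable def trialAt (F A : PPT) (β : Bool) (nw : Word) (P Q g X Y Z u v w xB kB : ℕ) :
    PMF Word :=
  challenge F A β nw P Q g (powMod X w P * powMod g u P % P) (powMod g xB P)
    (Y * powMod g v P % P) (powMod g kB P)
    (powMod (Z * powMod X v P) w P * powMod (Y * powMod g v P) u P * powMod (powMod g xB P) kB P)

theorem Samplable.trialAt (F A : PPT) (β : Bool) {nw : (ι → Word) → Word}
    {P Q g X Y Z u v w xB kB : (ι → Word) → ℕ} (hn : PolyTime nw) (hP : PolyNat P) (hQ : PolyNat Q)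
    (hg : PolyNat g) (hX : PolyNat X) (hY : PolyNat Y) (hZ : PolyNat Z) (hu : PolyNat u)
    (hv : PolyNat v) (hw : PolyNat w) (hx : PolyNat xB) (hk : PolyNat kB) : Samplable fun s =>
      trialAt F A β (nw s) (P s) (Q s) (g s) (X s) (Y s) (Z s) (u s) (v s) (w s) (xB s) (kB s) :=
  .challenge F A β hn hP hQ hg (((hX.powMod hw hP).mul (hg.powMod hu hP)).mod hP)
    (hg.powMod hx hP) ((hY.mul (hg.powMod hv hP)).mod hP) (hg.powMod hk hP)
    ((((hZ.mul (hX.powMod hv hP)).powMod hw hP).mul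
      ((hY.mul (hg.powMod hv hP)).powMod hu hP)).mul ((hg.powMod hx hP).powMod hk hP))

/-- The field number `k` of an encoded tuple of words. -/
def field (k : ℕ) (x : Word) : Word := headField (tailFields^[k] x)

theorem PolyTime.field {a : (ι → Word) → Word} (ha : PolyTime a) (k : ℕ) :
    PolyTime fun s => field k (a s) := by
  suffices PolyTime fun s => _root_.tailFields^[k] (a s) from this.headField
  induction k with
  | zero => exact ha
  | succ k ih => simpa only [Function.iterate_succ_apply'] using ih.tailFields

/-- A random binary number of `|w|` digits. -/
noncomputable def randomNat (w : Word) : PMF ℕ := (randomBits w).map decNat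

/-- The experiment on a rerandomized triple, as a function of the input `(1ⁿ, P, Q, g, X, Y, Z)`.
The exponents are random numbers of `n + |P|` bits, hence almost uniform modulo `Q`. -/
noncomputable def trial (F A : PPT) (β : Bool) (x : Word) : PMF Word :=
  (randomNat (field 0 x ++ field 1 x)).bind fun u =>
  (randomNat (field 0 x ++ field 1 x)).bind fun v =>
  (randomNat (field 0 x ++ field 1 x)).bind fun w =>
  (randomNat (field 0 x ++ field 1 x)).bind fun xB =>
  (randomNat (field 0 x ++ field 1 x)).bind fun kB =>
    trialAt F A β (field 0 x) (decNat (field 1 x)) (decNat (field 2 x)) (decNat (field 3 x))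
      (decNat (field 4 x)) (decNat (field 5 x)) (decNat (field 6 x)) u v w xB kB

theorem Samplable.trial (F A : PPT) (β : Bool) {a : (ι → Word) → Word} (ha : PolyTime a) :
    Samplable fun s => trial F A β (a s) := by
  suffices Samplable fun s : Option ι → Word => _root_.trial F A β (s none) from this.subst ha
  have hL {κ : Type} [Fintype κ] [DecidableEq κ] (k : κ) :
      Samplable fun s : κ → Word => _root_.randomBits (field 0 (s k) ++ field 1 (s k)) :=
    .randomBits (PolyTime.append ((PolyTime.var k).field 0) ((PolyTime.var k).field 1))
  simp only [_root_.trial, randomNat, PMF.bind_map, Function.comp_def]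
  refine .bind' (hL _) (.bind' (hL _) (.bind' (hL _) (.bind' (hL _) (.bind' (hL _) ?_))))
  have hx {κ : Type} [Fintype κ] [DecidableEq κ] (k : κ) (i : ℕ) :
      PolyNat fun s : κ → Word => _root_.decNat (field i (s k)) :=
    ((PolyTime.var k).field i).decNat
  exact .trialAt F A β ((PolyTime.var _).field 0) (hx _ 1) (hx _ 2) (hx _ 3) (hx _ 4) (hx _ 5)
    (hx _ 6) (PolyTime.decNat (.var _)) (PolyTime.decNat (.var _)) (PolyTime.decNat (.var _))
    (PolyTime.decNat (.var _)) (PolyTime.decNat (.var _))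

/-- Repeat a randomized computation `|l|` times; the number of answers `1`, in unary. -/
noncomputable def countOnes (e : PMF Word) (l : Word) : PMF Word :=
  l.foldlM (fun acc _ => e.bind fun r =>
    if r = [some true] then PMF.pure (some true :: acc) else PMF.pure acc) []

theorem countOnes_append_singleton (e : PMF Word) (l : Word) (x : IOSymbol) :
    countOnes e (l ++ [x]) = (countOnes e l).bind fun acc => e.bind fun r =>
      if r = [some true] then PMF.pure (some true :: acc) else PMF.pure acc := by
  rw [countOnes, List.foldlM_append]
  refine congrArg (PMF.bind _) (funext fun v => ?_)
  rw [List.foldlM_cons]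
  exact PMF.bind_pure _

theorem length_le_of_mem_support_countOnes (e : PMF Word) (l : Word) :
    ∀ v ∈ (countOnes e l).support, v.length ≤ l.length := by
  induction l using List.reverseRecOn with
  | nil =>
    intro v hv
    rw [(PMF.mem_support_pure_iff _ _).1 hv]
  | append_singleton w x ih =>
    intro v hv
    rw [countOnes_append_singleton, PMF.mem_support_bind_iff] at hv
    obtain ⟨v', hv', hv⟩ := hv
    obtain ⟨r, -, hv⟩ := (PMF.mem_support_bind_iff _ _ _).1 hv
    have := ih v' hv'
    split_ifs at hv <;> rw [(PMF.mem_support_pure_iff _ _).1 hv] <;> simp <;> omega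

theorem Samplable.countOnes {e : (ι → Word) → PMF Word} (he : Samplable e)
    {l : (ι → Word) → Word} (hl : PolyTime l) : Samplable fun s => countOnes (e s) (l s) := by
  obtain ⟨t, ht, h⟩ := hl.exists_length_le
  have := Samplable.foldlM_of_length_le hl Samplable.nil (g := fun s acc _ => (e s).bind fun r =>
    if r = [some true] then PMF.pure (some true :: acc) else PMF.pure acc)
    (.bind' he.weaken.weaken (.ite_eq_true (.var none) ((PolyTime.var (some none)).cons _)
      (PolyTime.var (some none)))) ht fun s l' hl' w hw => by
      rw [PMF.pure_bind] at hw
      exact (length_le_of_mem_support_countOnes _ l' w hw).trans (hl'.length_le.trans (h s))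
  simp only [PMF.pure_bind] at this
  exact this

/-- The decision procedure: compare the number of answers `1` of `n^(2d+2)` experiments with the
message `m₁` and of as many with the message `m₀`, where `n` is the length of the first field. -/
noncomputable def decideDDH (F A : PPT) (d : ℕ) (x : Word) : PMF Word :=
  (countOnes (trial F A true x) (unary ((field 0 x).length ^ (2 * d + 2)))).bind fun s₁ =>
  (countOnes (trial F A false x) (unary ((field 0 x).length ^ (2 * d + 2)))).bind fun s₀ =>
    if (field 0 x).length ^ (2 * d + 2) ≤
      2 * (field 0 x).length ^ d * ((s₁.length - s₀.length) + (s₀.length - s₁.length))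
    then PMF.pure [some true] else PMF.pure [some false]

theorem exists_ppt_decideDDH (F A : PPT) (d : ℕ) :
    ∃ M : PPT, ∀ x, M.output x = decideDDH F A d x := by
  refine Samplable.exists_ppt ?_
  have hn {κ : Type} [Fintype κ] [DecidableEq κ] (k : κ) :
      PolyUnary fun s : κ → Word => (field 0 (s k)).length :=
    .length ((PolyTime.var k).field 0)
  have hs {κ : Type} [Fintype κ] [DecidableEq κ] (k : κ) :
      PolyUnary fun s : κ → Word => (s k).length := .length (.var k)
  refine .bind' (.countOnes (.trial F A true (.var ())) ((hn ()).pow _)) ?_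
  refine .bind' (.countOnes (.trial F A false (.var _)) ((hn _).pow _)) ?_
  exact .ite_unary_le ((hn _).pow _) (((PolyUnary.const 2).mul ((hn _).pow d)).mul
    (((hs _).sub (hs _)).add ((hs _).sub (hs _)))) (.bool_word true) (.bool_word false)

theorem exists_ppt_trial (F A : PPT) (β : Bool) : ∃ M : PPT, ∀ x, M.output x = trial F A β x :=
  Samplable.exists_ppt (.trial F A β (.var ()))

end Reduction

/-! ### Expectations and averages -/

section Expectation

variable {α β : Type}

/-- The expectation of a bounded real function. -/
noncomputable def ev (μ : PMF α) (φ : α → ℝ) : ℝ := ∑' a, (μ a).toReal * φ a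

theorem toReal_nonneg_le_one (μ : PMF α) (a : α) : 0 ≤ (μ a).toReal ∧ (μ a).toReal ≤ 1 :=
  ⟨ENNReal.toReal_nonneg, by simpa using ENNReal.toReal_mono ENNReal.one_ne_top (μ.coe_le_one a)⟩

theorem hasSum_toReal (μ : PMF α) : HasSum (fun a => (μ a).toReal) 1 := by
  have := ENNReal.hasSum_toReal (f := fun a => μ a) (by rw [μ.tsum_coe]; exact ENNReal.one_ne_top)
  rwa [← ENNReal.tsum_toReal_eq fun a => μ.apply_ne_top a, μ.tsum_coe] at this

theorem summable_ev (μ : PMF α) {φ : α → ℝ} {C : ℝ} (h : ∀ a, |φ a| ≤ C) :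
    Summable fun a => (μ a).toReal * φ a := by
  refine Summable.of_norm_bounded ((hasSum_toReal μ).summable.mul_right C) fun a => ?_
  rw [Real.norm_eq_abs, abs_mul, abs_of_nonneg ENNReal.toReal_nonneg]
  exact mul_le_mul_of_nonneg_left (h a) ENNReal.toReal_nonneg

theorem ev_const (μ : PMF α) (c : ℝ) : ev μ (fun _ => c) = c := by
  rw [ev, tsum_mul_right, (hasSum_toReal μ).tsum_eq, one_mul]

theorem ev_mono (μ : PMF α) {φ ψ : α → ℝ} {C D : ℝ} (hφ : ∀ a, |φ a| ≤ C) (hψ : ∀ a, |ψ a| ≤ D)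
    (h : ∀ a ∈ μ.support, φ a ≤ ψ a) : ev μ φ ≤ ev μ ψ := by
  refine Summable.tsum_le_tsum (fun a => ?_) (summable_ev μ hφ) (summable_ev μ hψ)
  by_cases ha : a ∈ μ.support
  · exact mul_le_mul_of_nonneg_left (h a ha) ENNReal.toReal_nonneg
  · rw [PMF.mem_support_iff, not_not] at ha
    simp [ha]

theorem ev_sub (μ : PMF α) {φ ψ : α → ℝ} {C D : ℝ} (hφ : ∀ a, |φ a| ≤ C) (hψ : ∀ a, |ψ a| ≤ D) :
    ev μ (fun a => φ a - ψ a) = ev μ φ - ev μ ψ := by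
  simp only [ev, mul_sub]
  exact (summable_ev μ hφ).tsum_sub (summable_ev μ hψ)

theorem ev_add (μ : PMF α) {φ ψ : α → ℝ} {C D : ℝ} (hφ : ∀ a, |φ a| ≤ C) (hψ : ∀ a, |ψ a| ≤ D) :
    ev μ (fun a => φ a + ψ a) = ev μ φ + ev μ ψ := by
  simp only [ev, mul_add]
  exact (summable_ev μ hφ).tsum_add (summable_ev μ hψ)

theorem abs_ev_le (μ : PMF α) {φ : α → ℝ} {C ε : ℝ} (hφ : ∀ a, |φ a| ≤ C)
    (h : ∀ a ∈ μ.support, |φ a| ≤ ε) : |ev μ φ| ≤ ε := by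
  have h₁ := ev_mono μ hφ (fun _ => le_refl |ε|) fun a ha => (abs_le.1 (h a ha)).2
  have h₂ := ev_mono μ (fun _ => le_refl |-ε|) hφ fun a ha => (abs_le.1 (h a ha)).1
  rw [ev_const] at h₁ h₂
  exact abs_le.2 ⟨h₂, h₁⟩

theorem ev_mem (μ : PMF α) {φ : α → ℝ} (h : ∀ a, φ a ∈ Set.Icc (0 : ℝ) 1) :
    ev μ φ ∈ Set.Icc (0 : ℝ) 1 := by
  have h' : ∀ a, |φ a| ≤ 1 := fun a => abs_le.2 ⟨by linarith [(h a).1], (h a).2⟩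
  refine ⟨tsum_nonneg fun a => mul_nonneg ENNReal.toReal_nonneg (h a).1, ?_⟩
  have := ev_mono μ h' (fun _ => le_refl |(1 : ℝ)|) fun a _ => (h a).2
  rwa [ev_const] at this

theorem toReal_bind (μ : PMF α) (f : α → PMF β) (b : β) :
    (μ.bind f b).toReal = ev μ fun a => (f a b).toReal := by
  rw [PMF.bind_apply, ENNReal.tsum_toReal_eq fun a =>
    ENNReal.mul_ne_top (μ.apply_ne_top a) ((f a).apply_ne_top b)]
  simp only [ENNReal.toReal_mul, ev]

open Classical in
theorem toReal_toOuterMeasure (μ : PMF α) (s : Set α) :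
    (μ.toOuterMeasure s).toReal = ev μ fun a => if a ∈ s then 1 else 0 := by
  rw [PMF.toOuterMeasure_apply, ENNReal.tsum_toReal_eq]
  · refine tsum_congr fun a => ?_
    by_cases h : a ∈ s <;> simp [h]
  · intro a
    by_cases h : a ∈ s <;> simp [h, μ.apply_ne_top a]

theorem unif_range_apply {N : ℕ} (hN : N ≠ 0) (i : ℕ) :
    (unif (range N) i).toReal = if i < N then (N : ℝ)⁻¹ else 0 := by
  rw [unif, dif_pos (by simpa using hN), PMF.uniformOfFinset_apply]
  simp only [mem_range, card_range]
  split_ifs <;> simp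

theorem ev_unif_range {N : ℕ} (hN : N ≠ 0) (φ : ℕ → ℝ) :
    ev (unif (range N)) φ = (∑ i ∈ range N, φ i) / N := by
  rw [ev, tsum_eq_sum (s := range N), sum_div]
  · refine sum_congr rfl fun i hi => ?_
    rw [unif_range_apply hN, if_pos (mem_range.1 hi), div_eq_inv_mul]
  · intro i hi
    rw [unif_range_apply hN, if_neg (by simpa using hi), zero_mul]

/-- Equality of distributions, tested on the probabilities of points. -/
theorem pmf_eq_of_toReal {μ ν : PMF α} (h : ∀ a, (μ a).toReal = (ν a).toReal) : μ = ν :=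
  PMF.ext fun a => (ENNReal.toReal_eq_toReal_iff' (μ.apply_ne_top a) (ν.apply_ne_top a)).1 (h a)

theorem randomNat_eq (w : Word) : randomNat w = unif (range (2 ^ w.length)) := by
  rw [randomNat]
  induction w using List.reverseRecOn with
  | nil =>
    refine (PMF.pure_map _ _).trans (pmf_eq_of_toReal fun a => ?_)
    rw [unif_range_apply (by simp)]
    by_cases h : a = 0 <;> simp [h, PMF.pure_apply, decNat_nil]
  | append_singleton w x ih =>
    have : (randomBits (w ++ [x])).map decNat = (unif (range (2 ^ w.length))).bind fun m =>
        (PMF.uniformOfFintype Bool).bind fun b => PMF.pure (b.toNat + 2 * m) := by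
      rw [randomBits_append_singleton, PMF.map_bind, ← ih, PMF.bind_map]
      refine congrArg _ (funext fun v => ?_)
      rw [PMF.map_comp]
      refine congrArg (PMF.bind _) (funext fun b => congrArg PMF.pure ?_)
      cases b <;> simp [decNat_cons]
    rw [this]
    refine pmf_eq_of_toReal fun a => ?_
    rw [toReal_bind, ev_unif_range (by simp), unif_range_apply (by simp), List.length_append,
      List.length_singleton]
    simp only [toReal_bind, ev, tsum_bool, PMF.uniformOfFintype_apply, PMF.pure_apply]
    have key : ∀ N : ℕ, ∑ i ∈ range N, ((if a = 2 * i then (1 : ℝ) else 0) +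
        (if a = 1 + 2 * i then (1 : ℝ) else 0)) = if a < 2 * N then 1 else 0 := by
      intro N
      induction N with
      | zero => simp
      | succ N ih =>
        rw [sum_range_succ, ih]
        split_ifs <;> first | omega | norm_num
    have h2 := key (2 ^ w.length)
    rw [pow_succ', Nat.cast_mul, Nat.cast_two]
    by_cases h : a < 2 * 2 ^ w.length
    · rw [if_pos h] at h2 ⊢
      rw [mul_inv, div_eq_mul_inv, mul_comm]
      conv_rhs => rw [mul_comm, ← one_mul (2⁻¹ : ℝ), ← h2, sum_mul]
      congr 1
      refine sum_congr rfl fun i _ => ?_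
      split_ifs <;> simp_all
    · rw [if_neg h] at h2 ⊢
      rw [div_eq_zero_iff]
      left
      refine sum_eq_zero fun i hi => ?_
      rw [mem_range] at hi
      rw [if_neg (by simp; omega), if_neg (by simp; omega)]
      simp

end Expectation

/-! ### Reduction of exponents modulo the group order -/

section Average

variable {Q : ℕ} [NeZero Q]

/-- The average of a function on `ℤ_Q`. -/
noncomputable def avg (φ : ZMod Q → ℝ) : ℝ := (∑ z, φ z) / Q

theorem sum_range_eq_sum_zmod (φ : ZMod Q → ℝ) : ∑ i ∈ range Q, φ i = ∑ z, φ z := by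
  refine sum_bij (fun i _ => (i : ZMod Q)) (fun _ _ => mem_univ _) (fun i hi j hj h => ?_)
    (fun z _ => ⟨z.val, mem_range.2 z.val_lt, by simp⟩) fun _ _ => rfl
  rw [ZMod.natCast_eq_natCast_iff'] at h
  rwa [Nat.mod_eq_of_lt (mem_range.1 hi), Nat.mod_eq_of_lt (mem_range.1 hj)] at h

theorem sum_range_mul_eq (φ : ZMod Q → ℝ) (k : ℕ) : ∑ i ∈ range (Q * k), φ i = k * ∑ z, φ z := by
  induction k with
  | zero => simp
  | succ k ih =>
    rw [Nat.mul_succ, sum_range_add, ih]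
    simp only [Nat.cast_add, Nat.cast_mul, CharP.cast_eq_zero, zero_mul, zero_add,
      sum_range_eq_sum_zmod, Nat.cast_one]
    ring

theorem avg_mem {φ : ZMod Q → ℝ} (h : ∀ z, φ z ∈ Set.Icc (0 : ℝ) 1) : avg φ ∈ Set.Icc (0 : ℝ) 1 := by
  have hQ : (0 : ℝ) < Q := by exact_mod_cast NeZero.pos Q
  refine ⟨div_nonneg (sum_nonneg fun z _ => (h z).1) hQ.le, (div_le_one hQ).2 ?_⟩
  refine (sum_le_card_nsmul _ _ 1 fun z _ => (h z).2).trans ?_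
  simp [ZMod.card]

/-- A random number below `N` is uniform modulo `Q`, up to a statistical distance `Q / N`. -/
theorem abs_ev_unif_sub_avg_le {N : ℕ} (hN : N ≠ 0) {φ : ZMod Q → ℝ}
    (h : ∀ z, φ z ∈ Set.Icc (0 : ℝ) 1) :
    |ev (unif (range N)) (fun i => φ i) - avg φ| ≤ Q / N := by
  have hQ : (0 : ℝ) < Q := by exact_mod_cast NeZero.pos Q
  have hN' : (0 : ℝ) < N := by exact_mod_cast Nat.pos_of_ne_zero hN
  have hr := Nat.mod_lt N (NeZero.pos Q)
  have hNQ := Nat.div_add_mod N Q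
  rw [ev_unif_range hN, avg]
  have h1 : ∑ i ∈ range N, φ i = (N / Q : ℕ) * ∑ z, φ z + ∑ i ∈ range (N % Q), φ i := by
    conv_lhs => rw [← hNQ]
    rw [sum_range_add, sum_range_mul_eq]
    simp
  set S := ∑ z, φ z
  have hS := avg_mem h
  rw [avg, Set.mem_Icc, div_le_one hQ] at hS
  have hS0 : 0 ≤ S := sum_nonneg fun z _ => (h z).1
  set r := ∑ i ∈ range (N % Q), φ i
  have hr0 : 0 ≤ r := sum_nonneg fun z _ => (h z).1
  have hr1 : r ≤ (N % Q : ℕ) := by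
    refine (sum_le_card_nsmul (range (N % Q)) (fun i : ℕ => φ i) 1 fun i _ => (h i).2).trans ?_
    simp
  have hNQ' : (N : ℝ) = Q * (N / Q : ℕ) + (N % Q : ℕ) := by exact_mod_cast hNQ.symm
  have hr' : ((N % Q : ℕ) : ℝ) ≤ Q := by exact_mod_cast hr.le
  have hr2 : (0 : ℝ) ≤ (N % Q : ℕ) := Nat.cast_nonneg _
  have hd : |r * Q - (N % Q : ℕ) * S| ≤ Q * Q := by
    have h2 : r * Q ≤ Q * Q := mul_le_mul_of_nonneg_right (hr1.trans hr') hQ.le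
    have h3 : (N % Q : ℕ) * S ≤ Q * Q := mul_le_mul hr' hS.2 hS0 hQ.le
    have h4 := mul_nonneg hr0 hQ.le
    have h5 := mul_nonneg hr2 hS0
    exact abs_le.2 ⟨by linarith, by linarith⟩
  rw [h1, div_sub_div _ _ hN'.ne' hQ.ne', abs_div, abs_of_pos (mul_pos hN' hQ),
    div_le_div_iff₀ (mul_pos hN' hQ) hN',
    show ((N / Q : ℕ) * S + r) * Q - N * S = r * Q - (N % Q : ℕ) * S by rw [hNQ']; ring]
  calc _ ≤ Q * Q * (N : ℝ) := mul_le_mul_of_nonneg_right hd hN'.le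
    _ = Q * (N * Q) := by ring

/-- The same with a function that is only approximately periodic. -/
theorem abs_ev_unif_sub_avg_le_add {N : ℕ} (hN : N ≠ 0) {f : ℕ → ℝ} {φ : ZMod Q → ℝ} {ε : ℝ}
    (hC : ∀ i, f i ∈ Set.Icc (0 : ℝ) 1) (h : ∀ z, φ z ∈ Set.Icc (0 : ℝ) 1)
    (hf : ∀ i : ℕ, |f i - φ i| ≤ ε) :
    |ev (unif (range N)) f - avg φ| ≤ ε + Q / N := by
  have hφ : ∀ i : ℕ, |φ i| ≤ 1 := fun i => abs_le.2 ⟨by linarith [(h i).1], (h i).2⟩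
  have h1 := abs_ev_le (unif (range N)) (φ := fun i => f i - φ i) hf fun i _ => hf i
  rw [ev_sub _ (fun i => abs_le.2 ⟨by linarith [(hC i).1], (hC i).2⟩) hφ] at h1
  have h2 := abs_ev_unif_sub_avg_le hN h
  exact (abs_sub_le _ _ _).trans (add_le_add h1 h2)

theorem ev_exponent (pp : Params) (hQ : pp.Q = Q) (φ : ZMod Q → ℝ) :
    ev (exponent pp) (fun i => φ i) = avg φ := by
  rw [exponent, hQ, ev_unif_range (NeZero.ne Q), sum_range_eq_sum_zmod, avg]

theorem avg_congr_equiv (σ : ZMod Q ≃ ZMod Q) (φ : ZMod Q → ℝ) : avg (fun z => φ (σ z)) = avg φ := by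
  rw [avg, avg, Equiv.sum_comp σ]

theorem avg_comm (φ : ZMod Q → ZMod Q → ℝ) :
    (avg fun x => avg fun y => φ x y) = avg fun y => avg fun x => φ x y := by
  simp only [avg, ← sum_div]
  rw [sum_comm]

theorem avg_const (c : ℝ) : (avg fun _ : ZMod Q => c) = c := by
  have hQ : (Q : ℝ) ≠ 0 := by exact_mod_cast NeZero.ne Q
  simp [avg, ZMod.card, hQ]

end Average

/-! ### Powers of the generator -/

section Average

variable {Q : ℕ} [NeZero Q]

theorem avg_ev {α : Type} (μ : PMF α) {φ : ZMod Q → α → ℝ} {C : ℝ} (h : ∀ z a, |φ z a| ≤ C) :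
    (avg fun z => ev μ (φ z)) = ev μ fun a => avg fun z => φ z a := by
  simp only [avg, ev]
  rw [← Summable.tsum_finsetSum fun z _ => summable_ev μ (h z), ← tsum_div_const]
  refine tsum_congr fun a => ?_
  rw [← mul_sum, mul_div_assoc]

/-- The key computation behind the random self-reducibility: the exponents `a' = w a + u`,
`b' = b + v` and `c' = a' b' + w (c - a b)` of the rerandomized triple. -/
theorem avg_rerandomize (K : ZMod Q → ZMod Q → ZMod Q → ℝ) (a b c : ZMod Q) :
    (avg fun u => avg fun v => avg fun w => K (a * w + u) (b + v) ((c + a * v) * w + (b + v) * u)) =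
      avg fun y => avg fun x => avg fun w => K x y (x * y + w * (c - a * b)) := by
  rw [avg_comm]
  have h1 : ∀ v : ZMod Q, (avg fun u => avg fun w =>
      K (a * w + u) (b + v) ((c + a * v) * w + (b + v) * u)) =
      avg fun x => avg fun w => K x (b + v) (x * (b + v) + w * (c - a * b)) := by
    intro v
    rw [avg_comm]
    refine Eq.trans ?_ (avg_comm _)
    refine congrArg avg (funext fun w => ?_)
    refine Eq.trans ?_ (avg_congr_equiv (Equiv.addLeft (a * w)) fun x =>
      K x (b + v) (x * (b + v) + w * (c - a * b)))
    refine congrArg avg (funext fun u => ?_)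
    rw [Equiv.coe_addLeft]
    congr 1
    ring
  simp only [h1]
  exact avg_congr_equiv (Equiv.addLeft b) fun y =>
    avg fun x => avg fun w => K x y (x * y + w * (c - a * b))

/-- Diffie-Hellman triples become uniform Diffie-Hellman triples. -/
theorem avg_rerandomize_of_eq (K : ZMod Q → ZMod Q → ZMod Q → ℝ) {a b c : ZMod Q} (h : c = a * b) :
    (avg fun u => avg fun v => avg fun w => K (a * w + u) (b + v) ((c + a * v) * w + (b + v) * u)) =
      avg fun y => avg fun x => K x y (x * y) := by
  rw [avg_rerandomize]
  simp only [h, sub_self, mul_zero, add_zero, avg_const]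

/-- Other triples become uniform triples, since `c - a b` is invertible. -/
theorem avg_rerandomize_of_ne {Q : ℕ} [Fact Q.Prime] (K : ZMod Q → ZMod Q → ZMod Q → ℝ)
    {a b c : ZMod Q} (h : c ≠ a * b) :
    (avg fun u => avg fun v => avg fun w => K (a * w + u) (b + v) ((c + a * v) * w + (b + v) * u)) =
      avg fun y => avg fun x => avg fun z => K x y z := by
  rw [avg_rerandomize]
  refine congrArg avg (funext fun y => congrArg avg (funext fun x => ?_))
  exact avg_congr_equiv ((Equiv.mulRight₀ (c - a * b) (sub_ne_zero.2 h)).trans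
    (Equiv.addLeft (x * y))) fun z => K x y z

end Average

section Group

variable (pp : Params) [Fact pp.P.Prime]

/-- The least residue of `g ^ z`, for an exponent `z` modulo `Q`. -/
def Params.gpow (z : ZMod pp.Q) : ℕ := ((pp.g : ZMod pp.P) ^ z.val).val

theorem Params.gpow_lt (z : ZMod pp.Q) : pp.gpow z < pp.P := ZMod.val_lt _

theorem Params.cast_gpow (z : ZMod pp.Q) :
    (pp.gpow z : ZMod pp.P) = (pp.g : ZMod pp.P) ^ z.val := by
  rw [Params.gpow, ZMod.natCast_zmod_val]

theorem mod_eq_of_cast_eq {P m k : ℕ} (h : (m : ZMod P) = k) (hk : k < P) : m % P = k := by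
  rw [ZMod.natCast_eq_natCast_iff'] at h
  rwa [Nat.mod_eq_of_lt hk] at h

theorem cast_powMod {P : ℕ} [NeZero P] (b e : ℕ) : (powMod b e P : ZMod P) = (b : ZMod P) ^ e := by
  rw [powMod, if_neg (NeZero.ne P), ZMod.natCast_mod, Nat.cast_pow]

theorem powMod_lt {P : ℕ} [NeZero P] (b e : ℕ) : powMod b e P < P := by
  rw [powMod, if_neg (NeZero.ne P)]
  exact Nat.mod_lt _ (NeZero.pos P)

variable {pp} [Fact pp.Q.Prime] (hg : orderOf (pp.g : ZMod pp.P) = pp.Q)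

include hg

theorem g_pow_eq {j k : ℕ} (h : (j : ZMod pp.Q) = k) :
    (pp.g : ZMod pp.P) ^ j = (pp.g : ZMod pp.P) ^ k := by
  rw [ZMod.natCast_eq_natCast_iff'] at h
  rw [← pow_mod_orderOf, hg, h, ← hg, pow_mod_orderOf]

theorem pow_eq_gpow (k : ℕ) : pp.pow k = pp.gpow k := by
  refine mod_eq_of_cast_eq ?_ (pp.gpow_lt _)
  rw [pp.cast_gpow, Nat.cast_pow]
  exact g_pow_eq hg (by simp)

theorem cast_gpow_add (x y : ZMod pp.Q) :
    (pp.gpow (x + y) : ZMod pp.P) = pp.gpow x * pp.gpow y := by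
  simp only [pp.cast_gpow, ← pow_add]
  exact g_pow_eq hg (by simp)

theorem cast_gpow_mul (x : ZMod pp.Q) (k : ℕ) :
    (pp.gpow (x * k) : ZMod pp.P) = (pp.gpow x : ZMod pp.P) ^ k := by
  simp only [pp.cast_gpow, ← pow_mul]
  exact g_pow_eq hg (by simp)

theorem gpow_injective : Function.Injective pp.gpow := by
  intro x y h
  have h : (pp.g : ZMod pp.P) ^ x.val = (pp.g : ZMod pp.P) ^ y.val := ZMod.val_injective _ h
  exact ZMod.val_injective _ (pow_injOn_Iio_orderOf (by simpa [hg] using x.val_lt)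
    (by simpa [hg] using y.val_lt) h)

/-- Membership in `G_Q` can be tested by one exponentiation, since `ℤ_P^*` has only `Q` elements
with `m^Q = 1`. -/
theorem mem_group_iff (m : ℕ) : m ∈ pp.group ↔ m < pp.P ∧ powMod m pp.Q pp.P = 1 := by
  have h1 : powMod m pp.Q pp.P = 1 ↔ (m : ZMod pp.P) ^ pp.Q = 1 := by
    rw [← cast_powMod]
    constructor
    · intro h
      rw [h, Nat.cast_one]
    · intro h
      have := mod_eq_of_cast_eq (P := pp.P) (m := powMod m pp.Q pp.P) (k := 1) (by simpa using h)
        (Fact.out : pp.P.Prime).one_lt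
      rwa [Nat.mod_eq_of_lt (powMod_lt _ _)] at this
  rw [Params.group, Set.mem_ofPred_eq, h1]
  refine and_congr_right fun _ => ⟨?_, fun h => ?_⟩
  · rintro ⟨k, hk⟩
    rw [← hk]
    simp only
    rw [← pow_mul, mul_comm, pow_mul, ← hg, pow_orderOf_eq_one, one_pow]
  · have hprim : IsPrimitiveRoot (pp.g : ZMod pp.P) pp.Q := hg ▸ IsPrimitiveRoot.orderOf _
    have : NeZero pp.Q := ⟨(Fact.out : pp.Q.Prime).ne_zero⟩
    obtain ⟨i, -, hi⟩ := hprim.eq_pow_of_pow_eq_one h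
    exact ⟨i, hi⟩

theorem exists_gpow_of_mem_group {m : ℕ} (h : m ∈ pp.group) : ∃ z, m = pp.gpow z := by
  obtain ⟨h1, k, hk⟩ := h
  refine ⟨k, ?_⟩
  rw [← Nat.mod_eq_of_lt h1]
  refine mod_eq_of_cast_eq ?_ (pp.gpow_lt _)
  rw [← hk, pp.cast_gpow]
  exact g_pow_eq hg (by simp)

end Group

/-! ### Analysis of the self-reduction -/

/-- The decoding of a one-bit answer. -/
def answerBit (r : Word) : Bool := decide (r = [some true])

theorem monad_bind_eq {α β : Type} (μ : PMF α) (f : α → PMF β) : μ >>= f = μ.bind f := rfl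

theorem monad_pure_eq {α : Type} (a : α) : (pure a : PMF α) = PMF.pure a := rfl

theorem map_answerBit_apply (μ : PMF Word) : μ.map answerBit true = μ [some true] := by
  classical
  rw [PMF.map_apply, tsum_eq_single [some true]]
  · simp [answerBit]
  · intro r hr
    simp [answerBit, hr]

theorem answer_map (r : Word) : (answer r).map answerBit = PMF.pure (answerBit r) := by
  rw [answer]
  split_ifs with h <;> simp [PMF.pure_map, answerBit, h]

section Field

theorem headField_append {w : Word} (hw : ∀ x ∈ w, x.isSome) (v : Word) :
    headField (w ++ none :: v) = w := by
  rw [headField, List.takeWhile_append_of_pos hw]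
  simp

theorem tailFields_append {w : Word} (hw : ∀ x ∈ w, x.isSome) (v : Word) :
    tailFields (w ++ none :: v) = v := by
  rw [tailFields, List.dropWhile_append_of_pos hw]
  simp

theorem encFields_cons (w : Word) (ws : List Word) :
    encFields (w :: ws) = w ++ none :: encFields ws := by simp [encFields]

theorem field_encFields {ws : List Word} (hws : ∀ w ∈ ws, ∀ x ∈ w, x.isSome) (k : ℕ)
    (hk : k < ws.length) : field k (encFields ws) = ws[k] := by
  induction k generalizing ws with
  | zero =>
    rcases ws with _ | ⟨w, ws⟩
    · simp at hk
    · rw [encFields_cons]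
      exact headField_append (hws w (by simp)) _
  | succ k ih =>
    rcases ws with _ | ⟨w, ws⟩
    · simp at hk
    · have : field (k + 1) (encFields (w :: ws)) = field k (encFields ws) := by
        rw [field, Function.iterate_succ_apply, encFields_cons, tailFields_append (hws w (by simp))]
        rfl
      rw [this, ih (fun v hv => hws v (List.mem_cons_of_mem _ hv)) (by simpa using hk)]
      rfl

theorem isSome_of_mem_unary {n : ℕ} {x : IOSymbol} (h : x ∈ unary n) : x.isSome := by
  rw [List.eq_of_mem_replicate h]
  rfl

theorem field_ddhInput (n : ℕ) (pp : Params) (X Y Z : ℕ) (k : ℕ) (hk : k < 7) :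
    field k (ddhInput n pp X Y Z) =
      [unary n, encNat pp.P, encNat pp.Q, encNat pp.g, encNat X, encNat Y, encNat Z][k] :=
  field_encFields (by
    intro w hw x hx
    simp only [List.mem_cons, List.not_mem_nil, or_false] at hw
    rcases hw with rfl | rfl | rfl | rfl | rfl | rfl | rfl
    · exact isSome_of_mem_unary hx
    all_goals exact isSome_of_mem_encNat hx) k (by simpa using hk)

end Field

section Analysis

variable (F A : PPT) (n : ℕ) (pp : Params)

/-- The answer of the second adversary, if `w` is the output of the first one: the keys are
`yA = X` and `yB`, and the ciphertext is `(Y, gB, m_β T)`. -/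
noncomputable def stage (X Y T : ℕ) (yB gB : ℕ) (β : Bool) (w : Word) : PMF Word :=
  (A.output (encFields (publicFields n pp X yB ++ [encNat Y, encNat gB,
    encNat (decNat (headField (if β then tailFields w else w)) * T % pp.P)]) ++
      tailFields (tailFields w)))

variable {pp} [Fact pp.P.Prime] [Fact pp.Q.Prime] (hg : orderOf (pp.g : ZMod pp.P) = pp.Q)

include hg

open Classical in
/-- The computable checks in `challenge` are those of the indistinguishability experiment. -/
theorem challenge_eq (β : Bool) (X Y T yB gB : ℕ) :
    (challenge F A β (unary n) pp.P pp.Q pp.g X yB Y gB T).map answerBit =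
      (F.output (encFields (publicFields n pp X yB))).bind fun w =>
        if decNat (headField w) ∈ pp.group ∧ decNat (headField (tailFields w)) ∈ pp.group then
          (stage A n pp X Y T yB gB β w).map answerBit
        else PMF.pure false := by
  rw [challenge, PMF.map_bind]
  refine congrArg (PMF.bind _) (funext fun w => ?_)
  have hno : (PMF.pure [some false] : PMF Word).map answerBit = PMF.pure false := by
    rw [PMF.pure_map]; rfl
  simp only [mem_group_iff hg, apply_ite (PMF.map answerBit), hno]
  by_cases h1 : pp.P ≤ decNat (headField w)
  · rw [if_pos h1, if_neg fun h => absurd h.1.1 (not_lt.2 h1)]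
  by_cases h2 : pp.P ≤ decNat (headField (tailFields w))
  · rw [if_neg h1, if_pos h2, if_neg fun h => absurd h.2.1 (not_lt.2 h2)]
  by_cases h3 : powMod (decNat (headField w)) pp.Q pp.P = 1
  · by_cases h4 : powMod (decNat (headField (tailFields w))) pp.Q pp.P = 1
    · have h : (decNat (headField w) < pp.P ∧ powMod (decNat (headField w)) pp.Q pp.P = 1) ∧
          decNat (headField (tailFields w)) < pp.P ∧
            powMod (decNat (headField (tailFields w))) pp.Q pp.P = 1 :=
        ⟨⟨not_le.1 h1, h3⟩, not_le.1 h2, h4⟩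
      rw [if_neg h1, if_neg h2, if_pos h3, if_pos h4, if_pos h, PMF.map_bind]
      simp only [answer_map]
      rfl
    · rw [if_neg h1, if_neg h2, if_pos h3, if_neg h4, if_neg fun h => h4 h.2.2]
  · rw [if_neg h1, if_neg h2, if_neg h3, if_neg fun h => h3 h.1.2]

omit [Fact pp.P.Prime] [Fact pp.Q.Prime] hg in
theorem challenge_congr [Fact pp.P.Prime] (β : Bool) (nw : Word) (X Y yB gB : ℕ) {T T' : ℕ}
    (h : (T : ZMod pp.P) = T') : challenge F A β nw pp.P pp.Q pp.g X yB Y gB T =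
      challenge F A β nw pp.P pp.Q pp.g X yB Y gB T' := by
  have : ∀ m, m * T % pp.P = m * T' % pp.P := fun m => by
    rw [← Nat.ModEq, ← ZMod.natCast_eq_natCast_iff]
    push_cast
    rw [h]
  simp only [challenge, this]

end Analysis

section Experiment

variable (F A : PPT) (n : ℕ) (pp : Params) [Fact pp.P.Prime]

/-- The success probability of the experiment with key `yA = g^x`, randomness `y` of the encryption
and with `g^z` in the place of `yA^y yB^kB`. -/
noncomputable def success (β : Bool) (x y z xB kB : ZMod pp.Q) : ℝ :=
  (challenge F A β (unary n) pp.P pp.Q pp.g (pp.gpow x) (pp.gpow xB) (pp.gpow y) (pp.gpow kB)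
    (pp.gpow z) [some true]).toReal

theorem success_mem (β : Bool) (x y z xB kB : ZMod pp.Q) :
    success F A n pp β x y z xB kB ∈ Set.Icc (0 : ℝ) 1 := toReal_nonneg_le_one _ _

variable [Fact pp.Q.Prime]

/-- The success probability averaged over the second layer of the ciphertext. -/
noncomputable def layered (β : Bool) (x y z : ZMod pp.Q) : ℝ :=
  avg fun xB => avg fun kB => success F A n pp β x y (z + xB * kB) xB kB

variable {pp} (hg : orderOf (pp.g : ZMod pp.P) = pp.Q)

include hg

/-- A trial on `(g^a, g^b, g^c)`, with all group elements written as powers of `g`. -/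
theorem trialAt_eq (β : Bool) (a b c u v w xB kB : ℕ) :
    trialAt F A β (unary n) pp.P pp.Q pp.g (pp.pow a) (pp.pow b) (pp.pow c) u v w xB kB =
      challenge F A β (unary n) pp.P pp.Q pp.g (pp.gpow (a * w + u)) (pp.gpow xB)
        (pp.gpow (b + v)) (pp.gpow kB) (pp.gpow ((c + a * v) * w + (b + v) * u + xB * kB)) := by
  have h1 : powMod (pp.pow a) w pp.P * powMod pp.g u pp.P % pp.P = pp.gpow (a * w + u) := by
    refine mod_eq_of_cast_eq ?_ (pp.gpow_lt _)
    rw [Nat.cast_mul, cast_powMod, cast_powMod, cast_gpow_add hg, cast_gpow_mul hg,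
      pow_eq_gpow hg, ← Nat.cast_pow, pp.cast_gpow u]
    rw [Nat.cast_pow]
    congr 1
    exact g_pow_eq hg (by simp)
  have h2 : ∀ k : ℕ, powMod pp.g k pp.P = pp.gpow k := fun k => by
    rw [← pow_eq_gpow hg, powMod, if_neg (NeZero.ne _)]
    rfl
  have h3 : pp.pow b * powMod pp.g v pp.P % pp.P = pp.gpow (b + v) := by
    refine mod_eq_of_cast_eq ?_ (pp.gpow_lt _)
    rw [Nat.cast_mul, h2, cast_gpow_add hg, pow_eq_gpow hg]
  rw [trialAt, h1, h3, h2, h2]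
  refine challenge_congr F A β _ _ _ _ _ ?_
  simp only [Nat.cast_mul, cast_powMod, cast_gpow_add hg, cast_gpow_mul hg, pow_eq_gpow hg, h2]

theorem trial_apply (β : Bool) (a b c : ℕ) :
    (trial F A β (ddhInput n pp (pp.pow a) (pp.pow b) (pp.pow c)) [some true]).toReal =
      ev (unif (range (2 ^ (n + pp.P.size)))) fun u => ev (unif (range (2 ^ (n + pp.P.size)))) fun v =>
      ev (unif (range (2 ^ (n + pp.P.size)))) fun w =>
      ev (unif (range (2 ^ (n + pp.P.size)))) fun xB =>
      ev (unif (range (2 ^ (n + pp.P.size)))) fun kB => success F A n pp β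
        (a * w + u) (b + v) ((c + a * v) * w + (b + v) * u + xB * kB) xB kB := by
  have hL := randomNat_eq (field 0 (ddhInput n pp (pp.pow a) (pp.pow b) (pp.pow c)) ++
    field 1 (ddhInput n pp (pp.pow a) (pp.pow b) (pp.pow c)))
  have hlen : (field 0 (ddhInput n pp (pp.pow a) (pp.pow b) (pp.pow c)) ++
      field 1 (ddhInput n pp (pp.pow a) (pp.pow b) (pp.pow c))).length = n + pp.P.size := by
    rw [field_ddhInput _ _ _ _ _ 0 (by norm_num), field_ddhInput _ _ _ _ _ 1 (by norm_num)]
    simp [unary, length_encNat]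
  rw [hlen] at hL
  rw [trial]
  simp only [hL, toReal_bind]
  simp only [field_ddhInput _ _ _ _ _ 0 (by norm_num), field_ddhInput _ _ _ _ _ 1 (by norm_num),
    field_ddhInput _ _ _ _ _ 2 (by norm_num), field_ddhInput _ _ _ _ _ 3 (by norm_num),
    field_ddhInput _ _ _ _ _ 4 (by norm_num), field_ddhInput _ _ _ _ _ 5 (by norm_num),
    field_ddhInput _ _ _ _ _ 6 (by norm_num), List.getElem_cons_zero, List.getElem_cons_succ,
    decNat_encNat, trialAt_eq F A n hg, success]

/-- The trial on `(g^a, g^b, g^c)` is close to the trial with uniform exponents modulo `Q`. -/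
theorem abs_trial_sub_le (hQP : pp.Q ≤ pp.P) (β : Bool) (a b c : ℕ) :
    |(trial F A β (ddhInput n pp (pp.pow a) (pp.pow b) (pp.pow c)) [some true]).toReal -
      avg fun u : ZMod pp.Q => avg fun v : ZMod pp.Q => avg fun w : ZMod pp.Q =>
        layered F A n pp β (a * w + u) (b + v)
          ((c + a * v) * w + (b + v) * u)| ≤ 5 * (2⁻¹ : ℝ) ^ n := by
  have hdelta : (pp.Q : ℝ) / (2 ^ (n + pp.P.size) : ℕ) ≤ (2⁻¹ : ℝ) ^ n := by
    have h1 : pp.Q < 2 ^ pp.P.size := hQP.trans_lt (Nat.lt_size_self _)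
    have h2 : (pp.Q : ℝ) ≤ 2 ^ pp.P.size := by exact_mod_cast h1.le
    rw [Nat.cast_pow, Nat.cast_two, pow_add, inv_pow, div_le_iff₀ (by positivity)]
    rw [← mul_assoc, inv_mul_cancel₀ (by positivity), one_mul]
    exact h2
  rw [trial_apply F A n hg]
  have hN : 2 ^ (n + pp.P.size) ≠ 0 := by positivity
  generalize 2 ^ (n + pp.P.size) = N at *
  generalize hδ : (pp.Q : ℝ) / N = δ at *
  have near : ∀ {f : ℕ → ℝ} {φ : ZMod pp.Q → ℝ} {ε : ℝ}, (∀ i, f i ∈ Set.Icc (0 : ℝ) 1) →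
      (∀ z, φ z ∈ Set.Icc (0 : ℝ) 1) → (∀ i : ℕ, |f i - φ i| ≤ ε) →
      |ev (unif (range N)) f - avg φ| ≤ ε + δ := fun h₁ h₂ h₃ =>
    hδ ▸ abs_ev_unif_sub_avg_le_add hN h₁ h₂ h₃
  have hs := success_mem F A n pp β
  simp only [layered]
  refine (near (ε := δ + δ + δ + δ)
    (fun u => ev_mem _ fun v => ev_mem _ fun w => ev_mem _ fun xB => ev_mem _ fun kB => hs _ _ _ _ _)
    (fun u => avg_mem fun v => avg_mem fun w => avg_mem fun xB => avg_mem fun kB => hs _ _ _ _ _)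
    fun u => ?_).trans (by linarith)
  refine near
    (fun v => ev_mem _ fun w => ev_mem _ fun xB => ev_mem _ fun kB => hs _ _ _ _ _)
    (fun v => avg_mem fun w => avg_mem fun xB => avg_mem fun kB => hs _ _ _ _ _) fun v => ?_
  refine near
    (fun w => ev_mem _ fun xB => ev_mem _ fun kB => hs _ _ _ _ _)
    (fun w => avg_mem fun xB => avg_mem fun kB => hs _ _ _ _ _) fun w => ?_
  refine near (fun xB => ev_mem _ fun kB => hs _ _ _ _ _)
    (fun xB => avg_mem fun kB => hs _ _ _ _ _) fun xB => ?_
  rw [← hδ]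
  exact abs_ev_unif_sub_avg_le hN (φ := fun kB : ZMod pp.Q => success F A n pp β (a * w + u) (b + v)
    ((c + a * v) * w + (b + v) * u + xB * kB) xB kB) fun kB => hs _ _ _ _ _

/-- In the indistinguishability experiment, the third component of the Diffie-Hellman triple formed
by the key and the randomness of the encryption has the exponent `x y`. -/
theorem indGame_eq (β : Bool) : (indGame F A n pp β true).toReal =
    avg fun y => avg fun x => layered F A n pp β x y (x * y) := by
  classical
  have h1 : ∀ xA xB kA kB : ℕ, (challenge F A β (unary n) pp.P pp.Q pp.g (pp.pow xA) (pp.pow xB)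
      (pp.pow kA) (pp.pow kB) (pp.pow xA ^ kA * pp.pow xB ^ kB) [some true]).toReal =
      success F A n pp β xA kA (xA * kA + xB * kB) xB kB := fun xA xB kA kB => by
    rw [success, pow_eq_gpow hg, pow_eq_gpow hg, pow_eq_gpow hg, pow_eq_gpow hg]
    rw [challenge_congr F A β _ _ _ _ _ (T' := pp.gpow (xA * kA + xB * kB))]
    rw [cast_gpow_add hg, cast_gpow_mul hg, cast_gpow_mul hg]
    push_cast
    rfl
  have h2 : indGame F A n pp β = (exponent pp).bind fun xA => (exponent pp).bind fun xB =>
      (exponent pp).bind fun kA => (exponent pp).bind fun kB =>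
      (challenge F A β (unary n) pp.P pp.Q pp.g (pp.pow xA) (pp.pow xB)
      (pp.pow kA) (pp.pow kB) (pp.pow xA ^ kA * pp.pow xB ^ kB)).map answerBit := by
    have h3 : indGame F A n pp β = (exponent pp).bind fun xA => (exponent pp).bind fun xB =>
        (F.output (encFields (publicFields n pp (pp.pow xA) (pp.pow xB)))).bind fun w =>
        if decNat (headField w) ∈ pp.group ∧ decNat (headField (tailFields w)) ∈ pp.group then
          (exponent pp).bind fun kA => (exponent pp).bind fun kB =>
            (stage A n pp (pp.pow xA) (pp.pow kA) (pp.pow xA ^ kA * pp.pow xB ^ kB) (pp.pow xB)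
              (pp.pow kB) β w).map answerBit
        else PMF.pure false := by
      have hassoc : ∀ m s t : ℕ, m * s % pp.P * t % pp.P = m * (s * t) % pp.P := fun m s t => by
        rw [Nat.mod_mul_mod, mul_assoc]
      have hm : ∀ w : Word, decNat (headField (if β then tailFields w else w)) =
          if β then decNat (headField (tailFields w)) else decNat (headField w) := fun w => by
        cases β <;> rfl
      simp only [indGame, keyGen, encrypt, reEncrypt, monad_bind_eq, monad_pure_eq,
        PMF.bind_bind, PMF.pure_bind, hassoc, stage, hm, PMF.map]
      rfl
    rw [h3]
    refine congrArg _ (funext fun xA => congrArg _ (funext fun xB => ?_))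
    simp only [challenge_eq F A n hg]
    have h4 : ∀ kA, ((exponent pp).bind fun kB =>
        (F.output (encFields (publicFields n pp (pp.pow xA) (pp.pow xB)))).bind fun w =>
        if decNat (headField w) ∈ pp.group ∧ decNat (headField (tailFields w)) ∈ pp.group then
          (stage A n pp (pp.pow xA) (pp.pow kA) (pp.pow xA ^ kA * pp.pow xB ^ kB) (pp.pow xB)
            (pp.pow kB) β w).map answerBit
        else PMF.pure false) = _ := fun kA => PMF.bind_comm _ _ _
    simp only [h4]
    rw [PMF.bind_comm]
    refine congrArg _ (funext fun w => ?_)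
    split_ifs
    · rfl
    · rw [PMF.bind_const, PMF.bind_const]
  rw [h2]
  simp only [toReal_bind, map_answerBit_apply, h1]
  have h5 : ∀ S : ZMod pp.Q → ZMod pp.Q → ZMod pp.Q → ZMod pp.Q → ℝ,
      (ev (exponent pp) fun xA => ev (exponent pp) fun xB => ev (exponent pp) fun kA =>
        ev (exponent pp) fun kB => S xA xB kA kB) =
      avg fun x => avg fun xB => avg fun y => avg fun kB => S x xB y kB := fun S => by
    refine (congrArg (ev _) (funext fun xA => ?_)).trans (ev_exponent pp rfl fun x =>
      avg fun xB => avg fun y => avg fun kB => S x xB y kB)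
    refine (congrArg (ev _) (funext fun xB => ?_)).trans (ev_exponent pp rfl fun xB =>
      avg fun y => avg fun kB => S xA xB y kB)
    refine (congrArg (ev _) (funext fun kA => ?_)).trans (ev_exponent pp rfl fun y =>
      avg fun kB => S xA xB y kB)
    exact ev_exponent pp rfl fun kB => S xA xB kA kB
  rw [h5 fun x xB y kB => success F A n pp β x y (x * y + xB * kB) xB kB]
  exact Eq.trans (congrArg avg (funext fun x => avg_comm _)) (avg_comm _)

/-- If the exponent of the third component is uniform, then the message is perfectly hidden. -/
theorem avg_layered_eq (x y : ZMod pp.Q) : (avg fun z => layered F A n pp true x y z) =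
    avg fun z => layered F A n pp false x y z := by
  have h1 : ∀ β, (avg fun z => layered F A n pp β x y z) =
      avg fun xB => avg fun kB => avg fun z => success F A n pp β x y z xB kB := by
    intro β
    simp only [layered]
    rw [avg_comm]
    refine congrArg avg (funext fun xB => ?_)
    rw [avg_comm]
    refine congrArg avg (funext fun kB => ?_)
    exact avg_congr_equiv (Equiv.addRight (xB * kB)) fun z => success F A n pp β x y z xB kB
  rw [h1, h1]
  refine congrArg avg (funext fun xB => congrArg avg (funext fun kB => ?_))
  classical
  let p : Word → ℕ → ℝ := fun w t => ((A.output (encFields (publicFields n pp (pp.gpow x) (pp.gpow xB)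
    ++ [encNat (pp.gpow y), encNat (pp.gpow kB), encNat t]) ++
      tailFields (tailFields w))) [some true]).toReal
  -- The success probability, as an expectation over the output of the first adversary.
  let φ : Bool → ZMod pp.Q → Word → ℝ := fun β z w =>
    if decNat (headField w) ∈ pp.group ∧ decNat (headField (tailFields w)) ∈ pp.group then
      p w (decNat (headField (if β then tailFields w else w)) * pp.gpow z % pp.P) else 0
  have h2 : ∀ β z, success F A n pp β x y z xB kB =
      ev (F.output (encFields (publicFields n pp (pp.gpow x) (pp.gpow xB)))) (φ β z) := by
    intro β z
    rw [success, ← map_answerBit_apply, challenge_eq F A n hg, toReal_bind]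
    refine congrArg _ (funext fun w => ?_)
    by_cases hw : decNat (headField w) ∈ pp.group ∧ decNat (headField (tailFields w)) ∈ pp.group
    · simp only [φ, if_pos hw]
      rw [map_answerBit_apply]
      rfl
    · simp only [φ, if_neg hw]
      simp
  have h3 : ∀ β z w, |φ β z w| ≤ 1 := by
    intro β z w
    by_cases hw : decNat (headField w) ∈ pp.group ∧ decNat (headField (tailFields w)) ∈ pp.group
    · simp only [φ, if_pos hw]
      have := toReal_nonneg_le_one (A.output (encFields (publicFields n pp (pp.gpow x)
        (pp.gpow xB) ++ [encNat (pp.gpow y), encNat (pp.gpow kB), encNat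
        (decNat (headField (if β then tailFields w else w)) * pp.gpow z % pp.P)]) ++
        tailFields (tailFields w))) [some true]
      exact abs_le.2 ⟨by linarith [this.1], this.2⟩
    · simp only [φ, if_neg hw]
      simp
  simp only [h2]
  rw [avg_ev _ (h3 true), avg_ev _ (h3 false)]
  refine congrArg _ (funext fun w => ?_)
  by_cases hw : decNat (headField w) ∈ pp.group ∧ decNat (headField (tailFields w)) ∈ pp.group
  · -- A message in the group is a power of the generator, which shifts the uniform exponent.
    have h4 : ∀ β, (avg fun z => φ β z w) = avg fun z => p w (pp.gpow z) := by
      intro β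
      have hm : decNat (headField (if β then tailFields w else w)) ∈ pp.group := by
        cases β
        · exact hw.1
        · exact hw.2
      obtain ⟨μ, hμ⟩ := exists_gpow_of_mem_group hg hm
      rw [← avg_congr_equiv (Equiv.addLeft μ) fun z => p w (pp.gpow z)]
      refine congrArg avg (funext fun z => ?_)
      simp only [φ, if_pos hw, hμ, Equiv.coe_addLeft]
      rw [mod_eq_of_cast_eq (k := pp.gpow (μ + z)) _ (pp.gpow_lt _)]
      rw [Nat.cast_mul, cast_gpow_add hg]
    rw [h4, h4]
  · simp only [φ, if_neg hw]

/-- On Diffie-Hellman triples the trial simulates the indistinguishability experiment. -/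
theorem abs_trial_sub_indGame_le (hQP : pp.Q ≤ pp.P) (β : Bool) {a b c : ℕ}
    (h : pp.pow c = pp.pow (a * b)) :
    |(trial F A β (ddhInput n pp (pp.pow a) (pp.pow b) (pp.pow c)) [some true]).toReal -
      (indGame F A n pp β true).toReal| ≤ 5 * (2⁻¹ : ℝ) ^ n := by
  have := abs_trial_sub_le F A n hg hQP β a b c
  rw [pow_eq_gpow hg, pow_eq_gpow hg] at h
  have hc := gpow_injective hg h
  rw [Nat.cast_mul] at hc
  rwa [avg_rerandomize_of_eq (fun x y z => layered F A n pp β x y z) hc, ← indGame_eq F A n hg] at this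

/-- The success probability of the trial with exponents that form a random triple. -/
noncomputable def blind : ℝ :=
  avg fun y => avg fun x => avg fun z => layered F A n pp false x y z

/-- On other triples the trial is almost independent of the choice of the message. -/
theorem abs_trial_sub_blind_le (hQP : pp.Q ≤ pp.P) (β : Bool) {a b c : ℕ}
    (h : pp.pow c ≠ pp.pow (a * b)) :
    |(trial F A β (ddhInput n pp (pp.pow a) (pp.pow b) (pp.pow c)) [some true]).toReal -
      blind F A n (pp := pp)| ≤ 5 * (2⁻¹ : ℝ) ^ n := by
  have := abs_trial_sub_le F A n hg hQP β a b c
  rw [pow_eq_gpow hg, pow_eq_gpow hg] at h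
  have hc : (c : ZMod pp.Q) ≠ a * b := fun hc => h (by rw [hc, Nat.cast_mul])
  rw [avg_rerandomize_of_ne (fun x y z => layered F A n pp β x y z) hc] at this
  cases β
  · exact this
  · simp only [avg_layered_eq F A n hg] at this
    exact this

end Experiment

/-! ### Concentration of repeated experiments -/

section Concentration

variable {α β : Type}

theorem tsum_bind_mul (μ : PMF α) (f : α → PMF β) (φ : β → ENNReal) :
    ∑' b, μ.bind f b * φ b = ∑' a, μ a * ∑' b, f a b * φ b := by
  simp only [PMF.bind_apply, ← ENNReal.tsum_mul_right, ← ENNReal.tsum_mul_left]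
  rw [ENNReal.tsum_comm]
  simp only [mul_assoc]

theorem tsum_pure_mul (a : α) (φ : α → ENNReal) : ∑' b, PMF.pure a b * φ b = φ a := by
  rw [tsum_eq_single a fun b hb => by simp [PMF.pure_apply, hb]]
  simp [PMF.pure_apply]

theorem tsum_mul_ofReal (μ : PMF α) {φ : α → ℝ} {C : ℝ} (h0 : ∀ a, 0 ≤ φ a) (hC : ∀ a, φ a ≤ C) :
    ∑' a, μ a * ENNReal.ofReal (φ a) = ENNReal.ofReal (ev μ φ) := by
  rw [ev, ENNReal.ofReal_tsum_of_nonneg (fun a => mul_nonneg ENNReal.toReal_nonneg (h0 a))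
    (summable_ev μ fun a => (abs_of_nonneg (h0 a)).trans_le (hC a))]
  refine tsum_congr fun a => ?_
  rw [ENNReal.ofReal_mul ENNReal.toReal_nonneg, ENNReal.ofReal_toReal (μ.apply_ne_top a)]

/-- The exponential moments of the number of answers `1`. -/
theorem exp_moment_countOnes_le (e : PMF Word) (x : ℝ) (hx : |x| ≤ 1) (l : Word) :
    ∑' v, countOnes e l v * ENNReal.ofReal (Real.exp (x * v.length)) ≤
      ENNReal.ofReal (Real.exp (l.length * ((e [some true]).toReal * x + x ^ 2))) := by
  classical
  set q := (e [some true]).toReal with hq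
  have hq0 : 0 ≤ q := ENNReal.toReal_nonneg
  have hq1 : q ≤ 1 := (toReal_nonneg_le_one e _).2
  have hstep : ∑' r, e r * ENNReal.ofReal (if r = [some true] then Real.exp x else 1) ≤
      ENNReal.ofReal (Real.exp (q * x + x ^ 2)) := by
    rw [tsum_mul_ofReal e (C := Real.exp x + 1)]
    · refine ENNReal.ofReal_le_ofReal ?_
      have h1 : ev e (fun r => if r = [some true] then Real.exp x else 1) =
          1 + q * (Real.exp x - 1) := by
        have h2 : ev e (fun r => if r = [some true] then (1 : ℝ) else 0) = q := by
          rw [ev, tsum_eq_single [some true]]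
          · simp [hq]
          · intro r hr
            simp [hr]
        have h3 : ∀ r : Word, (if r = [some true] then Real.exp x else 1) =
            1 + (Real.exp x - 1) * (if r = [some true] then (1 : ℝ) else 0) := by
          intro r
          split_ifs <;> ring
        simp only [h3]
        rw [ev_add e (C := 1) (D := |Real.exp x - 1|) (by simp) (by
          intro r
          split_ifs <;> simp), ev_const]
        congr 1
        rw [← h2, ev, ev, ← tsum_mul_right]
        exact tsum_congr fun r => by ring
      rw [h1]
      have h4 := (abs_le.1 (Real.abs_exp_sub_one_sub_id_le hx)).2
      have h5 : q * (Real.exp x - 1) ≤ q * x + x ^ 2 := by nlinarith [sq_nonneg x]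
      linarith [Real.add_one_le_exp (q * x + x ^ 2)]
    · intro r
      split_ifs <;> positivity
    · intro r
      split_ifs <;> linarith [Real.exp_pos x]
  induction l using List.reverseRecOn with
  | nil =>
    rw [countOnes, List.foldlM_nil]
    exact (tsum_pure_mul _ _).trans_le (by simp)
  | append_singleton l y ih =>
    rw [countOnes_append_singleton, tsum_bind_mul]
    have h1 : ∀ v : Word, ∑' w, (e.bind fun r => if r = [some true] then PMF.pure (some true :: v)
        else PMF.pure v) w * ENNReal.ofReal (Real.exp (x * w.length)) =
        ENNReal.ofReal (Real.exp (x * v.length)) *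
          ∑' r, e r * ENNReal.ofReal (if r = [some true] then Real.exp x else 1) := by
      intro v
      rw [tsum_bind_mul, ← ENNReal.tsum_mul_left]
      refine tsum_congr fun r => ?_
      rw [mul_left_comm]
      congr 1
      split_ifs
      · rw [tsum_pure_mul, ← ENNReal.ofReal_mul (Real.exp_pos _).le, ← Real.exp_add]
        congr 2
        simp
        ring
      · rw [tsum_pure_mul]
        simp
    simp only [h1, ← mul_assoc]
    rw [ENNReal.tsum_mul_right]
    refine (mul_le_mul' ih hstep).trans_eq ?_
    rw [← ENNReal.ofReal_mul (Real.exp_pos _).le, ← Real.exp_add]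
    congr 2
    simp
    ring

/-- Markov's inequality for the exponential moments; the sign of `x` decides between the upper and
the lower tail. -/
theorem tail_countOnes_le (e : PMF Word) {x : ℝ} (hx : |x| ≤ 1) (l : Word) (t : ℝ) :
    ((countOnes e l).toOuterMeasure {v | t ≤ x * v.length}).toReal ≤
      Real.exp (l.length * ((e [some true]).toReal * x + x ^ 2) - t) := by
  refine ENNReal.toReal_le_of_le_ofReal (Real.exp_pos _).le ?_
  rw [PMF.toOuterMeasure_apply, Real.exp_sub, div_eq_mul_inv,
    ENNReal.ofReal_mul (Real.exp_pos _).le, ← Real.exp_neg]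
  refine le_trans ?_ (mul_le_mul_left (exp_moment_countOnes_le e x hx l) _)
  rw [← ENNReal.tsum_mul_right]
  refine ENNReal.tsum_le_tsum fun v => ?_
  by_cases hv : v ∈ {v : Word | t ≤ x * v.length}
  · rw [Set.indicator_of_mem hv, mul_assoc, ← ENNReal.ofReal_mul (Real.exp_pos _).le, ← Real.exp_add]
    refine le_mul_of_one_le_right zero_le (ENNReal.one_le_ofReal.2 (Real.one_le_exp ?_))
    have : t ≤ x * v.length := hv
    linarith
  · rw [Set.indicator_of_notMem hv]
    exact zero_le

/-- Chernoff bound for the number of answers `1`. -/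
theorem countOnes_concentration (e : PMF Word) (l : Word) {η : ℝ} (h0 : 0 ≤ η) (h2 : η ≤ 2) :
    ((countOnes e l).toOuterMeasure
      {v | η * l.length ≤ |(v.length : ℝ) - (e [some true]).toReal * l.length|}).toReal ≤
      2 * Real.exp (-(η ^ 2 * l.length / 4)) := by
  set q := (e [some true]).toReal
  set T : ℝ := (List.length l : ℝ)
  have hsub : {v : Word | η * T ≤ |(v.length : ℝ) - q * T|} ⊆
      {v : Word | η / 2 * ((q + η) * T) ≤ η / 2 * v.length} ∪
      {v : Word | -(η / 2) * ((q - η) * T) ≤ -(η / 2) * v.length} := by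
    intro v hv
    have hv : η * T ≤ |(v.length : ℝ) - q * T| := hv
    rcases le_abs.1 hv with h | h
    · have h' : (q + η) * T ≤ v.length := by linarith
      exact Or.inl (mul_le_mul_of_nonneg_left h' (by linarith : 0 ≤ η / 2))
    · have h' : v.length ≤ (q - η) * T := by linarith
      exact Or.inr (mul_le_mul_of_nonpos_left h' (by linarith : -(η / 2) ≤ 0))
  have hab : |η / 2| ≤ 1 := abs_le.2 ⟨by linarith, by linarith⟩
  have hab' : |-(η / 2)| ≤ 1 := by rwa [abs_neg]
  have h3 := tail_countOnes_le e hab l (η / 2 * ((q + η) * T))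
  have h4 := tail_countOnes_le e hab' l (-(η / 2) * ((q - η) * T))
  have htop : ∀ s : Set Word, (countOnes e l).toOuterMeasure s ≠ ⊤ := fun s =>
    ((PMF.toOuterMeasure_mono _ (Set.subset_univ _)).trans_lt (by
      rw [(PMF.toOuterMeasure_apply_eq_one_iff _ _).2 (Set.subset_univ _)]
      exact ENNReal.one_lt_top)).ne
  refine (ENNReal.toReal_mono (ENNReal.add_ne_top.2 ⟨htop _, htop _⟩)
    ((MeasureTheory.measure_mono hsub).trans (MeasureTheory.measure_union_le _ _))).trans
    (ENNReal.toReal_add_le.trans ((add_le_add h3 h4).trans_eq ?_))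
  rw [two_mul, show T * (q * (η / 2) + (η / 2) ^ 2) - η / 2 * ((q + η) * T) = -(η ^ 2 * T / 4) by ring,
    show T * (q * -(η / 2) + (-(η / 2)) ^ 2) - -(η / 2) * ((q - η) * T) = -(η ^ 2 * T / 4) by ring]

end Concentration

/-! ### Deciding the Diffie-Hellman problem -/

theorem abs_natCast_sub (a b : ℕ) : (((a - b) + (b - a) : ℕ) : ℝ) = |(a : ℝ) - b| := by
  rcases le_total a b with h | h
  · rw [Nat.sub_eq_zero_of_le h, zero_add, Nat.cast_sub h, abs_sub_comm, abs_of_nonneg]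
    exact sub_nonneg.2 (Nat.cast_le.2 h)
  · rw [Nat.sub_eq_zero_of_le h, add_zero, Nat.cast_sub h, abs_of_nonneg]
    exact sub_nonneg.2 (Nat.cast_le.2 h)

/-- The comparison of the two counts gives the right answer if both counts are close to their
expectations and the success probabilities `q₁`, `q₀` differ by almost `n^(-d)` or by almost `0`. -/
theorem compare_counts {n d s₁ s₀ : ℕ} {q₁ q₀ : ℝ} (hn : 0 < n) (ans : Bool)
    (hq : cond ans (7 / (8 * (n : ℝ) ^ d) ≤ |q₁ - q₀|) (|q₁ - q₀| ≤ 1 / (8 * (n : ℝ) ^ d)))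
    (h₁ : |(s₁ : ℝ) - q₁ * (n ^ (2 * d + 2) : ℕ)| < 1 / (8 * (n : ℝ) ^ d) * (n ^ (2 * d + 2) : ℕ))
    (h₀ : |(s₀ : ℝ) - q₀ * (n ^ (2 * d + 2) : ℕ)| < 1 / (8 * (n : ℝ) ^ d) * (n ^ (2 * d + 2) : ℕ)) :
    decide (n ^ (2 * d + 2) ≤ 2 * n ^ d * ((s₁ - s₀) + (s₀ - s₁))) = ans := by
  have hiff : n ^ (2 * d + 2) ≤ 2 * n ^ d * ((s₁ - s₀) + (s₀ - s₁)) ↔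
      ((n ^ (2 * d + 2) : ℕ) : ℝ) ≤ 2 * (n : ℝ) ^ d * |(s₁ : ℝ) - s₀| := by
    rw [← abs_natCast_sub]
    exact_mod_cast Iff.rfl
  have hT : (0 : ℝ) < (n ^ (2 * d + 2) : ℕ) := by positivity
  have hN : (0 : ℝ) < (n : ℝ) ^ d := by positivity
  generalize ((n ^ (2 * d + 2) : ℕ) : ℝ) = T at *
  generalize (n : ℝ) ^ d = N at *
  -- The difference of the counts is the difference of the expectations up to `T / (4 N)`.
  have hdiff : |((s₁ : ℝ) - s₀) - (q₁ - q₀) * T| < T / (4 * N) := by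
    have h : ((s₁ : ℝ) - s₀) - (q₁ - q₀) * T = (s₁ - q₁ * T) - (s₀ - q₀ * T) := by ring
    rw [h]
    refine (abs_sub _ _).trans_lt ?_
    have : T / (4 * N) = 1 / (8 * N) * T + 1 / (8 * N) * T := by field_simp; ring
    linarith
  have hmul : |(q₁ - q₀) * T| = |q₁ - q₀| * T := by rw [abs_mul, abs_of_pos hT]
  have hlow := abs_sub_abs_le_abs_sub ((q₁ - q₀) * T) ((s₁ : ℝ) - s₀)
  have hup := abs_sub_abs_le_abs_sub ((s₁ : ℝ) - s₀) ((q₁ - q₀) * T)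
  rw [abs_sub_comm ((q₁ - q₀) * T)] at hlow
  cases ans
  · rw [decide_eq_false_iff_not, hiff, not_le]
    have h1 : |q₁ - q₀| * T ≤ 1 / (8 * N) * T := mul_le_mul_of_nonneg_right hq hT.le
    have h2 : |(s₁ : ℝ) - s₀| < 3 * T / (8 * N) := by
      have : 3 * T / (8 * N) = 1 / (8 * N) * T + T / (4 * N) := by field_simp; ring
      linarith
    calc 2 * N * |(s₁ : ℝ) - s₀| < 2 * N * (3 * T / (8 * N)) :=
          mul_lt_mul_of_pos_left h2 (by linarith)
      _ = 3 / 4 * T := by field_simp; ring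
      _ < T := by linarith
  · rw [decide_eq_true_eq, hiff]
    have h1 : 7 / (8 * N) * T ≤ |q₁ - q₀| * T := mul_le_mul_of_nonneg_right hq hT.le
    have h2 : 5 * T / (8 * N) ≤ |(s₁ : ℝ) - s₀| := by
      have : 5 * T / (8 * N) = 7 / (8 * N) * T - T / (4 * N) := by field_simp; ring
      linarith
    calc T ≤ 5 / 4 * T := by linarith
      _ = 2 * N * (5 * T / (8 * N)) := by field_simp; ring
      _ ≤ 2 * N * |(s₁ : ℝ) - s₀| := mul_le_mul_of_nonneg_left h2 (by linarith)

/-- The decision procedure is correct, up to an exponentially small error, if the success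
probabilities of the two trials differ by almost `n^(-d)` or by almost `0`. -/
theorem decideDDH_correct (F A : PPT) (d : ℕ) (x : Word) (ans : Bool) (hn : 0 < (field 0 x).length)
    (hq : cond ans
      (7 / (8 * ((field 0 x).length : ℝ) ^ d) ≤
        |(trial F A true x [some true]).toReal - (trial F A false x [some true]).toReal|)
      (|(trial F A true x [some true]).toReal - (trial F A false x [some true]).toReal| ≤
        1 / (8 * ((field 0 x).length : ℝ) ^ d))) :
    1 - 4 * Real.exp (-((field 0 x).length ^ 2 / 256)) ≤
      (decideDDH F A d x [some ans]).toReal := by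
  classical
  set n := (field 0 x).length
  set T := n ^ (2 * d + 2) with hT
  set η : ℝ := 1 / (8 * (n : ℝ) ^ d) with hη
  have hNpos : (0 : ℝ) < (n : ℝ) ^ d := by positivity
  have hη0 : 0 ≤ η := by positivity
  have hη2 : η ≤ 2 := by
    rw [hη, div_le_iff₀ (by positivity)]
    have : (1 : ℝ) ≤ (n : ℝ) ^ d := one_le_pow₀ (by exact_mod_cast hn)
    linarith
  let bad : Bool → Set Word := fun β =>
    {v | η * (unary T).length ≤ |(v.length : ℝ) - (trial F A β x [some true]).toReal *
      (unary T).length|}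
  have hbad : ∀ β, ev (countOnes (trial F A β x) (unary T)) (fun v => if v ∈ bad β then 1 else 0) ≤
      2 * Real.exp (-((n : ℝ) ^ 2 / 256)) := by
    intro β
    rw [← toReal_toOuterMeasure]
    refine (countOnes_concentration _ _ hη0 hη2).trans_eq ?_
    congr 3
    rw [unary, List.length_replicate, hη, hT]
    push_cast
    field_simp
    ring
  have hb : ∀ β (v : Word), |(if v ∈ bad β then (1 : ℝ) else 0)| ≤ 1 := by
    intro β v
    split_ifs <;> simp
  rw [decideDDH, toReal_bind]
  have h1 : ∀ s₁ : Word, 1 - 2 * Real.exp (-((n : ℝ) ^ 2 / 256)) - (if s₁ ∈ bad true then 1 else 0) ≤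
      ((countOnes (trial F A false x) (unary T)).bind (fun s₀ =>
        if T ≤ 2 * n ^ d * ((s₁.length - s₀.length) + (s₀.length - s₁.length))
        then PMF.pure [some true] else PMF.pure [some false]) [some ans]).toReal := by
    intro s₁
    by_cases hs₁ : s₁ ∈ bad true
    · rw [if_pos hs₁]
      have := Real.exp_pos (-((n : ℝ) ^ 2 / 256))
      refine le_trans ?_ ENNReal.toReal_nonneg
      linarith
    rw [if_neg hs₁, sub_zero, toReal_bind]
    have h2 : ev (countOnes (trial F A false x) (unary T)) (fun v => 1 -
        if v ∈ bad false then 1 else 0) ≤ ev (countOnes (trial F A false x) (unary T)) fun s₀ =>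
        ((if T ≤ 2 * n ^ d * ((s₁.length - s₀.length) + (s₀.length - s₁.length))
        then PMF.pure [some true] else PMF.pure [some false] : PMF Word) [some ans]).toReal := by
      refine ev_mono _ (C := 2) (D := 1) (fun v => ?_) (fun v => ?_) fun s₀ _ => ?_
      · split_ifs <;> norm_num
      · have := toReal_nonneg_le_one (if T ≤ 2 * n ^ d * ((s₁.length - v.length) + (v.length -
          s₁.length)) then PMF.pure [some true] else PMF.pure [some false] : PMF Word) [some ans]
        exact abs_le.2 ⟨by linarith [this.1], this.2⟩
      · by_cases hs₀ : s₀ ∈ bad false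
        · rw [if_pos hs₀, sub_self]
          exact ENNReal.toReal_nonneg
        · rw [if_neg hs₀, sub_zero]
          simp only [bad, Set.mem_ofPred_eq, not_le, unary, List.length_replicate] at hs₁ hs₀
          have := compare_counts hn ans hq hs₁ hs₀
          rw [← this]
          by_cases hc : T ≤ 2 * n ^ d * ((s₁.length - s₀.length) + (s₀.length - s₁.length))
          · rw [if_pos hc, decide_eq_true hc]
            simp
          · rw [if_neg hc, decide_eq_false hc]
            simp
    rw [ev_sub _ (C := 1) (by simp) (hb false), ev_const] at h2
    linarith [hbad false]
  have he : 0 ≤ Real.exp (-((n : ℝ) ^ 2 / 256)) ∧ Real.exp (-((n : ℝ) ^ 2 / 256)) ≤ 1 :=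
    ⟨(Real.exp_pos _).le, Real.exp_le_one_iff.2 (neg_nonpos.2 (by positivity))⟩
  have hc : |1 - 2 * Real.exp (-((n : ℝ) ^ 2 / 256))| ≤ 3 :=
    abs_le.2 ⟨by linarith [he.2], by linarith [he.1]⟩
  have h3 := ev_mono (countOnes (trial F A true x) (unary T)) (C := 4) (D := 1)
    (fun s₁ => (abs_sub _ _).trans (by linarith [hb true s₁]))
    (fun s₁ => by
      rw [abs_of_nonneg ENNReal.toReal_nonneg]
      exact (toReal_nonneg_le_one _ _).2) fun s₁ _ => h1 s₁
  rw [ev_sub _ (fun _ => hc) (hb true), ev_const] at h3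
  linarith [hbad true]

/-! ### Instances of the system parameters -/

/-- What the analysis needs about an instance; the last inequality says that `1/Q` is exponentially
small for a fixed `γ`. -/
theorem Params.IsInstance.facts {δ γ n : ℕ} {pp : Params} (h : pp.IsInstance δ γ n) :
    pp.P.Prime ∧ pp.Q.Prime ∧ orderOf (pp.g : ZMod pp.P) = pp.Q ∧ pp.Q ≤ pp.P ∧
      2 ^ n ≤ 4 * γ * pp.Q := by
  obtain ⟨hP, hQ, hg⟩ := h
  rw [moduli, mem_filter] at hP
  obtain ⟨-, hP, hsize, hdvd, hQ'⟩ := hP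
  rw [← hQ] at hQ'
  refine ⟨hP, hQ', ?_, ?_, ?_⟩
  · classical
    rw [generators, mem_filter] at hg
    exact hg.2
  · rw [hQ]
    exact (Nat.div_le_self _ _).trans (Nat.sub_le _ _)
  · have h1 : γ * pp.Q = pp.P - 1 := by rw [hQ, Nat.mul_div_cancel' hdvd]
    have h2 : 2 ^ (n + δ - 1) ≤ pp.P := Nat.lt_size.1 (by
      rw [hsize]
      have : 0 < pp.P.size := Nat.size_pos.2 hP.pos
      omega)
    have h3 : 2 ^ n ≤ 2 * 2 ^ (n + δ - 1) := by
      rw [← pow_succ']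
      exact Nat.pow_le_pow_right (by norm_num) (by omega)
    have h4 := hP.two_le
    rw [mul_assoc, h1]
    omega

theorem generators_nonempty {P Q : ℕ} (hP : P.Prime) (hQ : Q.Prime) (h : Q ∣ P - 1) :
    (generators P Q).Nonempty := by
  classical
  have := Fact.mk hP
  have := Fact.mk hQ
  obtain ⟨u, hu⟩ := exists_prime_orderOf_dvd_card (G := (ZMod P)ˣ) Q (by rwa [ZMod.card_units])
  refine ⟨(u : ZMod P).val, ?_⟩
  rw [generators, mem_filter, mem_range, ZMod.natCast_zmod_val, orderOf_units]
  exact ⟨ZMod.val_lt _, hu⟩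

theorem isInstance_of_mem_support {δ γ n : ℕ} (hne : (moduli δ γ n).Nonempty) {pp : Params}
    (h : pp ∈ (setup δ γ n).support) : pp.IsInstance δ γ n := by
  simp only [setup, monad_bind_eq, monad_pure_eq, PMF.mem_support_bind_iff,
    PMF.mem_support_pure_iff] at h
  obtain ⟨P, hP, g, hg, rfl⟩ := h
  rw [unif, dif_pos hne, PMF.mem_support_uniformOfFinset_iff] at hP
  have hP' := hP
  rw [moduli, mem_filter] at hP'
  have hgen := generators_nonempty hP'.2.1 hP'.2.2.2.2 (Nat.div_dvd_of_dvd hP'.2.2.2.1)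
  rw [unif, dif_pos hgen, PMF.mem_support_uniformOfFinset_iff] at hg
  exact ⟨hP, rfl, hg⟩

/-! ### Negligible functions -/

theorem negligible_two_inv_pow : Negligible fun n : ℕ => (2⁻¹ : ℝ) ^ n := fun k =>
  tendsto_pow_const_mul_const_pow_of_abs_lt_one k (by rw [abs_of_pos] <;> norm_num)

theorem Negligible.of_le {f g : ℕ → ℝ} (hg : Negligible g) (h : ∀ᶠ n in atTop, |f n| ≤ g n) :
    Negligible f :=
  Asymptotics.SuperpolynomialDecay.trans_eventually_abs_le hg
    (h.mono fun _ hn => hn.trans (le_abs_self _))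

theorem Negligible.add {f g : ℕ → ℝ} (hf : Negligible f) (hg : Negligible g) :
    Negligible fun n => f n + g n := Asymptotics.SuperpolynomialDecay.add hf hg

theorem Negligible.const_mul {f : ℕ → ℝ} (hf : Negligible f) (c : ℝ) :
    Negligible fun n => c * f n := Asymptotics.SuperpolynomialDecay.const_mul hf c

theorem exp_neg_sq_le {n : ℕ} (hn : 256 ≤ n) : Real.exp (-((n : ℝ) ^ 2 / 256)) ≤ (2⁻¹ : ℝ) ^ n := by
  have h1 : (n : ℝ) ≤ (n : ℝ) ^ 2 / 256 := by
    have : (256 : ℝ) ≤ n := by exact_mod_cast hn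
    rw [le_div_iff₀ (by norm_num)]
    nlinarith
  have h2 : Real.exp (-1) ≤ 2⁻¹ := by
    rw [Real.exp_neg]
    exact inv_anti₀ (by norm_num) (by linarith [Real.add_one_le_exp (1 : ℝ)])
  calc Real.exp (-((n : ℝ) ^ 2 / 256)) ≤ Real.exp (n * (-1)) := Real.exp_le_exp.2 (by linarith)
    _ = Real.exp (-1) ^ n := Real.exp_nat_mul _ _
    _ ≤ 2⁻¹ ^ n := pow_le_pow_left₀ (Real.exp_pos _).le h2 n

open Classical in
/-- A bound for the error probability of the decision procedure. It is the trivial bound for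
`n = 0` and for the finitely many `n` with `2^n < 80 n^d`, for which the errors of the trials are
too large. -/
noncomputable def decisionError (d n : ℕ) : ℝ :=
  if 0 < n ∧ 80 * n ^ d ≤ 2 ^ n then 4 * Real.exp (-((n : ℝ) ^ 2 / 256)) else 1

theorem negligible_decisionError (d : ℕ) : Negligible (decisionError d) := by
  refine (negligible_two_inv_pow.const_mul 4).of_le ?_
  have h1 := (negligible_two_inv_pow.const_mul 80) d
  have h2 : ∀ᶠ n : ℕ in atTop, (n : ℝ) ^ d * (80 * 2⁻¹ ^ n) < 1 := h1.eventually_lt_const one_pos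
  filter_upwards [h2, eventually_ge_atTop 256] with n hn hn'
  have h3 : 80 * n ^ d ≤ 2 ^ n := by
    have h : 80 * (n : ℝ) ^ d ≤ 2 ^ n := by
      rw [inv_pow, ← mul_assoc, ← div_eq_mul_inv, div_lt_one (by positivity)] at hn
      linarith
    exact_mod_cast h
  rw [decisionError, if_pos ⟨by omega, h3⟩, abs_of_nonneg (by positivity)]
  exact mul_le_mul_of_nonneg_left (exp_neg_sq_le hn') (by norm_num)

/-! ### Adversaries yield solvers -/

/-- The decision procedure solves the decision Diffie-Hellman problem for all parameters for which
the advantage is at least `n^-d`. -/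
theorem exists_solver (δ γ : ℕ) (F A : PPT) (d : ℕ) : ∃ M : PPT, ∃ ε : ℕ → ℝ, Negligible ε ∧
    ∀ (n : ℕ) (pp : Params), pp.IsInstance δ γ n →
      1 ≤ (n : ℝ) ^ d * indAdvantageAt F A n pp → SolvesDDHAt M n pp (1 - ε n) := by
  obtain ⟨M, hM⟩ := exists_ppt_decideDDH F A d
  refine ⟨M, decisionError d, negligible_decisionError d, fun n pp hI hadv a _ b _ c _ => ?_⟩
  obtain ⟨hP, hQ, hg, hQP, -⟩ := hI.facts
  have := Fact.mk hP
  have := Fact.mk hQ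
  rw [hM, decisionError]
  split_ifs with hn
  swap
  · rw [sub_self]
    exact ENNReal.toReal_nonneg
  obtain ⟨hn, hn2⟩ := hn
  set x := ddhInput n pp (pp.pow a) (pp.pow b) (pp.pow c) with hx
  have hlen : (field 0 x).length = n := by
    rw [hx, field_ddhInput _ _ _ _ _ 0 (by norm_num)]
    simp [unary]
  have hN : (0 : ℝ) < (n : ℝ) ^ d := by positivity
  have hsmall : 10 * (2⁻¹ : ℝ) ^ n ≤ 1 / (8 * (n : ℝ) ^ d) := by
    have h : 80 * (n : ℝ) ^ d ≤ 2 ^ n := by exact_mod_cast hn2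
    rw [le_div_iff₀ (by positivity), inv_pow, mul_assoc, inv_mul_eq_div, ← mul_div_assoc,
      div_le_one (by positivity)]
    linarith
  have := decideDDH_correct F A d x (decide (pp.pow c = pp.pow (a * b))) (by rwa [hlen])
  rw [hlen] at this
  refine this ?_
  by_cases hc : pp.pow c = pp.pow (a * b)
  · rw [decide_eq_true hc]
    have h1 := abs_trial_sub_indGame_le F A n hg hQP true hc
    have h0 := abs_trial_sub_indGame_le F A n hg hQP false hc
    rw [← hx] at h1 h0
    rw [indAdvantageAt] at hadv
    have h2 : 1 / (n : ℝ) ^ d ≤ |(indGame F A n pp true true).toReal -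
        (indGame F A n pp false true).toReal| := by
      rw [div_le_iff₀ hN]
      linarith
    have h3 : 7 / (8 * (n : ℝ) ^ d) = 1 / (n : ℝ) ^ d - 1 / (8 * (n : ℝ) ^ d) := by
      field_simp
      norm_num
    change 7 / (8 * (n : ℝ) ^ d) ≤ _
    rw [h3]
    generalize (trial F A true x [some true]).toReal = t₁ at *
    generalize (trial F A false x [some true]).toReal = t₀ at *
    generalize (indGame F A n pp true true).toReal = i₁ at *
    generalize (indGame F A n pp false true).toReal = i₀ at *
    have h4 : |i₁ - i₀| ≤ |t₁ - t₀| + (|t₁ - i₁| + |t₀ - i₀|) := by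
      rw [show i₁ - i₀ = (t₁ - t₀) - ((t₁ - i₁) - (t₀ - i₀)) by ring]
      exact (abs_sub _ _).trans (add_le_add_right (abs_sub _ _) _)
    linarith
  · rw [decide_eq_false hc]
    have h1 := abs_trial_sub_blind_le F A n hg hQP true hc
    have h0 := abs_trial_sub_blind_le F A n hg hQP false hc
    rw [← hx] at h1 h0
    change _ ≤ 1 / (8 * (n : ℝ) ^ d)
    rw [abs_sub_comm] at h0
    have := abs_sub_le (trial F A true x [some true]).toReal (blind F A n (pp := pp))
      (trial F A false x [some true]).toReal
    linarith

theorem indAdvantageAt_mem (F A : PPT) (n : ℕ) (pp : Params) :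
    indAdvantageAt F A n pp ∈ Set.Icc (0 : ℝ) 1 := by
  have h1 := toReal_nonneg_le_one (indGame F A n pp true) true
  have h0 := toReal_nonneg_le_one (indGame F A n pp false) true
  exact ⟨abs_nonneg _, abs_le.2 ⟨by linarith [h1.1, h0.2], by linarith [h1.2, h0.1]⟩⟩

theorem abs_toReal_le (μ : PMF Bool) : |(μ true).toReal| ≤ 1 := by
  rw [abs_of_nonneg ENNReal.toReal_nonneg]
  exact (toReal_nonneg_le_one μ true).2

theorem indAdvantage_le (δ γ : ℕ) (F A : PPT) (n : ℕ) :
    indAdvantage δ γ F A n ≤ ev (setup δ γ n) fun pp => indAdvantageAt F A n pp := by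
  have hb : ∀ pp, |indAdvantageAt F A n pp| ≤ 1 := fun pp => by
    rw [abs_of_nonneg (indAdvantageAt_mem F A n pp).1]
    exact (indAdvantageAt_mem F A n pp).2
  have hd : ∀ pp, |(indGame F A n pp true true).toReal - (indGame F A n pp false true).toReal| ≤ 1 :=
    fun pp => (indAdvantageAt_mem F A n pp).2
  rw [indAdvantage]
  split_ifs
  · rw [toReal_bind, toReal_bind, ← ev_sub _ (fun pp => abs_toReal_le _) fun pp => abs_toReal_le _]
    refine abs_le.2 ⟨?_, ev_mono _ hd hb fun pp _ => le_abs_self _⟩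
    have := ev_mono (setup δ γ n) (fun pp => (abs_neg _).trans_le (hb pp)) hd
      fun pp _ => neg_abs_le ((indGame F A n pp true true).toReal - (indGame F A n pp false true).toReal)
    refine le_trans (le_of_eq ?_) this
    simp only [ev, mul_neg, tsum_neg]
  · exact (ev_mem _ fun pp => indAdvantageAt_mem F A n pp).1

/-- A non-negligible average advantage forces a non-negligible fraction of parameters with large
advantage, by Markov's inequality. -/
theorem exists_solvesDDH (δ γ : ℕ) (h : ¬ INDSecure δ γ) : ∃ M : PPT, SolvesDDH δ γ M := by
  classical
  rw [INDSecure] at h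
  push Not at h
  obtain ⟨F, A, h⟩ := h
  rw [Negligible, Asymptotics.SuperpolynomialDecay] at h
  push Not at h
  obtain ⟨k, hk⟩ := h
  rw [Metric.tendsto_atTop] at hk
  push Not at hk
  obtain ⟨η, hη, hk⟩ := hk
  obtain ⟨M, ε, hε, hM⟩ := exists_solver δ γ F A (k + 1)
  refine ⟨M, ε, hε, k + 1, frequently_atTop.2 fun N => ?_⟩
  obtain ⟨n, hn, hadv⟩ := hk (max N (max 1 ⌈2 / η⌉₊))
  have hnN : N ≤ n := (le_max_left _ _).trans hn
  have hn1 : 1 ≤ n := ((le_max_left _ _).trans (le_max_right _ _)).trans hn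
  have hn2 : 2 / η ≤ n := (Nat.le_ceil _).trans
    (by exact_mod_cast ((le_max_right _ _).trans (le_max_right _ _)).trans hn)
  have hne : (moduli δ γ n).Nonempty := by
    by_contra hne
    rw [indAdvantage, if_neg hne, mul_zero, dist_self] at hadv
    linarith
  have hnonneg : 0 ≤ indAdvantage δ γ F A n := by
    rw [indAdvantage, if_pos hne]
    exact abs_nonneg _
  have hN : (0 : ℝ) < (n : ℝ) ^ (k + 1) := by positivity
  rw [Real.dist_eq, sub_zero, abs_of_nonneg (by positivity)] at hadv
  -- The extra factor `n` absorbs the constant.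
  have h2 : 2 ≤ (n : ℝ) ^ (k + 1) * indAdvantage δ γ F A n := by
    have h3 : 2 ≤ n * η := (div_le_iff₀ hη).1 hn2
    have h4 : (n : ℝ) * η ≤ n * ((n : ℝ) ^ k * indAdvantage δ γ F A n) :=
      mul_le_mul_of_nonneg_left hadv (Nat.cast_nonneg _)
    calc (2 : ℝ) ≤ n * ((n : ℝ) ^ k * indAdvantage δ γ F A n) := h3.trans h4
      _ = _ := by ring
  refine ⟨n, hnN, hne, ?_⟩
  set S := {pp | SolvesDDHAt M n pp (1 - ε n)}
  have hind : ∀ pp, |(if pp ∈ S then (1 : ℝ) else 0)| ≤ 1 := fun pp => by split_ifs <;> simp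
  have hpos : (0 : ℝ) ≤ 1 / (n : ℝ) ^ (k + 1) := by positivity
  -- Markov's inequality: the advantage is at most `n^(-k-1)` outside `S`.
  have h3 : ev (setup δ γ n) (fun pp => indAdvantageAt F A n pp) ≤
      ev (setup δ γ n) (fun pp => (if pp ∈ S then (1 : ℝ) else 0) + 1 / (n : ℝ) ^ (k + 1)) := by
    refine ev_mono _ (C := 1) (D := 1 + 1 / (n : ℝ) ^ (k + 1)) (fun pp => ?_) (fun pp => ?_)
      fun pp hpp => ?_
    · rw [abs_of_nonneg (indAdvantageAt_mem F A n pp).1]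
      exact (indAdvantageAt_mem F A n pp).2
    · refine (abs_add_le _ _).trans (add_le_add (hind pp) ?_)
      rw [abs_of_nonneg hpos]
    · by_cases hS : pp ∈ S
      · rw [if_pos hS]
        linarith [(indAdvantageAt_mem F A n pp).2]
      · rw [if_neg hS, zero_add, le_div_iff₀ hN]
        by_contra hlt
        exact hS (hM n pp (isInstance_of_mem_support hne hpp) (by linarith))
  rw [ev_add _ hind (fun _ => (abs_of_nonneg hpos).le), ev_const, ← toReal_toOuterMeasure] at h3
  have h4 := (indAdvantage_le δ γ F A n).trans h3
  have h5 := mul_le_mul_of_nonneg_left h4 hN.le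
  rw [mul_add, mul_one_div_cancel hN.ne'] at h5
  linarith

/-! ### The decision Diffie-Hellman assumption implies security -/

theorem abs_ev_sub_le {α : Type} (μ : PMF α) {φ ψ : α → ℝ} {C ε : ℝ} (hφ : ∀ a, |φ a| ≤ C)
    (hψ : ∀ a, |ψ a| ≤ C) (h : ∀ a ∈ μ.support, |φ a - ψ a| ≤ ε) : |ev μ φ - ev μ ψ| ≤ ε := by
  rw [← ev_sub μ hφ hψ]
  exact abs_ev_le μ (fun a => (abs_sub _ _).trans (add_le_add (hφ a) (hψ a))) h

theorem ddhGame_eq (D : PPT) (n : ℕ) (pp : Params) (real : Bool) :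
    (ddhGame D n pp real true).toReal = ev (exponent pp) fun a => ev (exponent pp) fun b =>
      ev (exponent pp) fun c => (D.output (ddhInput n pp (pp.pow a) (pp.pow b)
        (if real then pp.pow (a * b) else pp.pow c)) [some true]).toReal := by
  have : ddhGame D n pp real = (exponent pp).bind fun a => (exponent pp).bind fun b =>
      (exponent pp).bind fun c => (D.output (ddhInput n pp (pp.pow a) (pp.pow b)
        (if real then pp.pow (a * b) else pp.pow c))).map answerBit := rfl
  rw [this]
  simp only [toReal_bind, map_answerBit_apply]

section Hybrid

variable (F A : PPT) (n : ℕ) {pp : Params} [Fact pp.P.Prime] [Fact pp.Q.Prime]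
  (hg : orderOf (pp.g : ZMod pp.P) = pp.Q) (hQP : pp.Q ≤ pp.P)

include hg hQP

/-- On Diffie-Hellman triples the distinguisher simulates the indistinguishability experiment. -/
theorem abs_ddhGame_real_sub_le {D : PPT} {β : Bool} (hD : ∀ x, D.output x = trial F A β x) :
    |(ddhGame D n pp true true).toReal - (indGame F A n pp β true).toReal| ≤
      5 * (2⁻¹ : ℝ) ^ n := by
  rw [ddhGame_eq]
  have hb := fun x => abs_of_nonneg (toReal_nonneg_le_one (D.output x) [some true]).1 |>.trans_le
    (toReal_nonneg_le_one (D.output x) [some true]).2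
  have hm := fun x => toReal_nonneg_le_one (D.output x) [some true]
  have habs : ∀ {r : ℝ}, r ∈ Set.Icc (0 : ℝ) 1 → |r| ≤ 1 := fun h => (abs_of_nonneg h.1).trans_le h.2
  have hi := abs_toReal_le (indGame F A n pp β)
  generalize hr : (indGame F A n pp β true).toReal = i at *
  rw [← ev_const (exponent pp) i]
  refine abs_ev_sub_le _ (fun a => habs (ev_mem _ fun b => ev_mem _ fun c => hm _)) (fun _ => hi)
    fun a _ => ?_
  rw [← ev_const (exponent pp) i]
  refine abs_ev_sub_le _ (fun b => habs (ev_mem _ fun c => hm _)) (fun _ => hi) fun b _ => ?_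
  rw [← ev_const (exponent pp) i]
  refine abs_ev_sub_le _ (fun c => habs (hm _)) (fun _ => hi) fun c _ => ?_
  rw [if_pos rfl, hD, ← hr]
  exact abs_trial_sub_indGame_le F A n hg hQP β rfl

/-- On random triples the distinguishers for the two messages behave almost alike; the exception of
probability `1/Q` are the random triples that are Diffie-Hellman triples. -/
theorem abs_ddhGame_random_sub_le {D₁ D₀ : PPT} (h₁ : ∀ x, D₁.output x = trial F A true x)
    (h₀ : ∀ x, D₀.output x = trial F A false x) :
    |(ddhGame D₁ n pp false true).toReal - (ddhGame D₀ n pp false true).toReal| ≤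
      (pp.Q : ℝ)⁻¹ + 10 * (2⁻¹ : ℝ) ^ n := by
  classical
  rw [ddhGame_eq, ddhGame_eq]
  have hm := fun (D : PPT) x => toReal_nonneg_le_one (D.output x) [some true]
  have habs : ∀ {r : ℝ}, r ∈ Set.Icc (0 : ℝ) 1 → |r| ≤ 1 := fun h => (abs_of_nonneg h.1).trans_le h.2
  refine abs_ev_sub_le _ (fun a => habs (ev_mem _ fun b => ev_mem _ fun c => hm _ _))
    (fun a => habs (ev_mem _ fun b => ev_mem _ fun c => hm _ _)) fun a _ => ?_
  refine abs_ev_sub_le _ (fun b => habs (ev_mem _ fun c => hm _ _))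
    (fun b => habs (ev_mem _ fun c => hm _ _)) fun b _ => ?_
  set η := 10 * (2⁻¹ : ℝ) ^ n with hη
  have hη0 : 0 ≤ η := by positivity
  have hind : ev (exponent pp) (fun c => if pp.pow c = pp.pow (a * b) then (1 : ℝ) else 0) =
      (pp.Q : ℝ)⁻¹ := by
    have h : ∀ c : ℕ, (if pp.pow c = pp.pow (a * b) then (1 : ℝ) else 0) =
        if (c : ZMod pp.Q) = (a * b : ℕ) then 1 else 0 := fun c => by
      simp only [pow_eq_gpow hg, (gpow_injective hg).eq_iff]
    simp only [h]
    rw [ev_exponent pp rfl fun z => if z = ((a * b : ℕ) : ZMod pp.Q) then (1 : ℝ) else 0, avg]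
    simp
  have hib : ∀ c : ℕ, |(if pp.pow c = pp.pow (a * b) then (1 : ℝ) else 0)| ≤ 1 := fun c => by
    split_ifs <;> simp
  have hsub : ∀ c, |(D₁.output (ddhInput n pp (pp.pow a) (pp.pow b) (pp.pow c))
      [some true]).toReal - (D₀.output (ddhInput n pp (pp.pow a) (pp.pow b) (pp.pow c))
      [some true]).toReal| ≤ (if pp.pow c = pp.pow (a * b) then (1 : ℝ) else 0) + η := by
    intro c
    split_ifs with hc
    · have k₁ := hm D₁ (ddhInput n pp (pp.pow a) (pp.pow b) (pp.pow c))
      have k₀ := hm D₀ (ddhInput n pp (pp.pow a) (pp.pow b) (pp.pow c))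
      exact abs_le.2 ⟨by linarith [k₁.1, k₀.2], by linarith [k₁.2, k₀.1]⟩
    · have k₁ := abs_trial_sub_blind_le F A n hg hQP true hc
      have k₀ := abs_trial_sub_blind_le F A n hg hQP false hc
      rw [abs_sub_comm] at k₀
      rw [h₁, h₀]
      have := abs_sub_le (trial F A true (ddhInput n pp (pp.pow a) (pp.pow b) (pp.pow c))
        [some true]).toReal (blind F A n (pp := pp)) (trial F A false
        (ddhInput n pp (pp.pow a) (pp.pow b) (pp.pow c)) [some true]).toReal
      linarith
  have hev : ev (exponent pp) (fun c => (if pp.pow c = pp.pow (a * b) then (1 : ℝ) else 0) + η) =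
      (pp.Q : ℝ)⁻¹ + η := by
    rw [ev_add _ hib (fun _ => (abs_of_nonneg hη0).le), hind, ev_const]
  have hC : ∀ c : ℕ, |(if pp.pow c = pp.pow (a * b) then (1 : ℝ) else 0) + η| ≤ 1 + η := fun c =>
    (abs_add_le _ _).trans (add_le_add (hib c) (abs_of_nonneg hη0).le)
  have hC' : ∀ c, |(D₁.output (ddhInput n pp (pp.pow a) (pp.pow b) (pp.pow c))
      [some true]).toReal - (D₀.output (ddhInput n pp (pp.pow a) (pp.pow b) (pp.pow c))
      [some true]).toReal| ≤ 2 := fun c => by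
    have k₁ := habs (hm D₁ (ddhInput n pp (pp.pow a) (pp.pow b) (pp.pow c)))
    have k₀ := habs (hm D₀ (ddhInput n pp (pp.pow a) (pp.pow b) (pp.pow c)))
    exact (abs_sub _ _).trans (by linarith)
  simp only [Bool.false_eq_true, if_false]
  rw [← ev_sub _ (fun c => habs (hm D₁ _)) (fun c => habs (hm D₀ _)), ← hev]
  refine abs_le.2 ⟨?_, ev_mono _ hC' hC fun c _ => (abs_le.1 (hsub c)).2⟩
  have := ev_mono (exponent pp) (fun c => (abs_neg _).trans_le (hC c)) hC'
    fun c _ => (abs_le.1 (hsub c)).1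
  refine le_trans (le_of_eq ?_) this
  simp only [ev, mul_neg, tsum_neg]

end Hybrid

/-- The two messages are linked by the chain: experiment for `m₁`, trial for `m₁` on real and then
on random triples, trial for `m₀` on random and then on real triples, experiment for `m₀`. -/
theorem indSecure_of_ddhAssumption (δ γ : ℕ) (h : DDHAssumption δ γ) : INDSecure δ γ := by
  intro F A
  obtain ⟨D₁, h₁⟩ := exists_ppt_trial F A true
  obtain ⟨D₀, h₀⟩ := exists_ppt_trial F A false
  refine Negligible.of_le (((h D₁).add (h D₀)).add
    (negligible_two_inv_pow.const_mul (20 + 4 * γ))) (Eventually.of_forall fun n => ?_)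
  have hpow : (0 : ℝ) ≤ 2⁻¹ ^ n := by positivity
  by_cases hne : (moduli δ γ n).Nonempty
  swap
  · rw [indAdvantage, ddhAdvantage, ddhAdvantage, if_neg hne, if_neg hne, if_neg hne]
    simp only [abs_zero, zero_add]
    positivity
  simp only [indAdvantage, ddhAdvantage, if_pos hne, abs_abs]
  simp only [toReal_bind]
  have hb := fun (f : Params → PMF Bool) pp => abs_toReal_le (f pp)
  have hreal : ∀ (β : Bool) (D : PPT), (∀ x, D.output x = trial F A β x) →
      |ev (setup δ γ n) (fun pp => (ddhGame D n pp true true).toReal) -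
        ev (setup δ γ n) (fun pp => (indGame F A n pp β true).toReal)| ≤ 5 * (2⁻¹ : ℝ) ^ n := by
    intro β D hD
    refine abs_ev_sub_le _ (hb _) (hb _) fun pp hpp => ?_
    obtain ⟨hP, hQ, hg, hQP, -⟩ := (isInstance_of_mem_support hne hpp).facts
    have := Fact.mk hP
    have := Fact.mk hQ
    exact abs_ddhGame_real_sub_le F A n hg hQP hD
  have hrandom : |ev (setup δ γ n) (fun pp => (ddhGame D₁ n pp false true).toReal) -
      ev (setup δ γ n) (fun pp => (ddhGame D₀ n pp false true).toReal)| ≤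
      (10 + 4 * γ) * (2⁻¹ : ℝ) ^ n := by
    refine abs_ev_sub_le _ (hb _) (hb _) fun pp hpp => ?_
    obtain ⟨hP, hQ, hg, hQP, hQn⟩ := (isInstance_of_mem_support hne hpp).facts
    have := Fact.mk hP
    have := Fact.mk hQ
    refine (abs_ddhGame_random_sub_le F A n hg hQP h₁ h₀).trans ?_
    have hQn' : (2 : ℝ) ^ n ≤ 4 * γ * pp.Q := by exact_mod_cast hQn
    have hQ0 : (0 : ℝ) < pp.Q := by exact_mod_cast hQ.pos
    have : (pp.Q : ℝ)⁻¹ ≤ 4 * γ * 2⁻¹ ^ n := by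
      rw [inv_pow, ← div_eq_mul_inv, le_div_iff₀ (by positivity), inv_mul_le_iff₀ hQ0]
      linarith
    linarith
  have hr₁ := hreal true D₁ h₁
  have hr₀ := hreal false D₀ h₀
  generalize ev (setup δ γ n) (fun pp => (ddhGame D₁ n pp true true).toReal) = r₁ at *
  generalize ev (setup δ γ n) (fun pp => (ddhGame D₀ n pp true true).toReal) = r₀ at *
  generalize ev (setup δ γ n) (fun pp => (ddhGame D₁ n pp false true).toReal) = f₁ at *
  generalize ev (setup δ γ n) (fun pp => (ddhGame D₀ n pp false true).toReal) = f₀ at *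
  generalize ev (setup δ γ n) (fun pp => (indGame F A n pp true true).toReal) = i₁ at *
  generalize ev (setup δ γ n) (fun pp => (indGame F A n pp false true).toReal) = i₀ at *
  -- The chain of inequalities, in linear arithmetic.
  have e₁ := abs_le.1 hr₁
  have e₂ := abs_le.1 hr₀
  have e₃ := abs_le.1 hrandom
  have e₄ := neg_abs_le (r₁ - f₁)
  have e₅ := le_abs_self (r₁ - f₁)
  have e₆ := neg_abs_le (r₀ - f₀)
  have e₇ := le_abs_self (r₀ - f₀)
  exact abs_le.2 ⟨by linarith [e₁.1, e₁.2, e₂.1, e₂.2, e₃.1, e₃.2],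
    by linarith [e₁.1, e₁.2, e₂.1, e₂.2, e₃.1, e₃.2]⟩


theorem mainTheorem1 (δ γ : ℕ) :
    (∀ (F A : PPT) (d : ℕ), ∃ M : PPT, ∃ ε : ℕ → ℝ, Negligible ε ∧
      ∀ (n : ℕ) (pp : Params), pp.IsInstance δ γ n →
        1 ≤ (n : ℝ) ^ d * indAdvantageAt F A n pp → SolvesDDHAt M n pp (1 - ε n)) ∧
    (¬ INDSecure δ γ → ∃ M : PPT, SolvesDDH δ γ M) ∧
    (DDHAssumption δ γ → INDSecure δ γ) :=
  ⟨exists_solver δ γ, exists_solvesDDH δ γ, indSecure_of_ddhAssumption δ γ⟩
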